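/- **Setting.** Let $A=\mathbb C[t_1^{\pm1},t_2^{\pm1}]$, and write $t^n=t_1^{n(1)}t_2^{n(2)}$ for $n\in\mathbb Z^2$ and $\det\binom{n}{m}=n(1)m(2)-n(2)m(1)$. The centerless Virasoro-like algebra $\mathcal G$ is the Lie subalgebra of $\mathrm{Der}(A)$ spanned by $d_m=t^m\bigl(m(2)t_1\partial_{t_1}-m(1)t_2\partial_{t_2}\bigr)$, $m\in\mathbb Z^2\setminus\{0\}$, and $\mathcal G\ltimes A$ is the semidirect product with bracket $[x+f,y+g]=[x,y]+xg-yf$. Fix $\lambda\in\mathbb C\setminus\{0\}$. A *jet module* of parameter $\lambda$ is a $\mathbb Z^2$-graded $(\mathcal G\ltimes A)$-module $V=\bigoplus_{n\in\mathbb Z^2}V_n$ (with $d_m$ and $t^m$ of degree $m$) such that the dimensions $\dim V_n$ are finite and bounded, every $t^m$ with $m\ne0$ acts bijectively, $t^mt^nv=\lambda t^{m+n}v$ for all $v\in V$ and all nonzero $m,n$ with $m+n\neq0$, and the central element $t^0$ acts as $\lambda$. It is irreducible (indecomposable) if it is so as a $(\mathcal G\ltimes A)$-module; the zero module is neither. Isomorphism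 classes of jet modules are taken with respect to isomorphisms of $(\mathcal G\ltimes A)$-modules that preserve the gradation. Let $\mathcal B_+$ be the complex Lie algebra with basis $D_i$, $i\in\mathbb Z_+^2$, and $$[D_i,D_j]=\det\tbinom{j}{i}D_{i+j-(1,1)}\ \text{ if } i(1)+i(2)\ge2 \text{ and } j(1)+j(2)\ge2,\qquad [D_{(1,0)},D_{(0,1)}]=D_{(0,0)}=-[D_{(0,1)},D_{(1,0)}],$$ all other brackets of basis elements being $0$. Write $m^i=m(1)^{i(1)}m(2)^{i(2)}$ (with $0^0=1$) and $i!=i(1)!\,i(2)!$. For $m\in\mathbb Z^2$ let $$M(m)=\begin{pmatrix}m(1)m(2)&-m(1)^2\\ m(2)^2&-m(1)m(2)\end{pmatrix}\in\mathfrak{sl}_2(\mathbb C).$$ **Theorem.** 1. On every finite-dimensional $\mathcal B_+$-module only finitely many $D_i$ act nontrivially. If $V$ is an indecomposable jet module of parameter $\lambda$, then $V_0$ admits a unique $\mathcal B_+$-module structure such that $$d_mv=\lambda^{-1}t^m\sum_{i\in\mathbb Z_+^2}\frac{m^i}{i!}D_iv\qquad(m\in\mathbb Z^2\setminus\{0\},\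 v\in V_0).$$ For every finite-dimensional $\mathcal B_+$-module $U$ there is a unique action of $\mathcal G\ltimes A$ on $A\otimes U$ with $t^m(t^n\otimes v)=\lambda t^{m+n}\otimes v$ for all $m,n\in\mathbb Z^2$ and $$d_m(t^n\otimes v)=t^{m+n}\otimes\Bigl(\det\tbinom{n}{m}+\sum_{i\in\mathbb Z_+^2}\frac{m^i}{i!}D_i\Bigr)v\qquad(m\ne0).$$ If $U$ is indecomposable, then $A\otimes U$, graded by the $t^n\otimes U$, is an indecomposable jet module; and $V\mapsto V_0$, $U\mapsto A\otimes U$ are mutually inverse bijections between isomorphism classes of indecomposable jet modules of parameter $\lambda$ and isomorphism classes of indecomposable finite-dimensional $\mathcal B_+$-modules. Moreover, for indecomposable jet modules $V,W$ of parameter $\lambda$ there are an isomorphism $f:V\to W$ of $(\mathcal G\ltimes A)$-modules and a permutation $\varphi$ of $\mathbb Z^2$ with $f(V_k)=W_{\varphi(k)}$ for all $k$ if and only if, for some $n\in\mathbb Z^2$, the $\mathcal B_+$-module $V_0$ is isomorphic to the one obtained from $W_0$ by adding the scalar $-n(2)$ to $D_{(1,0)}$ and the scalar $n(1)$ to $D_{(0,1)}$.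 2. If $V$ is an irreducible jet module of parameter $\lambda$, then $V_0$ admits a unique $(\mathfrak{sl}_2\oplus\mathbb Cz_1\oplus\mathbb Cz_2)$-module structure (with $z_1,z_2$ central) such that $$d_mv=\lambda^{-1}t^m\bigl(M(m)+m(1)z_1+m(2)z_2\bigr)v\qquad(m\in\mathbb Z^2\setminus\{0\},\ v\in V_0),$$ and the $\mathcal B_+$-action of part 1 on $V_0$ is obtained from it through $D_{(2,0)}\mapsto-2e$, $D_{(0,2)}\mapsto2f$, $D_{(1,1)}\mapsto h$, $D_{(1,0)}\mapsto z_1$, $D_{(0,1)}\mapsto z_2$, and $D_i\mapsto0$ for all other $i$, where $e,f,h$ is the standard basis of $\mathfrak{sl}_2$. On every irreducible finite-dimensional $(\mathfrak{sl}_2\oplus\mathbb Cz_1\oplus\mathbb Cz_2)$-module $U$ the elements $z_1$ and $z_2$ act as scalars $-\alpha_2$ and $\alpha_1$ for a unique $\alpha=(\alpha_1,\alpha_2)\in\mathbb C^2$, and there is a unique action of $\mathcal G\ltimes A$ on $A\otimes U$ with $t^m(t^n\otimes v)=\lambda t^{m+n}\otimes v$ for all $m,n\in\mathbb Z^2$ and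 $$d_m(t^n\otimes v)=t^{m+n}\otimes\Bigl(M(m)+\det\tbinom{\alpha+n}{m}\Bigr)v\qquad(m\neq0).$$ With it $A\otimes U$, graded by the $t^n\otimes U$, is an irreducible jet module; and $V\mapsto V_0$, $U\mapsto A\otimes U$ are mutually inverse bijections between isomorphism classes of irreducible jet modules of parameter $\lambda$ and isomorphism classes of irreducible finite-dimensional $(\mathfrak{sl}_2\oplus\mathbb Cz_1\oplus\mathbb Cz_2)$-modules. -/

import Mathlib

open scoped TensorProduct

universe u

/- An associative algebra is viewed as a Lie algebra through its commutator. In particular a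
commutative algebra is an abelian Lie algebra. -/
attribute [local instance] LieRing.ofAssociativeRing

noncomputable section

namespace VirasoroJet

/-! ### The Laurent polynomial algebra and the centerless Virasoro-like algebra -/

/-- The Laurent polynomial algebra `A = ℂ[t₁^{±1}, t₂^{±1}]`. -/
abbrev Laurent : Type := AddMonoidAlgebra ℂ (ℤ × ℤ)

/-- The monomial `t^n = t₁^{n(1)} t₂^{n(2)}`. -/
def mono (n : ℤ × ℤ) : Laurent := AddMonoidAlgebra.single n 1

/-- The determinant `det (n over m) = n(1) m(2) - n(2) m(1)`. -/
def det2 {R : Type*} [CommRing R] (n m : R × R) : R := n.1 * m.2 - n.2 * m.1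

/-- An integer vector regarded as a complex vector. -/
def toC (n : ℤ × ℤ) : ℂ × ℂ := ((n.1 : ℂ), (n.2 : ℂ))

lemma linearMap_ext {M : Type*} [AddCommGroup M] [Module ℂ M] {f g : Laurent →ₗ[ℂ] M}
    (h : ∀ n, f (mono n) = g (mono n)) : f = g := by
  refine AddMonoidAlgebra.lhom_ext' fun n => ?_
  ext
  simpa [mono] using h n

lemma mono_mul (m n : ℤ × ℤ) : mono m * mono n = mono (m + n) := by
  simp [mono, AddMonoidAlgebra.single_mul_single]

/-- The linear map `t^n ↦ c(n) t^n`. -/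
def scaleLin (c : ℤ × ℤ → ℂ) : Laurent →ₗ[ℂ] Laurent :=
  (Finsupp.lsum ℂ fun n => (AddMonoidAlgebra.lsingle n).comp (c n • LinearMap.id)).comp
    (AddMonoidAlgebra.coeffLinearEquiv ℂ).toLinearMap

lemma scaleLin_mono (c : ℤ × ℤ → ℂ) (n : ℤ × ℤ) : scaleLin c (mono n) = c n • mono n := by
  simp [scaleLin, mono]

/-- The derivation of `A` with `t^n ↦ c(n) t^n`, for an additive map `c`. -/
def euler (c : ℤ × ℤ →+ ℂ) : Derivation ℂ Laurent Laurent :=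
  Derivation.mk' (scaleLin c) (by
    intro a b
    induction a using AddMonoidAlgebra.induction_linear with
    | zero => simp
    | add f g hf hg => simp only [add_mul, map_add, hf, hg, smul_eq_mul, mul_add]; ring
    | single m r =>
      induction b using AddMonoidAlgebra.induction_linear with
      | zero => simp
      | add f g hf hg => simp only [mul_add, map_add, hf, hg, smul_eq_mul, add_mul]; ring
      | single n s =>
        have e1 : (AddMonoidAlgebra.single m r : Laurent) = r • mono m := by simp [mono]
        have e2 : (AddMonoidAlgebra.single n s : Laurent) = s • mono n := by simp [mono]
        rw [e1, e2]
        simp only [mono_mul, map_smul, scaleLin_mono, map_add, smul_eq_mul,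
          mul_smul_comm, smul_mul_assoc, smul_smul, add_comm n m, add_smul, smul_add]
        rw [add_comm]
        congr 2 <;> ring)

lemma euler_mono (c : ℤ × ℤ →+ ℂ) (n : ℤ × ℤ) : euler c (mono n) = c n • mono n :=
  scaleLin_mono c n

/-- The derivation `t₁ ∂/∂t₁` of `A`. -/
def euler₁ : Derivation ℂ Laurent Laurent :=
  euler ((Int.castAddHom ℂ).comp (AddMonoidHom.fst ℤ ℤ))

/-- The derivation `t₂ ∂/∂t₂` of `A`. -/
def euler₂ : Derivation ℂ Laurent Laurent :=
  euler ((Int.castAddHom ℂ).comp (AddMonoidHom.snd ℤ ℤ))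

/-- The derivation `d_m = t^m (m(2) t₁ ∂/∂t₁ - m(1) t₂ ∂/∂t₂)`. -/
def dDer (m : ℤ × ℤ) : Derivation ℂ Laurent Laurent :=
  mono m • ((m.2 : ℂ) • euler₁ - (m.1 : ℂ) • euler₂)

lemma dDer_mono (m n : ℤ × ℤ) :
    dDer m (mono n) = det2 (toC n) (toC m) • mono (m + n) := by
  simp only [dDer, euler₁, euler₂, Derivation.smul_apply, Derivation.sub_apply, euler_mono,
    smul_eq_mul, smul_smul, ← sub_smul, mul_smul_comm, mono_mul]
  congr 1
  simp [det2, toC]; ring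

lemma derivation_ext {D E : Derivation ℂ Laurent Laurent}
    (h : ∀ n, D (mono n) = E (mono n)) : D = E := by
  have : (D : Laurent →ₗ[ℂ] Laurent) = E := linearMap_ext h
  ext1 a
  exact LinearMap.congr_fun this a

lemma dDer_lie (m n : ℤ × ℤ) : ⁅dDer m, dDer n⁆ = det2 (toC n) (toC m) • dDer (m + n) := by
  refine derivation_ext fun k => ?_
  rw [Derivation.commutator_apply, Derivation.smul_apply, dDer_mono, dDer_mono, dDer_mono,
    Derivation.map_smul, Derivation.map_smul, dDer_mono, dDer_mono, smul_smul, smul_smul, smul_smul,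
    show m + n + k = m + (n + k) by abel, show n + (m + k) = m + (n + k) by abel, ← sub_smul]
  congr 1
  simp [det2, toC]; ring

lemma lie_mem_span {x y : Derivation ℂ Laurent Laurent}
    (hx : x ∈ Submodule.span ℂ {D | ∃ m : ℤ × ℤ, m ≠ 0 ∧ D = dDer m})
    (hy : y ∈ Submodule.span ℂ {D | ∃ m : ℤ × ℤ, m ≠ 0 ∧ D = dDer m}) :
    ⁅x, y⁆ ∈ Submodule.span ℂ {D | ∃ m : ℤ × ℤ, m ≠ 0 ∧ D = dDer m} := by
  induction hx using Submodule.span_induction with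
  | zero => rw [show ⁅(0 : Derivation ℂ Laurent Laurent), y⁆ = 0 from zero_lie y]; exact zero_mem _
  | add a b _ _ ha hb =>
    rw [show ⁅a + b, y⁆ = ⁅a, y⁆ + ⁅b, y⁆ from add_lie a b y]; exact add_mem ha hb
  | smul c a _ ha =>
    rw [show ⁅c • a, y⁆ = c • ⁅a, y⁆ from smul_lie c a y]; exact Submodule.smul_mem _ c ha
  | mem a ha =>
    obtain ⟨m, hm, rfl⟩ := ha
    induction hy using Submodule.span_induction with
    | zero =>
      rw [show ⁅dDer m, (0 : Derivation ℂ Laurent Laurent)⁆ = 0 by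
        ext1 a; simp [Derivation.commutator_apply]]
      exact zero_mem _
    | add a b _ _ ha hb =>
      rw [show ⁅dDer m, a + b⁆ = ⁅dDer m, a⁆ + ⁅dDer m, b⁆ by
        ext1 k; simp only [Derivation.commutator_apply, Derivation.add_apply, map_add]; abel]
      exact add_mem ha hb
    | smul c a _ ha =>
      rw [show ⁅dDer m, c • a⁆ = c • ⁅dDer m, a⁆ by
        ext1 k
        simp only [Derivation.commutator_apply, Derivation.smul_apply, Derivation.map_smul, smul_sub]]
      exact Submodule.smul_mem _ c ha
    | mem a ha =>
      obtain ⟨n, hn, rfl⟩ := ha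
      rw [dDer_lie]
      by_cases h : m + n = 0
      · have h1 : n = -m := by rw [← sub_eq_zero, sub_neg_eq_add, add_comm]; exact h
        have : det2 (toC n) (toC m) = 0 := by subst h1; simp [det2, toC]; ring
        rw [this, zero_smul]; exact Submodule.zero_mem _
      · exact Submodule.smul_mem _ _ (Submodule.subset_span ⟨_, h, rfl⟩)

/-- The centerless Virasoro-like algebra `𝒢`: the Lie subalgebra of the Witt algebra `Der A` that
is spanned by the `d_m`, `m ≠ 0`. -/
def Vir : LieSubalgebra ℂ (Derivation ℂ Laurent Laurent) where
  __ := Submodule.span ℂ {D | ∃ m : ℤ × ℤ, m ≠ 0 ∧ D = dDer m}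
  lie_mem' := fun hx hy => lie_mem_span hx hy

/-- The natural action of `Der A` on the abelian Lie algebra `A` by Lie derivations. -/
def derAction : Derivation ℂ Laurent Laurent →ₗ⁅ℂ⁆ LieDerivation ℂ Laurent Laurent where
  toFun D := ⟨D.toLinearMap, by
    intro a b
    simp [LieRing.of_associative_ring_bracket, mul_comm]⟩
  map_add' _ _ := by ext; simp
  map_smul' _ _ := by ext; simp
  map_lie' := by
    intro x y
    ext a : 1
    rfl

/-- The semidirect product `𝒢 ⋉ A`, with bracket `[x + f, y + g] = [x, y] + x g - y f`. -/
abbrev VirA : Type :=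
  LieAlgebra.SemiDirectSum Laurent Vir (derAction.comp Vir.incl)

/-- The element `t^n` of `𝒢 ⋉ A`. -/
def tElt (n : ℤ × ℤ) : VirA := ⟨mono n, 0⟩

/-- The element `d_m` of `𝒢 ⋉ A`, for `m ≠ 0`. -/
def dElt (m : ℤ × ℤ) (hm : m ≠ 0) : VirA := ⟨0, ⟨dDer m, Submodule.subset_span ⟨m, hm, rfl⟩⟩⟩

/-! ### Modules, given by representations -/

section Rep

variable {L : Type*} [LieRing L] [LieAlgebra ℂ L]
  {V : Type*} [AddCommGroup V] [Module ℂ V] {W : Type*} [AddCommGroup W] [Module ℂ W]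

/-- `S` is a submodule for the representation `ρ`. -/
def IsInvariant (ρ : L →ₗ⁅ℂ⁆ Module.End ℂ V) (S : Submodule ℂ V) : Prop :=
  ∀ x : L, ∀ v ∈ S, ρ x v ∈ S

/-- Nonzero, and without submodules other than `0` and the whole module. -/
def IsIrreducibleRep (ρ : L →ₗ⁅ℂ⁆ Module.End ℂ V) : Prop :=
  Nontrivial V ∧ ∀ S : Submodule ℂ V, IsInvariant ρ S → S = ⊥ ∨ S = ⊤

/-- Nonzero, and not the direct sum of two nonzero submodules. -/
def IsIndecomposableRep (ρ : L →ₗ⁅ℂ⁆ Module.End ℂ V) : Prop :=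
  Nontrivial V ∧ ∀ S T : Submodule ℂ V, IsInvariant ρ S → IsInvariant ρ T → IsCompl S T →
    S = ⊥ ∨ T = ⊥

/-- The linear equivalence `f` is an isomorphism of modules. -/
def Intertwines (ρ : L →ₗ⁅ℂ⁆ Module.End ℂ V) (σ : L →ₗ⁅ℂ⁆ Module.End ℂ W) (f : V ≃ₗ[ℂ] W) : Prop :=
  ∀ (x : L) (v : V), f (ρ x v) = σ x (f v)

end Rep

/-- A finite-dimensional module over the Lie algebra `L`. -/
structure LieFDRep (L : Type) [LieRing L] [LieAlgebra ℂ L] : Type (u + 1) where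
  carrier : Type u
  [addCommGroup : AddCommGroup carrier]
  [module : Module ℂ carrier]
  [finite : Module.Finite ℂ carrier]
  action : L →ₗ⁅ℂ⁆ Module.End ℂ carrier

attribute [instance] LieFDRep.addCommGroup LieFDRep.module LieFDRep.finite

/-- Isomorphism of finite-dimensional modules. -/
def LieFDRep.setoid (L : Type) [LieRing L] [LieAlgebra ℂ L] : Setoid (LieFDRep.{u} L) where
  r U W := ∃ f : U.carrier ≃ₗ[ℂ] W.carrier, Intertwines U.action W.action f
  iseqv :=
    { refl := fun U => ⟨LinearEquiv.refl ℂ _, fun _ _ => rfl⟩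
      symm := by
        rintro U W ⟨f, hf⟩
        refine ⟨f.symm, fun x w => ?_⟩
        rw [LinearEquiv.symm_apply_eq, hf, LinearEquiv.apply_symm_apply]
      trans := by
        rintro U W X ⟨f, hf⟩ ⟨g, hg⟩
        exact ⟨f.trans g, fun x v => by simp [hf x v, hg x (f v)]⟩ }

/-- Isomorphism classes of indecomposable finite-dimensional `L`-modules. -/
def IndecRepClass (L : Type) [LieRing L] [LieAlgebra ℂ L] : Type (u + 1) :=
  Quotient ((LieFDRep.setoid.{u} L).comap
    (Subtype.val : {U : LieFDRep.{u} L // IsIndecomposableRep U.action} → LieFDRep.{u} L))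

/-- The isomorphism class of an indecomposable module. -/
def IndecRepClass.mk {L : Type} [LieRing L] [LieAlgebra ℂ L] (U : LieFDRep.{u} L)
    (h : IsIndecomposableRep U.action) : IndecRepClass.{u} L :=
  Quotient.mk _ ⟨U, h⟩

/-- Isomorphism classes of irreducible finite-dimensional `L`-modules. -/
def IrrRepClass (L : Type) [LieRing L] [LieAlgebra ℂ L] : Type (u + 1) :=
  Quotient ((LieFDRep.setoid.{u} L).comap
    (Subtype.val : {U : LieFDRep.{u} L // IsIrreducibleRep U.action} → LieFDRep.{u} L))

/-- The isomorphism class of an irreducible module. -/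
def IrrRepClass.mk {L : Type} [LieRing L] [LieAlgebra ℂ L] (U : LieFDRep.{u} L)
    (h : IsIrreducibleRep U.action) : IrrRepClass.{u} L :=
  Quotient.mk _ ⟨U, h⟩

/-! ### Jet modules -/

/-- The representation `Φ` of `𝒢 ⋉ A` with the family `gr` of subspaces is a jet module of
parameter `lam`. The element `t^0`, which is central in `𝒢 ⋉ A`, acts as `lam`, so that
`t^m t^n = lam t^{m+n}` for all `m, n`. -/
structure IsJet (lam : ℂ) {V : Type*} [AddCommGroup V] [Module ℂ V]
    (Φ : VirA →ₗ⁅ℂ⁆ Module.End ℂ V) (gr : ℤ × ℤ → Submodule ℂ V) : Prop where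
  isInternal : DirectSum.IsInternal gr
  t_mem : ∀ (m n : ℤ × ℤ), ∀ v ∈ gr n, Φ (tElt m) v ∈ gr (m + n)
  d_mem : ∀ (m : ℤ × ℤ) (hm : m ≠ 0) (n : ℤ × ℤ), ∀ v ∈ gr n, Φ (dElt m hm) v ∈ gr (m + n)
  bounded : ∃ N : ℕ, ∀ n, Module.Finite ℂ (gr n) ∧ Module.finrank ℂ (gr n) ≤ N
  t_bijective : ∀ m : ℤ × ℤ, m ≠ 0 → Function.Bijective (Φ (tElt m))
  t_quasiAssoc : ∀ m n : ℤ × ℤ, m ≠ 0 → n ≠ 0 → m + n ≠ 0 → ∀ v,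
    Φ (tElt m) (Φ (tElt n) v) = lam • Φ (tElt (m + n)) v
  t_zero : ∀ v, Φ (tElt 0) v = lam • v

/-- A jet `𝒢`-module of parameter `lam`, together with its gradation. -/
structure JetModule (lam : ℂ) : Type (u + 1) where
  carrier : Type u
  [addCommGroup : AddCommGroup carrier]
  [module : Module ℂ carrier]
  action : VirA →ₗ⁅ℂ⁆ Module.End ℂ carrier
  gr : ℤ × ℤ → Submodule ℂ carrier
  isJet : IsJet lam action gr

attribute [instance] JetModule.addCommGroup JetModule.module

/-- Isomorphism of jet modules that respects the gradations. -/
def JetModule.setoid (lam : ℂ) : Setoid (JetModule.{u} lam) where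
  r V W := ∃ f : V.carrier ≃ₗ[ℂ] W.carrier, Intertwines V.action W.action f ∧
    ∀ n, (V.gr n).map f.toLinearMap = W.gr n
  iseqv :=
    { refl := fun U => ⟨LinearEquiv.refl ℂ _, fun _ _ => rfl, fun n => by simp⟩
      symm := by
        rintro U W ⟨f, hf, hg⟩
        refine ⟨f.symm, fun x w => ?_, fun n => ?_⟩
        · rw [LinearEquiv.symm_apply_eq, hf, LinearEquiv.apply_symm_apply]
        · rw [← hg n, ← Submodule.map_comp]; simp
      trans := by
        rintro U W X ⟨f, hf, hf'⟩ ⟨g, hg, hg'⟩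
        refine ⟨f.trans g, fun x v => by simp [hf x v, hg x (f v)], fun n => ?_⟩
        rw [← hg' n, ← hf' n, ← Submodule.map_comp]; rfl }

/-- Isomorphism of jet modules up to regrading: an isomorphism of modules that maps homogeneous
components onto homogeneous components, along some permutation of `ℤ²`. -/
def JetModule.RegradedIso {lam : ℂ} (V W : JetModule.{u} lam) : Prop :=
  ∃ f : V.carrier ≃ₗ[ℂ] W.carrier, Intertwines V.action W.action f ∧
    ∃ s : Equiv.Perm (ℤ × ℤ), ∀ n, (V.gr n).map f.toLinearMap = W.gr (s n)

/-- Isomorphism classes of indecomposable jet modules of parameter `lam`. -/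
def IndecJetClass (lam : ℂ) : Type (u + 1) :=
  Quotient ((JetModule.setoid.{u} lam).comap
    (Subtype.val : {V : JetModule.{u} lam // IsIndecomposableRep V.action} → JetModule.{u} lam))

/-- The isomorphism class of an indecomposable jet module. -/
def IndecJetClass.mk {lam : ℂ} (V : JetModule.{u} lam) (h : IsIndecomposableRep V.action) :
    IndecJetClass.{u} lam :=
  Quotient.mk _ ⟨V, h⟩

/-- Isomorphism classes of irreducible jet modules of parameter `lam`. -/
def IrrJetClass (lam : ℂ) : Type (u + 1) :=
  Quotient ((JetModule.setoid.{u} lam).comap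
    (Subtype.val : {V : JetModule.{u} lam // IsIrreducibleRep V.action} → JetModule.{u} lam))

/-- The isomorphism class of an irreducible jet module. -/
def IrrJetClass.mk {lam : ℂ} (V : JetModule.{u} lam) (h : IsIrreducibleRep V.action) :
    IrrJetClass.{u} lam :=
  Quotient.mk _ ⟨V, h⟩

/-- The component `V₀` of a jet module, with a given action of `L` on it. -/
def JetModule.fiber {lam : ℂ} (V : JetModule.{u} lam) {L : Type} [LieRing L] [LieAlgebra ℂ L]
    (ρ : L →ₗ⁅ℂ⁆ Module.End ℂ (V.gr 0)) : LieFDRep.{u} L :=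
  haveI : Module.Finite ℂ (V.gr 0) := (V.isJet.bounded.choose_spec 0).1
  { carrier := V.gr 0, action := ρ }

/-- The gradation of `A ⊗ U` with components `t^n ⊗ U`. -/
def tensorGr (U : Type*) [AddCommGroup U] [Module ℂ U] (n : ℤ × ℤ) :
    Submodule ℂ (Laurent ⊗[ℂ] U) :=
  LinearMap.range (TensorProduct.mk ℂ Laurent U (mono n))

/-- The space `A ⊗ U` with a given action of `𝒢 ⋉ A` and the gradation by the `t^n ⊗ U`. -/
def tensorJet {lam : ℂ} {U : Type u} [AddCommGroup U] [Module ℂ U]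
    (Φ : VirA →ₗ⁅ℂ⁆ Module.End ℂ (Laurent ⊗[ℂ] U)) (h : IsJet lam Φ (tensorGr U)) :
    JetModule.{u} lam where
  carrier := Laurent ⊗[ℂ] U
  action := Φ
  gr := tensorGr U
  isJet := h

/-! ### The Lie algebra `𝓑₊` -/

/-- The vector space `𝓑₊` with basis `D_i`, `i ∈ ℤ₊²`. -/
def BlockPlus : Type := ℕ × ℕ →₀ ℂ

namespace BlockPlus

instance : AddCommGroup BlockPlus := inferInstanceAs (AddCommGroup (ℕ × ℕ →₀ ℂ))

instance : Module ℂ BlockPlus := inferInstanceAs (Module ℂ (ℕ × ℕ →₀ ℂ))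

/-- The basis element `D_i`. -/
def D (i : ℕ × ℕ) : BlockPlus := Finsupp.single i (1 : ℂ)

/-- A pair of natural numbers regarded as a complex vector. -/
def natC (i : ℕ × ℕ) : ℂ × ℂ := ((i.1 : ℂ), (i.2 : ℂ))

/-- The bracket `[D_i, D_j]` of two basis elements. In the first case the determinant is zero
as soon as `i + j - (1,1)` is not in `ℤ₊²`. -/
def lieBasis (i j : ℕ × ℕ) : BlockPlus :=
  if 2 ≤ i.1 + i.2 ∧ 2 ≤ j.1 + j.2 then
    det2 (natC j) (natC i) • D (i.1 + j.1 - 1, i.2 + j.2 - 1)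
  else if i = (1, 0) ∧ j = (0, 1) then D (0, 0)
  else if i = (0, 1) ∧ j = (1, 0) then -D (0, 0)
  else 0

/-- The bilinear extension of `lieBasis`. -/
def lieLin : BlockPlus →ₗ[ℂ] BlockPlus →ₗ[ℂ] BlockPlus :=
  Finsupp.linearCombination ℂ fun i : ℕ × ℕ =>
    (Finsupp.linearCombination ℂ (lieBasis i) : (ℕ × ℕ →₀ ℂ) →ₗ[ℂ] BlockPlus)

lemma lieLin_D (i j : ℕ × ℕ) : lieLin (D i) (D j) = lieBasis i j := by
  have h1 : lieLin (D i) =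
      (Finsupp.linearCombination ℂ (lieBasis i) : (ℕ × ℕ →₀ ℂ) →ₗ[ℂ] BlockPlus) := by
    unfold lieLin D
    erw [Finsupp.linearCombination_single]
    exact one_smul ℂ _
  rw [h1]
  unfold D
  erw [Finsupp.linearCombination_single]
  exact one_smul ℂ _

lemma lin_ext {M : Type*} [AddCommGroup M] [Module ℂ M] {f g : BlockPlus →ₗ[ℂ] M}
    (h : ∀ i, f (D i) = g (D i)) : f = g :=
  Finsupp.lhom_ext' fun i => LinearMap.ext_ring (h i)

lemma lieBasis_skew (i j : ℕ × ℕ) : lieBasis i j = -lieBasis j i := by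
  unfold lieBasis
  by_cases h : 2 ≤ i.1 + i.2 ∧ 2 ≤ j.1 + j.2
  · rw [if_pos h, if_pos h.symm, ← neg_smul, add_comm j.1, add_comm j.2]
    congr 1
    simp [det2]; ring
  · have h2 : ¬(2 ≤ j.1 + j.2 ∧ 2 ≤ i.1 + i.2) := fun h' => h h'.symm
    simp only [if_neg h, if_neg h2]
    by_cases ha : i = (1, 0) ∧ j = (0, 1)
    · simp [ha.1, ha.2]
    · by_cases hb : i = (0, 1) ∧ j = (1, 0)
      · simp [hb.1, hb.2]
      · rw [if_neg ha, if_neg hb, if_neg (fun h' => hb h'.symm), if_neg (fun h' => ha h'.symm),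
          neg_zero]

lemma lieLin_skew (x y : BlockPlus) : lieLin x y = -lieLin y x := by
  have : lieLin = -lieLin.flip := by
    refine lin_ext fun i => lin_ext fun j => ?_
    simp only [LinearMap.neg_apply, LinearMap.flip_apply, lieLin_D]
    exact lieBasis_skew i j
  conv_lhs => rw [this]
  simp

lemma lieLin_D_lieBasis (i j k : ℕ × ℕ) : lieLin (D i) (lieBasis j k) =
    (if 2 ≤ i.1 + i.2 ∧ 2 ≤ j.1 + j.2 ∧ 2 ≤ k.1 + k.2 then
      det2 (natC k) (natC j) * det2 (natC j + natC k - (1, 1)) (natC i) else 0) •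
      D (i.1 + j.1 + k.1 - 2, i.2 + j.2 + k.2 - 2) := by
  have hz : ∀ i, lieLin (D i) (D (0, 0)) = 0 := by
    intro i; rw [lieLin_D]; unfold lieBasis; simp
  by_cases h : 2 ≤ j.1 + j.2 ∧ 2 ≤ k.1 + k.2
  · rw [lieBasis, if_pos h, map_smul, lieLin_D]
    by_cases hi : 2 ≤ i.1 + i.2
    · rw [lieBasis, if_pos ⟨hi, by dsimp only; omega⟩, if_pos ⟨hi, h⟩, smul_smul]
      obtain ⟨i1, i2⟩ := i
      obtain ⟨j1, j2⟩ := j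
      obtain ⟨k1, k2⟩ := k
      simp only at h hi ⊢
      by_cases h1 : j1 + k1 = 0
      · have e1 : j1 = 0 := by omega
        have e2 : k1 = 0 := by omega
        subst e1 e2; simp [det2, natC]
      by_cases h2 : j2 + k2 = 0
      · have e1 : j2 = 0 := by omega
        have e2 : k2 = 0 := by omega
        subst e1 e2; simp [det2, natC]
      have c1 : ((j1 + k1 - 1 : ℕ) : ℂ) = j1 + k1 - 1 := by
        rw [Nat.cast_sub (by omega)]; push_cast; ring
      have c2 : ((j2 + k2 - 1 : ℕ) : ℂ) = j2 + k2 - 1 := by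
        rw [Nat.cast_sub (by omega)]; push_cast; ring
      rw [show i1 + (j1 + k1 - 1) - 1 = i1 + j1 + k1 - 2 by omega,
        show i2 + (j2 + k2 - 1) - 1 = i2 + j2 + k2 - 2 by omega]
      congr 1
      simp [det2, natC, c1, c2]
    · rw [if_neg (fun h' => hi h'.1), zero_smul, lieBasis, if_neg (fun h' => hi h'.1),
        if_neg, if_neg, smul_zero]
      · simp only [Prod.mk.injEq]; omega
      · simp only [Prod.mk.injEq]; omega
  · rw [if_neg (fun h' => h h'.2), zero_smul, lieBasis, if_neg h]
    split_ifs <;> simp [hz]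

lemma lieLin_jacobi (x y z : BlockPlus) :
    lieLin x (lieLin y z) = lieLin (lieLin x y) z + lieLin y (lieLin x z) := by
  have key : ∀ i j k : ℕ × ℕ, lieLin (D i) (lieLin (D j) (D k)) =
      lieLin (lieLin (D i) (D j)) (D k) + lieLin (D j) (lieLin (D i) (D k)) := by
    intro i j k
    rw [lieLin_skew (lieLin (D i) (D j))]
    simp only [lieLin_D, lieLin_D_lieBasis]
    rw [show k.1 + i.1 + j.1 = i.1 + j.1 + k.1 by ring,
      show k.2 + i.2 + j.2 = i.2 + j.2 + k.2 by ring,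
      show j.1 + i.1 + k.1 = i.1 + j.1 + k.1 by ring,
      show j.2 + i.2 + k.2 = i.2 + j.2 + k.2 by ring, ← neg_smul, ← add_smul]
    congr 1
    by_cases h : 2 ≤ i.1 + i.2 ∧ 2 ≤ j.1 + j.2 ∧ 2 ≤ k.1 + k.2
    · rw [if_pos h, if_pos ⟨h.2.2, h.1, h.2.1⟩, if_pos ⟨h.2.1, h.1, h.2.2⟩]
      simp [det2, natC]; ring
    · rw [if_neg h, if_neg (fun h' => h ⟨h'.2.1, h'.2.2, h'.1⟩),
        if_neg (fun h' => h ⟨h'.2.1, h'.1, h'.2.2⟩)]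
      simp
  -- extend from the basis, one argument at a time
  have e3 : ∀ i j : ℕ × ℕ, (lieLin (D i)).comp (lieLin (D j)) =
      lieLin (lieLin (D i) (D j)) + (lieLin (D j)).comp (lieLin (D i)) :=
    fun i j => lin_ext fun k => key i j k
  have e2 : ∀ i : ℕ × ℕ, ∀ z, (lieLin (D i)).comp (lieLin.flip z) =
      (lieLin.flip z).comp (lieLin (D i)) + lieLin.flip (lieLin (D i) z) :=
    fun i z => lin_ext fun j => LinearMap.congr_fun (e3 i j) z
  have e1 : lieLin.flip (lieLin y z) =
      (lieLin.flip z).comp (lieLin.flip y) + (lieLin y).comp (lieLin.flip z) :=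
    lin_ext fun i => LinearMap.congr_fun (e2 i z) y
  exact LinearMap.congr_fun e1 x

instance : LieRing BlockPlus where
  bracket x y := lieLin x y
  add_lie x y z := by simp
  lie_add x y z := by simp
  lie_self x := by
    have h : (2 : ℂ) • lieLin x x = 0 := by
      rw [two_smul]; nth_rewrite 1 [lieLin_skew x x]; exact neg_add_cancel _
    exact (smul_eq_zero.mp h).resolve_left two_ne_zero
  leibniz_lie x y z := lieLin_jacobi x y z

instance : LieAlgebra ℂ BlockPlus where
  lie_smul c x y := (lieLin x).map_smul c y

lemma lie_D (i j : ℕ × ℕ) : ⁅D i, D j⁆ = lieBasis i j := lieLin_D i j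

end BlockPlus

/-- The operator `∑_{i ∈ ℤ₊²} (m^i / i!) D_i` of a `𝓑₊`-module on which only finitely many `D_i`
act nontrivially. -/
def polyOp {U : Type*} [AddCommGroup U] [Module ℂ U] (ρ : BlockPlus →ₗ⁅ℂ⁆ Module.End ℂ U)
    (m : ℤ × ℤ) : Module.End ℂ U :=
  ∑ᶠ i : ℕ × ℕ, (((m.1 : ℂ) ^ i.1 * (m.2 : ℂ) ^ i.2) / ((i.1.factorial : ℂ) * (i.2.factorial : ℂ))) •
    ρ (BlockPlus.D i)

/-- The `𝓑₊`-action `ρ` on `V₀` is the one induced by the jet module `V`: one has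
`d_m v = lam⁻¹ t^m (∑ (m^i / i!) D_i v)` for all `v ∈ V₀`, `m ≠ 0`. -/
def JetModule.IsBlockAction {lam : ℂ} (V : JetModule.{u} lam)
    (ρ : BlockPlus →ₗ⁅ℂ⁆ Module.End ℂ (V.gr 0)) : Prop :=
  ∀ (m : ℤ × ℤ) (hm : m ≠ 0) (v : V.gr 0),
    V.action (dElt m hm) (v : V.carrier) =
      lam⁻¹ • V.action (tElt m) (polyOp ρ m v : V.carrier)

/-- The action of `𝒢 ⋉ A` on `A ⊗ U` defined by the `𝓑₊`-module `U`. -/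
def IsBlockTensorAction (lam : ℂ) {U : Type*} [AddCommGroup U] [Module ℂ U]
    (ρ : BlockPlus →ₗ⁅ℂ⁆ Module.End ℂ U) (Φ : VirA →ₗ⁅ℂ⁆ Module.End ℂ (Laurent ⊗[ℂ] U)) : Prop :=
  (∀ (m n : ℤ × ℤ) (v : U), Φ (tElt m) (mono n ⊗ₜ v) = lam • (mono (m + n) ⊗ₜ[ℂ] v)) ∧
  ∀ (m : ℤ × ℤ) (hm : m ≠ 0) (n : ℤ × ℤ) (v : U), Φ (dElt m hm) (mono n ⊗ₜ v) =
    mono (m + n) ⊗ₜ[ℂ] (det2 (toC n) (toC m) • v + polyOp ρ m v)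

/-! ### The Lie algebra `sl₂ ⊕ ℂ z₁ ⊕ ℂ z₂` -/

/-- The Lie algebra `sl₂(ℂ) ⊕ ℂ z₁ ⊕ ℂ z₂`, with `z₁`, `z₂` central. -/
abbrev SlZ : Type := LieAlgebra.SpecialLinear.sl (Fin 2) ℂ × (ℂ × ℂ)

/-- The matrix `(a, b; c, -a)` of `sl₂`, as an element of `sl₂ ⊕ ℂ z₁ ⊕ ℂ z₂`. -/
def slMat (a b c : ℂ) : SlZ :=
  (⟨!![a, b; c, -a], by
    change Matrix.trace !![a, b; c, -a] = 0
    simp [Matrix.trace_fin_two]⟩, 0)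

/-- The central element `z₁`. -/
def z₁ : SlZ := (0, (1, 0))

/-- The central element `z₂`. -/
def z₂ : SlZ := (0, (0, 1))

/-- The matrix `(m(1)m(2), -m(1)²; m(2)², -m(1)m(2))` in `sl₂`. -/
def slM (m : ℤ × ℤ) : SlZ :=
  slMat ((m.1 : ℂ) * m.2) (-(m.1 : ℂ) ^ 2) ((m.2 : ℂ) ^ 2)

/-- The action `ρ` of `sl₂ ⊕ ℂ z₁ ⊕ ℂ z₂` on `V₀` is the one induced by the jet module `V`:
for all `v ∈ V₀`, `m ≠ 0` one has
`d_m v = lam⁻¹ t^m ((m(1)m(2), -m(1)²; m(2)², -m(1)m(2)) + m(1) z₁ + m(2) z₂) v`. -/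
def JetModule.IsSlAction {lam : ℂ} (V : JetModule.{u} lam)
    (ρ : SlZ →ₗ⁅ℂ⁆ Module.End ℂ (V.gr 0)) : Prop :=
  ∀ (m : ℤ × ℤ) (hm : m ≠ 0) (v : V.gr 0),
    V.action (dElt m hm) (v : V.carrier) =
      lam⁻¹ • V.action (tElt m)
        (ρ (slM m + (m.1 : ℂ) • z₁ + (m.2 : ℂ) • z₂) v : V.carrier)

/-- `z₁` and `z₂` act as the scalars `-α(2)` and `α(1)`. -/
def HasCentralWeight {U : Type*} [AddCommGroup U] [Module ℂ U]
    (ρ : SlZ →ₗ⁅ℂ⁆ Module.End ℂ U) (α : ℂ × ℂ) : Prop :=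
  (∀ v, ρ z₁ v = (-α.2) • v) ∧ ∀ v, ρ z₂ v = α.1 • v

/-- The action of `𝒢 ⋉ A` on `A ⊗ U` defined by `α` and the `sl₂`-action on `U`. -/
def IsSlTensorAction (lam : ℂ) (α : ℂ × ℂ) {U : Type*} [AddCommGroup U] [Module ℂ U]
    (ρ : SlZ →ₗ⁅ℂ⁆ Module.End ℂ U) (Φ : VirA →ₗ⁅ℂ⁆ Module.End ℂ (Laurent ⊗[ℂ] U)) : Prop :=
  (∀ (m n : ℤ × ℤ) (v : U), Φ (tElt m) (mono n ⊗ₜ v) = lam • (mono (m + n) ⊗ₜ[ℂ] v)) ∧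
  ∀ (m : ℤ × ℤ) (hm : m ≠ 0) (n : ℤ × ℤ) (v : U), Φ (dElt m hm) (mono n ⊗ₜ v) =
    mono (m + n) ⊗ₜ[ℂ] (ρ (slM m) v + det2 (α + toC n) (toC m) • v)

/-- The images of the `D_i` under the projection `𝓑₊ → sl₂ ⊕ ℂ z₁ ⊕ ℂ z₂`:
`D_{(2,0)} ↦ -2e`, `D_{(0,2)} ↦ 2f`, `D_{(1,1)} ↦ h`, `D_{(1,0)} ↦ z₁`, `D_{(0,1)} ↦ z₂`, and
the other `D_i` map to zero. -/
def blockToSl (i : ℕ × ℕ) : SlZ :=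
  if i = (2, 0) then slMat 0 (-2) 0
  else if i = (0, 2) then slMat 0 0 2
  else if i = (1, 1) then slMat 1 0 0
  else if i = (1, 0) then z₁
  else if i = (0, 1) then z₂
  else 0

/-- The scalar by which `D_i` changes when the gradation is shifted by `n`. -/
def shiftScalar (n : ℤ × ℤ) (i : ℕ × ℕ) : ℂ :=
  if i = (1, 0) then -(n.2 : ℂ) else if i = (0, 1) then (n.1 : ℂ) else 0

end VirasoroJet

end

open VirasoroJet

/-!
A jet module is determined by its zero component. The operators `T_m = λ⁻¹ t^m` satisfy
`T_m T_n = T_{m+n}` for all `m`, `n`, so that `V = ⨁ T_n V₀`, and the action of the `d_m` is encoded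
in the operators `P(m) = T_{-m} d_m` on `V₀`: one has `d_m T_n v = T_{m+n} (P(m) + det (n over m)) v`.
The relations of `𝒢 ⋉ A` then amount to

  `[P(m), P(n)] = det (n over m) (P(m + n) - P(m) - P(n))`   for `m, n ≠ 0`.

The main point is that a solution of this equation in a finite-dimensional Lie algebra is a
polynomial function of `m` (`exists_isPolyFun₂_of_lie`). Along a line `x_k = P(m + k n)` with
`δ = det (m over n) ≠ 0`, the bracket with `P(n)` gives a linear recurrence for `x`, hence a
decomposition of `x` into a polynomial part `u` and a part `y` in which only powers of numbers
different from `1` occur. Comparing parts in the formula for `[x_k, x_l]` yields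
`[y_k, u_0] = -δ k y_k`, so that `ad u_0` would have infinitely many eigenvalues if `y` were nonzero
(`mem_polSeq_of_lie`). Newton interpolation combines the directions. Writing
`P(m) = ∑ (m^i / i!) D_i`, the equation for `P` says exactly that the `D_i` satisfy the relations of
`𝓑₊` (`jetSum_lieBasis`, `exists_blockRep`), and the same identity, read backwards, provides the
modules `A ⊗ U`. Only finitely many `D_i` act nontrivially on a finite-dimensional module, since the
`D_i` are eigenvectors of `ad D_{(1,1)}` (`exists_boxSupported`).

Submodules of `V` and of `V₀` are compared through the operator `D_{(1,0)} + i D_{(0,1)}`. If `V₀` is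
indecomposable, it has a single eigenvalue `c` on `V₀`, and the corresponding operator on `V` has
the single eigenvalue `c - n(2) + i n(1)` on `V_n`. These numbers are distinct, so every submodule of
`V` is graded (`JetModule.extend_fiberSub`). Thus `V` is irreducible or indecomposable if and only if
`V₀` is. An isomorphism that permutes the components moves `V₀` to some `W_n`, where `P(m)` becomes
`P(m) + det (n over m)`; this is the shift of `D_{(1,0)}` and `D_{(0,1)}` by scalars.

Finally, on an irreducible `𝓑₊`-module `D_{(0,0)}` and all `D_i` with `i(1) + i(2) ≥ 3` act as zero:
from the highest degree downwards they are commuting nilpotent operators whose common kernel is a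
submodule (`D_eq_zero_of_ideal`). So the irreducible modules are those of the quotient
`sl₂ ⊕ ℂ z₁ ⊕ ℂ z₂`.
-/

noncomputable section

namespace VirasoroJet

/-! ### Sums in divided powers -/

/-- `f` vanishes outside the square of pairs with entries less than `K`. -/
def BoxSupported (K : ℕ) {E : Type*} [Zero E] (f : ℕ × ℕ → E) : Prop :=
  ∀ i, K ≤ i.1 ∨ K ≤ i.2 → f i = 0

lemma BoxSupported.mono {E : Type*} [Zero E] {K L : ℕ} (h : K ≤ L) {f : ℕ × ℕ → E}
    (hf : BoxSupported K f) : BoxSupported L f :=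
  fun i hi => hf i (hi.imp (le_trans h) (le_trans h))

section DividedPowers

variable {E : Type*} [AddCommGroup E] [Module ℂ E]

/-- The divided power `a^p / p!`. -/
def dpow (a : ℂ) (p : ℕ) : ℂ := a ^ p / (p.factorial : ℂ)

/-- The sum `∑_{p < K} (a^p / p!) g(p)`. -/
def dsum (K : ℕ) (a : ℂ) (g : ℕ → E) : E := ∑ p ∈ Finset.range K, dpow a p • g p

lemma mul_dpow (a : ℂ) (p : ℕ) : a * dpow a p = (p + 1 : ℕ) * dpow a (p + 1) := by
  have h : ((p.factorial : ℕ) : ℂ) ≠ 0 := by exact_mod_cast p.factorial_ne_zero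
  have h' : ((p : ℂ) + 1) ≠ 0 := by exact_mod_cast p.succ_ne_zero
  simp only [dpow, Nat.factorial_succ]
  push_cast
  field_simp
  ring

lemma dpow_add (a b : ℂ) (n : ℕ) :
    dpow (a + b) n = ∑ p ∈ Finset.range (n + 1), dpow a p * dpow b (n - p) := by
  have h : ∀ p : ℕ, ((p.factorial : ℕ) : ℂ) ≠ 0 := fun p => by exact_mod_cast p.factorial_ne_zero
  rw [dpow, div_eq_iff (h n), add_pow, Finset.sum_mul]
  refine Finset.sum_congr rfl fun p hp => ?_
  have hp' : p ≤ n := Nat.lt_succ_iff.mp (Finset.mem_range.mp hp)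
  have hc : ((n.choose p : ℕ) : ℂ) * p.factorial * (n - p).factorial = n.factorial := by
    exact_mod_cast Nat.choose_mul_factorial_mul_factorial hp'
  have h1 := h p
  have h2 := h (n - p)
  simp only [dpow]
  rw [← hc]
  field_simp

lemma dsum_zero_fun (K : ℕ) (a : ℂ) : dsum K a (fun _ => (0 : E)) = 0 := by simp [dsum]

lemma dsum_add (K : ℕ) (a : ℂ) (g h : ℕ → E) :
    dsum K a (fun p => g p + h p) = dsum K a g + dsum K a h := by
  simp [dsum, Finset.sum_add_distrib]

lemma dsum_sub (K : ℕ) (a : ℂ) (g h : ℕ → E) :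
    dsum K a (fun p => g p - h p) = dsum K a g - dsum K a h := by
  simp [dsum, smul_sub]

lemma dsum_smul (K : ℕ) (a c : ℂ) (g : ℕ → E) :
    dsum K a (fun p => c • g p) = c • dsum K a g := by
  simp [dsum, Finset.smul_sum, smul_comm c]

lemma map_dsum {F : Type*} [AddCommGroup F] [Module ℂ F] (φ : E →ₗ[ℂ] F) (K : ℕ) (a : ℂ)
    (g : ℕ → E) : φ (dsum K a g) = dsum K a (fun p => φ (g p)) := by
  simp [dsum]

lemma dsum_comm (K L : ℕ) (a b : ℂ) (g : ℕ → ℕ → E) :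
    dsum K a (fun p => dsum L b (fun q => g p q)) =
      dsum L b (fun q => dsum K a (fun p => g p q)) := by
  simp only [dsum, Finset.smul_sum]
  rw [Finset.sum_comm]
  simp only [smul_comm (dpow a _)]

lemma dsum_of_le {K L : ℕ} (h : K ≤ L) (a : ℂ) {g : ℕ → E} (hg : ∀ p, K ≤ p → g p = 0) :
    dsum L a g = dsum K a g := by
  refine (Finset.sum_subset (Finset.range_subset_range.mpr h) fun p _ hp => ?_).symm
  rw [hg p (by simpa using hp), smul_zero]

lemma smul_dsum (K : ℕ) (a : ℂ) (g : ℕ → E) :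
    a • dsum K a g = dsum (K + 1) a (fun p => (p : ℂ) • g (p - 1)) := by
  rw [dsum, dsum, Finset.sum_range_succ', Finset.smul_sum]
  simp [smul_smul, mul_dpow, mul_comm]

lemma dsum_add_arg {K : ℕ} (a b : ℂ) {g : ℕ → E} (hg : ∀ p, K ≤ p → g p = 0) :
    dsum K (a + b) g = dsum K a (fun p => dsum K b (fun q => g (p + q))) := by
  have h1 : dsum K (a + b) g = ∑ n ∈ Finset.range K, ∑ p ∈ Finset.range (n + 1),
      (dpow a p * dpow b (n - p)) • g (p + (n - p)) := by
    refine Finset.sum_congr rfl fun n _ => ?_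
    rw [dpow_add, Finset.sum_smul]
    refine Finset.sum_congr rfl fun p hp => ?_
    rw [Nat.add_sub_cancel' (Nat.lt_succ_iff.mp (Finset.mem_range.mp hp))]
  rw [h1, Finset.sum_range_diag_flip K (fun p q => (dpow a p * dpow b q) • g (p + q))]
  refine Finset.sum_congr rfl fun p _ => ?_
  simp only [dsum, Finset.smul_sum, smul_smul]
  refine Finset.sum_subset (Finset.range_subset_range.mpr (Nat.sub_le _ _)) fun q _ hq => ?_
  rw [hg (p + q) (by simp at hq; omega), smul_zero]

lemma dsum_single_zero {K : ℕ} (hK : 0 < K) (a : ℂ) (x : E) :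
    dsum K a (fun p => if p = 0 then x else 0) = x := by
  rw [dsum, Finset.sum_eq_single_of_mem 0 (Finset.mem_range.mpr hK)]
  · simp [dpow]
  · intro p _ hp; simp [hp]

/-- A vector-valued polynomial that vanishes at all positive integers has zero coefficients. -/
lemma eq_zero_of_dsum_eq_zero {K : ℕ} {g : ℕ → E}
    (h : ∀ k : ℕ, 1 ≤ k → dsum K (k : ℂ) g = 0) : ∀ p < K, g p = 0 := by
  intro p hp
  refine (Module.forall_dual_apply_eq_zero_iff ℂ (g p)).mp fun φ => ?_
  set P : Polynomial ℂ :=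
    ∑ q ∈ Finset.range K, Polynomial.monomial q (φ (g q) / q.factorial) with hP
  have hP0 : P = 0 := by
    refine Polynomial.eq_zero_of_infinite_isRoot P ?_
    refine Set.Infinite.mono (s := Set.range fun k : ℕ => ((k + 1 : ℕ) : ℂ)) ?_
      (Set.infinite_range_of_injective fun a b hab => by simpa using hab)
    rintro _ ⟨k, rfl⟩
    have := congrArg φ (h (k + 1) (by omega))
    rw [map_dsum, map_zero] at this
    rw [Set.mem_ofPred_eq, Polynomial.IsRoot, hP, Polynomial.eval_finsetSum, ← this, dsum]
    refine Finset.sum_congr rfl fun q _ => ?_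
    simp only [Polynomial.eval_monomial, dpow, smul_eq_mul]
    ring
  have hc : P.coeff p = φ (g p) / p.factorial := by
    rw [hP, Polynomial.finsetSum_coeff]
    simp [Polynomial.coeff_monomial, hp]
  rw [hP0, Polynomial.coeff_zero] at hc
  have h' : ((p.factorial : ℕ) : ℂ) ≠ 0 := by exact_mod_cast p.factorial_ne_zero
  exact (div_eq_zero_iff.mp hc.symm).resolve_right h'

/-- The sum `∑_i (m^i / i!) f(i)` over the pairs `i` with entries less than `K`. -/
def jetSum (K : ℕ) (m : ℤ × ℤ) (f : ℕ × ℕ → E) : E :=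
  dsum K (m.1 : ℂ) fun i => dsum K (m.2 : ℂ) fun j => f (i, j)

lemma jetSum_of_le {K L : ℕ} (h : K ≤ L) (m : ℤ × ℤ) {f : ℕ × ℕ → E} (hf : BoxSupported K f) :
    jetSum L m f = jetSum K m f := by
  rw [jetSum, jetSum, dsum_of_le h]
  · refine congrArg _ (funext fun i => dsum_of_le h _ fun j hj => hf _ (Or.inr hj))
  · intro i hi
    rw [show (fun j => f (i, j)) = fun _ => 0 from funext fun j => hf _ (Or.inl hi), dsum_zero_fun]

lemma map_jetSum {F : Type*} [AddCommGroup F] [Module ℂ F] (φ : E →ₗ[ℂ] F) (K : ℕ) (m : ℤ × ℤ)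
    (f : ℕ × ℕ → E) : φ (jetSum K m f) = jetSum K m (fun p => φ (f p)) := by
  simp [jetSum, map_dsum]

lemma jetSum_add (K : ℕ) (m : ℤ × ℤ) (f g : ℕ × ℕ → E) :
    jetSum K m (fun p => f p + g p) = jetSum K m f + jetSum K m g := by
  simp only [jetSum, dsum_add]

lemma jetSum_sub (K : ℕ) (m : ℤ × ℤ) (f g : ℕ × ℕ → E) :
    jetSum K m (fun p => f p - g p) = jetSum K m f - jetSum K m g := by
  simp only [jetSum, dsum_sub]

lemma jetSum_smul (K : ℕ) (m : ℤ × ℤ) (c : ℂ) (f : ℕ × ℕ → E) :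
    jetSum K m (fun p => c • f p) = c • jetSum K m f := by
  simp only [jetSum, dsum_smul]

lemma jetSum_zero_fun (K : ℕ) (m : ℤ × ℤ) : jetSum K m (fun _ => (0 : E)) = 0 := by
  simp only [jetSum, dsum_zero_fun]

lemma jetSum_single_zero {K : ℕ} (hK : 0 < K) (m : ℤ × ℤ) (x : E) :
    jetSum K m (fun p => if p = 0 then x else 0) = x := by
  have : ∀ i : ℕ, dsum K (m.2 : ℂ) (fun j => if ((i, j) : ℕ × ℕ) = 0 then x else 0) =
      if i = 0 then x else 0 := by
    intro i
    by_cases hi : i = 0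
    · subst hi
      simpa [Prod.ext_iff] using dsum_single_zero hK (m.2 : ℂ) x
    · simpa [Prod.ext_iff, hi] using dsum_zero_fun K _
  simp only [jetSum, this]
  exact dsum_single_zero hK _ x

lemma eq_zero_of_jetSum_eq_zero {K : ℕ} {f : ℕ × ℕ → E}
    (h : ∀ m : ℤ × ℤ, m ≠ 0 → jetSum K m f = 0) : ∀ i, i.1 < K → i.2 < K → f i = 0 := by
  intro i h1 h2
  refine eq_zero_of_dsum_eq_zero (g := fun j => f (i.1, j)) (fun b hb => ?_) i.2 h2
  refine eq_zero_of_dsum_eq_zero (K := K)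
    (g := fun p => dsum K (b : ℂ) fun j => f (p, j)) (fun a _ => ?_) i.1 h1
  have := h ((a : ℤ), (b : ℤ)) (by simp; omega)
  simpa [jetSum] using this

lemma jetSum_add_arg {K : ℕ} (m n : ℤ × ℤ) {f : ℕ × ℕ → E} (hf : BoxSupported K f) :
    jetSum K (m + n) f = jetSum K m fun p => jetSum K n fun q => f (p + q) := by
  simp only [jetSum, Prod.fst_add, Prod.snd_add, Int.cast_add, Prod.mk_add_mk]
  rw [dsum_add_arg]
  · refine congrArg _ (funext fun i => ?_)
    rw [dsum_comm K K (m.2 : ℂ)]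
    refine congrArg _ (funext fun k => ?_)
    rw [dsum_add_arg _ _ fun j hj => hf _ (Or.inr hj)]
  · intro i hi
    rw [show (fun j => f (i, j)) = fun _ => 0 from funext fun j => hf _ (Or.inl hi), dsum_zero_fun]

end DividedPowers

/-! ### Actions of `𝓑₊` and the functions `∑ (m^i / i!) D_i` -/

section Block

variable {E : Type*} [AddCommGroup E] [Module ℂ E]

/-- The linear map on `𝓑₊` with prescribed values on the `D_i`. -/
def BlockPlus.lift (f : ℕ × ℕ → E) : BlockPlus →ₗ[ℂ] E :=
  (Finsupp.linearCombination ℂ f : (ℕ × ℕ →₀ ℂ) →ₗ[ℂ] E)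

lemma BlockPlus.lift_D (f : ℕ × ℕ → E) (i : ℕ × ℕ) : BlockPlus.lift f (BlockPlus.D i) = f i := by
  unfold BlockPlus.lift BlockPlus.D
  erw [Finsupp.linearCombination_single]
  exact one_smul ℂ _

/-- Multiplication by `m(2) n(1)` shifts the coefficients of a sum over `m^p n^q / (p! q!)`. -/
lemma smul_jetSum_snd_fst {K : ℕ} (m n : ℤ × ℤ) {G : ℕ × ℕ → ℕ × ℕ → E}
    (hG : ∀ p q, K ≤ p.1 ∨ K ≤ p.2 ∨ K ≤ q.1 ∨ K ≤ q.2 → G p q = 0) :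
    ((m.2 : ℂ) * n.1) • jetSum K m (fun p => jetSum K n fun q => G p q) =
      jetSum (K + 1) m fun p => jetSum (K + 1) n fun q =>
        ((p.2 : ℂ) * q.1) • G (p.1, p.2 - 1) (q.1 - 1, q.2) := by
  have h1 : ∀ p, (n.1 : ℂ) • jetSum K n (fun q => G p q) =
      jetSum (K + 1) n fun q => (q.1 : ℂ) • G p (q.1 - 1, q.2) := by
    intro p
    rw [jetSum, smul_dsum, jetSum]
    refine congrArg _ (funext fun i => ?_)
    rw [← dsum_of_le (Nat.le_succ K), ← dsum_smul]
    exact fun j hj => hG _ _ (by simp; omega)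
  rw [mul_smul, ← jetSum_smul]
  simp only [h1]
  rw [jetSum, ← dsum_smul]
  simp only [smul_dsum]
  rw [← dsum_of_le (Nat.le_succ K) (m.1 : ℂ)]
  · refine congrArg _ (funext fun i => congrArg _ (funext fun j => ?_))
    rw [← jetSum_smul]
    simp only [smul_smul]
  · intro i hi
    have : ∀ j, jetSum (K + 1) n (fun q => (q.1 : ℂ) • G (i, j - 1) (q.1 - 1, q.2)) = 0 := by
      intro j
      rw [show (fun q : ℕ × ℕ => (q.1 : ℂ) • G (i, j - 1) (q.1 - 1, q.2)) = fun _ => 0 from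
        funext fun q => by rw [hG _ _ (Or.inl hi), smul_zero], jetSum_zero_fun]
    simp only [this, smul_zero, dsum_zero_fun]

/-- Multiplication by `m(1) n(2)` shifts the coefficients of a sum over `m^p n^q / (p! q!)`. -/
lemma smul_jetSum_fst_snd {K : ℕ} (m n : ℤ × ℤ) {G : ℕ × ℕ → ℕ × ℕ → E}
    (hG : ∀ p q, K ≤ p.1 ∨ K ≤ p.2 ∨ K ≤ q.1 ∨ K ≤ q.2 → G p q = 0) :
    ((m.1 : ℂ) * n.2) • jetSum K m (fun p => jetSum K n fun q => G p q) =
      jetSum (K + 1) m fun p => jetSum (K + 1) n fun q =>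
        ((p.1 : ℂ) * q.2) • G (p.1 - 1, p.2) (q.1, q.2 - 1) := by
  have h1 : ∀ p, (n.2 : ℂ) • jetSum K n (fun q => G p q) =
      jetSum (K + 1) n fun q => (q.2 : ℂ) • G p (q.1, q.2 - 1) := by
    intro p
    rw [jetSum, ← dsum_smul, jetSum]
    rw [← dsum_of_le (Nat.le_succ K)]
    · exact congrArg _ (funext fun i => smul_dsum _ _ _)
    · intro i hi
      rw [show (fun j => G p (i, j)) = fun _ => 0 from
        funext fun j => hG _ _ (by simp; omega), dsum_zero_fun, smul_zero]
  rw [mul_smul, ← jetSum_smul]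
  simp only [h1]
  rw [jetSum, smul_dsum, jetSum]
  refine congrArg _ (funext fun i => ?_)
  rw [← dsum_smul, ← dsum_of_le (Nat.le_succ K) (m.2 : ℂ)]
  · refine congrArg _ (funext fun j => ?_)
    rw [← jetSum_smul]
    simp only [smul_smul]
  · intro j hj
    rw [show (fun q : ℕ × ℕ => (q.2 : ℂ) • G (i - 1, j) (q.1, q.2 - 1)) = fun _ => 0 from
        funext fun q => by rw [hG _ _ (Or.inr (Or.inl hj)), smul_zero], jetSum_zero_fun, smul_zero]

/-- The coefficient at `m^p n^q / (p! q!)` of `det (n over m) (P(m + n) - P(m) - P(n))`, for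
`P(m) = ∑ (m^i / i!) f(i)`. Multiplication by `m(2) n(1)` or `m(1) n(2)` lowers the indices, and the
conditional terms come from `P(m)` and `P(n)`; they produce the exceptional brackets of `𝓑₊`, between
elements of degree one. -/
lemma lift_lieBasis (f : ℕ × ℕ → E) (p q : ℕ × ℕ) :
    BlockPlus.lift f (BlockPlus.lieBasis p q) =
      ((p.2 : ℂ) * q.1) • (f ((p.1, p.2 - 1) + (q.1 - 1, q.2))
        - (if ((q.1 - 1, q.2) : ℕ × ℕ) = 0 then f (p.1, p.2 - 1) else 0)
        - (if ((p.1, p.2 - 1) : ℕ × ℕ) = 0 then f (q.1 - 1, q.2) else 0)) -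
      ((p.1 : ℂ) * q.2) • (f ((p.1 - 1, p.2) + (q.1, q.2 - 1))
        - (if ((q.1, q.2 - 1) : ℕ × ℕ) = 0 then f (p.1 - 1, p.2) else 0)
        - (if ((p.1 - 1, p.2) : ℕ × ℕ) = 0 then f (q.1, q.2 - 1) else 0)) := by
  obtain ⟨a, b⟩ := p
  obtain ⟨c, d⟩ := q
  have hD : ∀ i, BlockPlus.lift f (BlockPlus.D i) = f i := BlockPlus.lift_D f
  rcases a with _ | a <;> rcases b with _ | b <;> rcases c with _ | c <;> rcases d with _ | d <;>
    simp [BlockPlus.lieBasis, det2, BlockPlus.natC, apply_ite (BlockPlus.lift f), hD]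
  · rcases b with _ | b <;> rcases c with _ | c <;> simp [mul_comm]
  · rw [if_congr (and_iff_left (by omega)) rfl rfl, show b + 1 + d = b + (d + 1) by omega]
    rcases b with _ | b <;> simp [mul_comm]
  · rcases a with _ | a <;> rcases d with _ | d <;> simp [mul_comm]
  · rw [if_congr (and_iff_left (by omega)) rfl rfl, show a + 1 + c = a + (c + 1) by omega]
    rcases a with _ | a <;> simp [mul_comm]
  · rw [if_congr (and_iff_right (by omega)) rfl rfl]
    rcases d with _ | d <;> simp [mul_comm]
  · rw [if_congr (and_iff_right (by omega)) rfl rfl]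
    rcases c with _ | c <;> simp [mul_comm]
  · rw [if_pos (by omega), show a + 1 + c = a + (c + 1) by omega,
      show b + 1 + d = b + (d + 1) by omega, sub_smul, mul_comm ((c : ℂ) + 1),
      mul_comm ((d : ℂ) + 1)]

/-- The bracket of `𝓑₊` encodes the function `det (n over m) (P(m + n) - P(m) - P(n))` for
`P(m) = ∑ (m^i / i!) f(i)`. -/
lemma jetSum_lieBasis {K : ℕ} (hK : 0 < K) (m n : ℤ × ℤ) {f : ℕ × ℕ → E} (hf : BoxSupported K f) :
    det2 (toC n) (toC m) • (jetSum K (m + n) f - jetSum K m f - jetSum K n f) =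
      jetSum (K + 1) m fun p => jetSum (K + 1) n fun q =>
        BlockPlus.lift f (BlockPlus.lieBasis p q) := by
  set G : ℕ × ℕ → ℕ × ℕ → E := fun p q =>
    f (p + q) - (if q = 0 then f p else 0) - (if p = 0 then f q else 0) with hGdef
  have hG : ∀ p q, K ≤ p.1 ∨ K ≤ p.2 ∨ K ≤ q.1 ∨ K ≤ q.2 → G p q = 0 := by
    intro p q h
    have h0 : f (p + q) = 0 := hf _ (by simp only [Prod.fst_add, Prod.snd_add]; omega)
    simp only [hGdef, h0]
    by_cases hp : p = 0
    · subst hp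
      by_cases hq : q = 0
      · subst hq; simp at h; omega
      · rw [zero_add] at h0; simp [hq, h0]
    · by_cases hq : q = 0
      · subst hq; rw [add_zero] at h0; simp [hp, h0]
      · simp [hp, hq]
  have hsum : jetSum K (m + n) f - jetSum K m f - jetSum K n f =
      jetSum K m fun p => jetSum K n fun q => G p q := by
    rw [jetSum_add_arg m n hf]
    simp only [hGdef, jetSum_sub]
    congr 1
    · congr 1
      exact congrArg _ (funext fun p => (jetSum_single_zero hK n (f p)).symm)
    · have : ∀ p : ℕ × ℕ, jetSum K n (fun q => if p = 0 then f q else 0) =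
          if p = 0 then jetSum K n f else 0 := by
        intro p
        by_cases hp : p = 0
        · simp [hp]
        · simp [hp, jetSum_zero_fun]
      simp only [this, jetSum_single_zero hK]
  rw [hsum, show det2 (toC n) (toC m) = (m.2 : ℂ) * n.1 - (m.1 : ℂ) * n.2 by
    simp [det2, toC]; ring, sub_smul, smul_jetSum_snd_fst m n hG, smul_jetSum_fst_snd m n hG,
    ← jetSum_sub]
  refine congrArg _ (funext fun p => ?_)
  rw [← jetSum_sub]
  refine congrArg _ (funext fun q => ?_)
  rw [lift_lieBasis]

end Block

section BlockRep

lemma jetSum_ext {E : Type*} [AddCommGroup E] [Module ℂ E] {K L : ℕ} {f g : ℕ × ℕ → E}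
    (hf : BoxSupported K f) (hg : BoxSupported L g)
    (h : ∀ m : ℤ × ℤ, m ≠ 0 → jetSum K m f = jetSum L m g) : f = g := by
  have hf' := hf.mono (le_max_left K L)
  have hg' := hg.mono (le_max_right K L)
  funext i
  by_cases hi : max K L ≤ i.1 ∨ max K L ≤ i.2
  · rw [hf' i hi, hg' i hi]
  · push Not at hi
    refine sub_eq_zero.mp (eq_zero_of_jetSum_eq_zero (f := fun i => f i - g i) (K := max K L)
      (fun m hm => ?_) i hi.1 hi.2)
    rw [jetSum_sub, jetSum_of_le (le_max_left K L) m hf, jetSum_of_le (le_max_right K L) m hg,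
      h m hm, sub_self]

lemma jetSum_lie {E : Type*} [LieRing E] [LieAlgebra ℂ E] (K L : ℕ) (m n : ℤ × ℤ)
    (f g : ℕ × ℕ → E) : ⁅jetSum K m f, jetSum L n g⁆ =
      jetSum K m fun p => jetSum L n fun q => ⁅f p, g q⁆ := by
  have h1 : ∀ y : E, ⁅jetSum K m f, y⁆ = jetSum K m fun p => ⁅f p, y⁆ := fun y =>
    map_jetSum ((LieAlgebra.ad ℂ E).toLinearMap.flip y) K m f
  rw [h1]
  exact congrArg _ (funext fun p => map_jetSum (LieAlgebra.ad ℂ E (f p)) L n g)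

variable {U : Type*} [AddCommGroup U] [Module ℂ U]

/-- Only finitely many `D_i` act nontrivially on a finite-dimensional module: `D_i` is an
eigenvector of `ad D_{(1,1)}` for the eigenvalue `i(1) - i(2)`, so `D_{(K,0)}` and `D_{(0,K)}` act
as zero for large `K`, and brackets with them give all `D_i` with a large entry. -/
lemma exists_boxSupported [Module.Finite ℂ U] (ρ : BlockPlus →ₗ⁅ℂ⁆ Module.End ℂ U) :
    ∃ K, 0 < K ∧ BoxSupported K fun i => ρ (BlockPlus.D i) := by
  set A : Module.End ℂ (Module.End ℂ U) := LieAlgebra.ad ℂ (Module.End ℂ U) (ρ (BlockPlus.D (1, 1)))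
  have hfin := A.finite_hasEigenvalue
  have hD : ∀ i j : ℕ, 2 ≤ i + j →
      A (ρ (BlockPlus.D (i, j))) = ((i : ℂ) - j) • ρ (BlockPlus.D (i, j)) := by
    intro i j hij
    change ⁅ρ _, ρ _⁆ = _
    rw [← LieHom.map_lie, BlockPlus.lie_D, BlockPlus.lieBasis, if_pos ⟨by norm_num, hij⟩,
      map_smul]
    simp [det2, BlockPlus.natC]
  -- no integer of absolute value at least `K` is an eigenvalue
  obtain ⟨K, hK2, hK⟩ : ∃ K : ℕ,
      2 ≤ K ∧ ¬ A.HasEigenvalue (K : ℂ) ∧ ¬ A.HasEigenvalue (-(K : ℂ)) := by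
    have h1 : {k : ℕ | A.HasEigenvalue (k : ℂ)}.Finite :=
      hfin.preimage (f := fun k : ℕ => (k : ℂ)) fun a _ b _ h => by simpa using h
    have h2 : {k : ℕ | A.HasEigenvalue (-(k : ℂ))}.Finite :=
      hfin.preimage (f := fun k : ℕ => -(k : ℂ)) fun a _ b _ h => by simpa using h
    obtain ⟨K, hK⟩ := ((h1.union h2).union (Set.finite_lt_nat 2)).exists_notMem
    simp only [Set.mem_union, Set.mem_ofPred_eq, not_or, not_lt] at hK
    exact ⟨K, hK.2, hK.1.1, hK.1.2⟩
  have hzero : ∀ i j : ℕ, 2 ≤ i + j → ¬ A.HasEigenvalue ((i : ℂ) - j) →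
      ρ (BlockPlus.D (i, j)) = 0 := by
    intro i j hij hne
    by_contra h0
    exact hne (Module.End.hasEigenvalue_of_hasEigenvector
      ⟨Module.End.mem_eigenspace_iff.mpr (hD i j hij), h0⟩)
  have e1 : ρ (BlockPlus.D (K, 0)) = 0 := hzero K 0 (by omega) (by simpa using hK.1)
  have e2 : ρ (BlockPlus.D (0, K)) = 0 := hzero 0 K (by omega) (by simpa using hK.2)
  refine ⟨K, by omega, ?_⟩
  rintro ⟨a, b⟩ h
  dsimp only at h ⊢
  -- `D_(a,b)` is a nonzero multiple of a bracket with `D_(K,0)` or `D_(0,K)`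
  rcases h with h | h
  · have h3 := congrArg ρ (BlockPlus.lie_D (K, 0) (a - K + 1, b + 1))
    rw [LieHom.map_lie, e1, zero_lie, BlockPlus.lieBasis,
      if_pos ⟨by simpa using hK2, by dsimp only; omega⟩, map_smul] at h3
    rcases smul_eq_zero.mp h3.symm with h4 | h4
    · exfalso
      simp only [det2, BlockPlus.natC, Nat.cast_zero, mul_zero, zero_sub, neg_eq_zero,
        mul_eq_zero, Nat.cast_eq_zero] at h4
      omega
    · convert h4 using 4 <;> omega
  · have h3 := congrArg ρ (BlockPlus.lie_D (0, K) (a + 1, b - K + 1))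
    rw [LieHom.map_lie, e2, zero_lie, BlockPlus.lieBasis,
      if_pos ⟨by simpa using hK2, by dsimp only; omega⟩, map_smul] at h3
    rcases smul_eq_zero.mp h3.symm with h4 | h4
    · exfalso
      simp only [det2, BlockPlus.natC, Nat.cast_zero, mul_zero, sub_zero,
        mul_eq_zero, Nat.cast_eq_zero] at h4
      omega
    · convert h4 using 4 <;> omega

lemma finite_D_ne_zero [Module.Finite ℂ U] (ρ : BlockPlus →ₗ⁅ℂ⁆ Module.End ℂ U) :
    {i : ℕ × ℕ | ρ (BlockPlus.D i) ≠ 0}.Finite := by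
  obtain ⟨K, -, hK⟩ := exists_boxSupported ρ
  refine (Finset.range K ×ˢ Finset.range K).finite_toSet.subset fun i hi => ?_
  by_contra h
  simp only [Finset.coe_product, Finset.coe_range, Set.mem_prod, Set.mem_Iio] at h
  exact hi (hK i (by omega))

lemma polyOp_eq_jetSum (ρ : BlockPlus →ₗ⁅ℂ⁆ Module.End ℂ U) {K : ℕ}
    (hK : BoxSupported K fun i => ρ (BlockPlus.D i)) (m : ℤ × ℤ) :
    polyOp ρ m = jetSum K m fun i => ρ (BlockPlus.D i) := by
  rw [polyOp, finsum_eq_sum_of_support_subset (s := Finset.range K ×ˢ Finset.range K),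
    Finset.sum_product]
  · simp only [jetSum, dsum, dpow, Finset.smul_sum, smul_smul]
    refine Finset.sum_congr rfl fun i _ => Finset.sum_congr rfl fun j _ => ?_
    congr 1
    rw [div_mul_div_comm]
  · intro i hi
    by_contra h
    simp only [Finset.coe_product, Finset.coe_range, Set.mem_prod, Set.mem_Iio] at h
    exact hi (by simp only [hK i (by omega), smul_zero])

lemma polyOp_apply_eq_jetSum (ρ : BlockPlus →ₗ⁅ℂ⁆ Module.End ℂ U) {K : ℕ}
    (hK : BoxSupported K fun i => ρ (BlockPlus.D i)) (m : ℤ × ℤ) (v : U) :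
    polyOp ρ m v = jetSum K m fun i => ρ (BlockPlus.D i) v := by
  rw [polyOp_eq_jetSum ρ hK]
  exact map_jetSum (LinearMap.applyₗ v) K m _

lemma lift_comp_D (ρ : BlockPlus →ₗ⁅ℂ⁆ Module.End ℂ U) (x : BlockPlus) :
    BlockPlus.lift (fun i => ρ (BlockPlus.D i)) x = ρ x :=
  LinearMap.congr_fun (BlockPlus.lin_ext (g := ρ.toLinearMap) fun i => BlockPlus.lift_D _ i) x

lemma blockHom_ext {L : Type*} [LieRing L] [LieAlgebra ℂ L] {ρ σ : BlockPlus →ₗ⁅ℂ⁆ L}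
    (h : ∀ i, ρ (BlockPlus.D i) = σ (BlockPlus.D i)) : ρ = σ := by
  ext x
  exact LinearMap.congr_fun (BlockPlus.lin_ext (f := ρ.toLinearMap) (g := σ.toLinearMap) h) x

/-- The operators `P(m) = ∑ (m^i / i!) D_i` satisfy the functional equation of jet modules. -/
lemma polyOp_lie [Module.Finite ℂ U] (ρ : BlockPlus →ₗ⁅ℂ⁆ Module.End ℂ U) (m n : ℤ × ℤ) :
    ⁅polyOp ρ m, polyOp ρ n⁆ =
      det2 (toC n) (toC m) • (polyOp ρ (m + n) - polyOp ρ m - polyOp ρ n) := by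
  obtain ⟨K, hK0, hK⟩ := exists_boxSupported ρ
  simp only [polyOp_eq_jetSum ρ hK]
  rw [jetSum_lieBasis hK0 m n hK, ← jetSum_of_le (Nat.le_succ K) m hK,
    ← jetSum_of_le (Nat.le_succ K) n hK, jetSum_lie]
  simp only [lift_comp_D, ← LieHom.map_lie, BlockPlus.lie_D]

/-- Define a Lie algebra homomorphism on `𝓑₊` by its values on the `D_i`. -/
def BlockPlus.liftLie {L : Type*} [LieRing L] [LieAlgebra ℂ L] (f : ℕ × ℕ → L)
    (h : ∀ i j, BlockPlus.lift f (BlockPlus.lieBasis i j) = ⁅f i, f j⁆) : BlockPlus →ₗ⁅ℂ⁆ L where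
  __ := BlockPlus.lift f
  map_lie' := by
    intro x y
    change BlockPlus.lift f ⁅x, y⁆ = ⁅BlockPlus.lift f x, BlockPlus.lift f y⁆
    have : (LieModule.toEnd ℂ BlockPlus BlockPlus).toLinearMap.compr₂ (BlockPlus.lift f) =
        (LieModule.toEnd ℂ L L).toLinearMap.compl₁₂ (BlockPlus.lift f) (BlockPlus.lift f) := by
      refine BlockPlus.lin_ext fun i => BlockPlus.lin_ext fun j => ?_
      change BlockPlus.lift f ⁅BlockPlus.D i, BlockPlus.D j⁆ =
        ⁅BlockPlus.lift f (BlockPlus.D i), BlockPlus.lift f (BlockPlus.D j)⁆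
      rw [BlockPlus.lie_D, BlockPlus.lift_D, BlockPlus.lift_D, h]
    exact LinearMap.congr_fun₂ this x y

lemma BlockPlus.liftLie_D {L : Type*} [LieRing L] [LieAlgebra ℂ L] (f : ℕ × ℕ → L)
    (h : ∀ i j, BlockPlus.lift f (BlockPlus.lieBasis i j) = ⁅f i, f j⁆) (i : ℕ × ℕ) :
    BlockPlus.liftLie f h (BlockPlus.D i) = f i :=
  BlockPlus.lift_D f i

/-- The coefficients of a polynomial solution `P` of
`[P(m), P(n)] = det (n over m) (P(m + n) - P(m) - P(n))` form a representation of `𝓑₊`. -/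
lemma exists_blockRep {K : ℕ} (hK0 : 0 < K) {f : ℕ × ℕ → Module.End ℂ U}
    (hf : BoxSupported K f)
    (h : ∀ m n : ℤ × ℤ, m ≠ 0 → n ≠ 0 → ⁅jetSum K m f, jetSum K n f⁆ =
      det2 (toC n) (toC m) • (jetSum K (m + n) f - jetSum K m f - jetSum K n f)) :
    ∃ ρ : BlockPlus →ₗ⁅ℂ⁆ Module.End ℂ U, ∀ i, ρ (BlockPlus.D i) = f i := by
  have hb : ∀ m n : ℤ × ℤ, m ≠ 0 → n ≠ 0 →
      (jetSum (K + 1) m fun p => jetSum (K + 1) n fun q =>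
        BlockPlus.lift f (BlockPlus.lieBasis p q)) =
      jetSum (K + 1) m fun p => jetSum (K + 1) n fun q => ⁅f p, f q⁆ := by
    intro m n hm hn
    rw [← jetSum_lieBasis hK0 m n hf, ← jetSum_lie, jetSum_of_le (Nat.le_succ K) m hf,
      jetSum_of_le (Nat.le_succ K) n hf, h m n hm hn]
  -- both sides vanish outside the box, and inside one compares coefficients
  have hlb : ∀ p q : ℕ × ℕ, K + 1 ≤ p.1 ∨ K + 1 ≤ p.2 ∨ K + 1 ≤ q.1 ∨ K + 1 ≤ q.2 →
      BlockPlus.lift f (BlockPlus.lieBasis p q) = 0 := by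
    intro p q hpq
    unfold BlockPlus.lieBasis
    split_ifs with h1 h2 h3
    · rw [map_smul, BlockPlus.lift_D, hf _ (by dsimp only; omega), smul_zero]
    · obtain ⟨rfl, rfl⟩ := h2
      simp at hpq; omega
    · obtain ⟨rfl, rfl⟩ := h3
      simp at hpq; omega
    · exact map_zero _
  refine ⟨BlockPlus.liftLie f fun p q => ?_, BlockPlus.liftLie_D f _⟩
  by_cases hpq : K + 1 ≤ p.1 ∨ K + 1 ≤ p.2 ∨ K + 1 ≤ q.1 ∨ K + 1 ≤ q.2
  · rw [hlb p q hpq]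
    by_cases hp : K ≤ p.1 ∨ K ≤ p.2
    · rw [hf p hp, zero_lie]
    · rw [hf q (by omega), lie_zero]
  · push Not at hpq
    have key := fun (n : ℤ × ℤ) (hn : n ≠ 0) => eq_zero_of_jetSum_eq_zero
      (f := fun p => jetSum (K + 1) n (fun q => BlockPlus.lift f (BlockPlus.lieBasis p q)) -
        jetSum (K + 1) n (fun q => ⁅f p, f q⁆)) (K := K + 1)
      (fun m hm => by rw [jetSum_sub, hb m n hm hn, sub_self]) p hpq.1 hpq.2.1
    refine sub_eq_zero.mp (eq_zero_of_jetSum_eq_zero (K := K + 1) (f := fun q =>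
      BlockPlus.lift f (BlockPlus.lieBasis p q) - ⁅f p, f q⁆) (fun n hn => ?_) q
      hpq.2.2.1 hpq.2.2.2)
    rw [jetSum_sub]
    exact key n hn

end BlockRep

/-! ### Sequences annihilated by polynomials in the shift -/

section Sequences

open Polynomial

variable {E : Type*} [AddCommGroup E] [Module ℂ E]

variable (E) in
/-- The shift `f ↦ f(· + 1)` on two-sided sequences. -/
def shift : Module.End ℂ (ℤ → E) := LinearMap.funLeft ℂ E fun k => k + 1

@[simp] lemma shift_apply (f : ℤ → E) (k : ℤ) : shift E f k = f (k + 1) := rfl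

variable (E) in
/-- Multiplication of a sequence by its index. -/
def indexMul : Module.End ℂ (ℤ → E) where
  toFun f k := (k : ℂ) • f k
  map_add' f g := by ext; simp
  map_smul' c f := by ext; simp [smul_comm c]

@[simp] lemma indexMul_apply (f : ℤ → E) (k : ℤ) : indexMul E f k = (k : ℂ) • f k := rfl

lemma shift_mul_indexMul : shift E * indexMul E = indexMul E * shift E + shift E := by
  ext f k
  simp [add_smul]

/-- The commutation of `q(S)` with multiplication by the index produces the derivative of `q`. -/
lemma aeval_shift_mul_indexMul (q : ℂ[X]) :
    aeval (shift E) q * indexMul E =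
      indexMul E * aeval (shift E) q + shift E * aeval (shift E) (derivative q) := by
  have hpow : ∀ n : ℕ, shift E ^ n * indexMul E =
      indexMul E * shift E ^ n + (n : ℂ) • shift E ^ n := by
    intro n
    induction n with
    | zero => simp
    | succ n ih =>
      rw [pow_succ', mul_assoc, ih, mul_add, ← mul_assoc, shift_mul_indexMul, add_mul,
        mul_smul_comm, mul_assoc, ← pow_succ']
      push_cast
      rw [add_smul, one_smul]
      abel
  induction q using Polynomial.induction_on' with
  | add p q hp hq => simp only [map_add, add_mul, mul_add, hp, hq]; abel
  | monomial n c =>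
    rw [derivative_monomial, aeval_monomial, aeval_monomial]
    simp only [Algebra.algebraMap_eq_smul_one, mul_smul_comm, smul_mul_assoc, one_mul,
      hpow, smul_add, smul_smul]
    rcases n with _ | n
    · simp
    · rw [add_tsub_cancel_right, pow_succ']

/-- The sequences annihilated by a polynomial in the shift that belongs to `M`. -/
def shiftTorsion (E : Type*) [AddCommGroup E] [Module ℂ E] (M : Submonoid ℂ[X]) :
    Submodule ℂ (ℤ → E) where
  carrier := {f | ∃ q ∈ M, aeval (shift E) q f = 0}
  zero_mem' := ⟨1, M.one_mem, map_zero _⟩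
  add_mem' := by
    rintro f g ⟨p, hp, hf⟩ ⟨q, hq, hg⟩
    refine ⟨p * q, M.mul_mem hp hq, ?_⟩
    rw [map_add]
    nth_rewrite 1 [mul_comm]
    rw [map_mul, map_mul, Module.End.mul_apply, Module.End.mul_apply, hf, hg, map_zero, map_zero,
      add_zero]
  smul_mem' := by
    rintro c f ⟨p, hp, hf⟩
    exact ⟨p, hp, by rw [map_smul, hf, smul_zero]⟩

variable {M : Submonoid ℂ[X]} {f : ℤ → E}

lemma shiftTorsion_of_commute {T : Module.End ℂ (ℤ → E)} (hT : Commute T (shift E))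
    (hf : f ∈ shiftTorsion E M) : T f ∈ shiftTorsion E M := by
  obtain ⟨q, hq, h⟩ := hf
  refine ⟨q, hq, ?_⟩
  have hc : Commute T (aeval (shift E) q) := by
    rw [aeval_eq_sum_range]
    exact Commute.sum_right _ _ _ fun i _ => (hT.pow_right i).smul_right _
  rw [← Module.End.mul_apply, ← hc.eq, Module.End.mul_apply, h, map_zero]

lemma shiftTorsion_map (φ : E →ₗ[ℂ] E) (hf : f ∈ shiftTorsion E M) :
    (fun k => φ (f k)) ∈ shiftTorsion E M :=
  shiftTorsion_of_commute (T := φ.compLeft ℤ) (by ext; rfl) hf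

lemma shiftTorsion_translate (l : ℤ) (hf : f ∈ shiftTorsion E M) :
    (fun k => f (k + l)) ∈ shiftTorsion E M :=
  shiftTorsion_of_commute (T := LinearMap.funLeft ℂ E fun k => k + l)
    (LinearMap.ext fun g => funext fun k => congrArg g (by ring)) hf

lemma shiftTorsion_indexMul (hf : f ∈ shiftTorsion E M) :
    (fun k : ℤ => (k : ℂ) • f k) ∈ shiftTorsion E M := by
  obtain ⟨q, hq, h⟩ := hf
  refine ⟨q * q, M.mul_mem hq hq, ?_⟩
  change (aeval (shift E) (q * q) * indexMul E) f = 0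
  rw [aeval_shift_mul_indexMul, derivative_mul, mul_comm (derivative q), ← two_mul]
  simp [Module.End.mul_apply, h, mul_comm q]

lemma shiftTorsion_linear (a b : ℂ) (hf : f ∈ shiftTorsion E M) :
    (fun k : ℤ => (a * k + b) • f k) ∈ shiftTorsion E M := by
  have := add_mem ((shiftTorsion E M).smul_mem a (shiftTorsion_indexMul hf))
    ((shiftTorsion E M).smul_mem b hf)
  convert this using 1
  ext k
  simp [add_smul, smul_smul]

variable (E) in
/-- The polynomial sequences: those annihilated by a power of the difference operator. -/
def polSeq : Submodule ℂ (ℤ → E) := shiftTorsion E (Submonoid.powers (X - C 1))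

variable (E) in
/-- The sequences annihilated by a polynomial in the shift that does not vanish at `1`. -/
def expSeq : Submodule ℂ (ℤ → E) :=
  shiftTorsion E ((nonZeroDivisors ℂ).comap (evalRingHom (1 : ℂ)))

lemma const_mem_polSeq (c : E) : (fun _ => c) ∈ polSeq E :=
  ⟨X - C 1, ⟨1, pow_one _⟩, by ext k; simp⟩

lemma eq_zero_of_mem_polSeq_of_mem_expSeq (h1 : f ∈ polSeq E) (h2 : f ∈ expSeq E) : f = 0 := by
  obtain ⟨_, ⟨N, rfl⟩, hp⟩ := h1
  obtain ⟨g, hg, hq⟩ := h2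
  have hg1 : g.eval 1 ≠ 0 := by simpa using hg
  have hcop : IsCoprime ((X - C (1 : ℂ)) ^ N) g := by
    refine IsCoprime.pow_left ?_
    refine ((irreducible_X_sub_C (1 : ℂ)).coprime_iff_not_dvd).mpr ?_
    rwa [dvd_iff_isRoot]
  exact Submodule.disjoint_def.mp (disjoint_ker_aeval_of_isCoprime (shift E) hcop) f hp hq

lemma aeval_shift_apply {B : Module.End ℂ E} {w : ℤ → E} (hw : ∀ k, w (k + 1) = B (w k))
    (p : ℂ[X]) (k : ℤ) : aeval (shift E) p w k = aeval B p (w k) := by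
  have hpow : ∀ (n : ℕ) (k : ℤ), (shift E ^ n) w k = (B ^ n) (w k) := by
    intro n
    induction n with
    | zero => intro k; rfl
    | succ n ih =>
      intro k
      rw [pow_succ', Module.End.mul_apply, shift_apply, ih, hw, pow_succ, Module.End.mul_apply]
  induction p using Polynomial.induction_on' with
  | add p q hp hq => simp [hp, hq]
  | monomial n c => simp [aeval_monomial, Algebra.algebraMap_eq_smul_one, hpow]

/-- A sequence whose differences satisfy a first-order recurrence in a finite-dimensional space is
the sum of a polynomial sequence and one without polynomial part. -/
lemma exists_polSeq_add_expSeq [Module.Finite ℂ E] {B : Module.End ℂ E} {x : ℤ → E}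
    (hx : ∀ k, x (k + 1 + 1) - x (k + 1) = B (x (k + 1) - x k)) :
    ∃ u ∈ polSeq E, ∃ y ∈ expSeq E, x = u + y := by
  -- `q` annihilates `x`; its factors `(X - 1)^N` and `g` are coprime, and the Bézout identity
  -- splits `x`
  set q : ℂ[X] := minpoly ℂ B * (X - C 1) with hq
  have hq0 : q ≠ 0 := mul_ne_zero (minpoly.ne_zero (Algebra.IsIntegral.isIntegral B))
    (X_sub_C_ne_zero 1)
  have hqx : aeval (shift E) q x = 0 := by
    rw [hq, map_mul, Module.End.mul_apply]
    ext k
    rw [aeval_shift_apply (B := B) (fun k => by simpa using hx k), minpoly.aeval]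
    rfl
  obtain ⟨g, hg, hgd⟩ := exists_eq_pow_rootMultiplicity_mul_and_not_dvd q hq0 1
  set N := rootMultiplicity 1 q
  have hg1 : g.eval 1 ≠ 0 := by rwa [dvd_iff_isRoot] at hgd
  have hcop : IsCoprime ((X - C (1 : ℂ)) ^ N) g :=
    IsCoprime.pow_left (((irreducible_X_sub_C (1 : ℂ)).coprime_iff_not_dvd).mpr hgd)
  obtain ⟨a, b, hab⟩ := hcop
  refine ⟨aeval (shift E) (b * g) x, ⟨(X - C 1) ^ N, ⟨N, rfl⟩, ?_⟩,
    aeval (shift E) (a * (X - C 1) ^ N) x, ⟨g, by simpa using hg1, ?_⟩, ?_⟩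
  · rw [← Module.End.mul_apply, ← map_mul, show (X - C (1 : ℂ)) ^ N * (b * g) = b * q by
      rw [hg]; ring, map_mul, Module.End.mul_apply, hqx, map_zero]
  · rw [← Module.End.mul_apply, ← map_mul, show g * (a * (X - C (1 : ℂ)) ^ N) = a * q by
      rw [hg]; ring, map_mul, Module.End.mul_apply, hqx, map_zero]
  · rw [← LinearMap.add_apply, ← map_add, add_comm, hab, map_one, Module.End.one_apply]

end Sequences

/-! ### Polynomiality in one direction -/

section OneDirection

open Polynomial

variable {E : Type*} [LieRing E] [LieAlgebra ℂ E] [Module.Finite ℂ E]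

/-- The sequence `x` is polynomial. Write `x = u + y` with `u` polynomial and `y` without polynomial
part. Separating the two kinds of sequences in the commutation relation gives
`⁅y k, u 0⁆ = -δ k y k`, so that `δ k` is an eigenvalue of `ad (u 0)` whenever `y k ≠ 0`. -/
lemma mem_polSeq_of_lie {a : E} {δ : ℂ} (hδ : δ ≠ 0) {x z : ℤ → E}
    (hx : ∀ k, ⁅a, x k⁆ = δ • (x (k + 1) - x k - a))
    (hz : ∀ k, ⁅a, z k⁆ = (2 * δ) • (z (k + 1) - z k - a))
    (hxx : ∀ k l : ℤ, ⁅x k, x l⁆ = (δ * (k - l)) • (z (k + l) - x k - x l)) :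
    x ∈ polSeq E := by
  -- the recurrence, with `B = 1 + ad a / c`
  have hrec : ∀ {c : ℂ} {x : ℤ → E}, c ≠ 0 → (∀ k, ⁅a, x k⁆ = c • (x (k + 1) - x k - a)) →
      ∀ k, x (k + 1) = (1 + c⁻¹ • LieAlgebra.ad ℂ E a) (x k) + a := by
    intro c x hc h k
    simp [h k, smul_smul, hc]; abel
  have hrec' : ∀ {c : ℂ} {x : ℤ → E}, c ≠ 0 → (∀ k, ⁅a, x k⁆ = c • (x (k + 1) - x k - a)) →
      ∀ k, x (k + 1 + 1) - x (k + 1) = (1 + c⁻¹ • LieAlgebra.ad ℂ E a) (x (k + 1) - x k) := by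
    intro c x hc h k
    rw [hrec hc h (k + 1), map_sub, ← sub_eq_of_eq_add (hrec hc h k)]
    abel
  obtain ⟨u, hu, y, hy, hxuy⟩ := exists_polSeq_add_expSeq (hrec' hδ hx)
  obtain ⟨uz, huz, yz, hyz, hzuy⟩ :=
    exists_polSeq_add_expSeq (hrec' (mul_ne_zero two_ne_zero hδ) hz)
  have split : ∀ {p e : ℤ → E}, p ∈ polSeq E → e ∈ expSeq E → p + e = 0 → p = 0 ∧ e = 0 := by
    intro p e hp he h
    have hp0 : p = 0 := eq_zero_of_mem_polSeq_of_mem_expSeq hp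
      (by rw [eq_neg_of_add_eq_zero_left h]; exact neg_mem he)
    exact ⟨hp0, by simpa [hp0] using h⟩
  -- the polynomial part in the second index
  have h1 : ∀ k l : ℤ, ⁅x k, u l⁆ - (δ * (k - l)) • (uz (l + k) - x k - u l) = 0 := by
    intro k
    have hp : (fun l : ℤ => ⁅x k, u l⁆ - (-δ * l + δ * k) • (uz (l + k) - x k - u l)) ∈ polSeq E :=
      sub_mem (shiftTorsion_map (LieAlgebra.ad ℂ E (x k)) hu) (shiftTorsion_linear _ _
        (sub_mem (sub_mem (shiftTorsion_translate k huz) (const_mem_polSeq _)) hu))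
    have he : (fun l : ℤ => ⁅x k, y l⁆ - (-δ * l + δ * k) • (yz (l + k) - y l)) ∈ expSeq E :=
      sub_mem (shiftTorsion_map (LieAlgebra.ad ℂ E (x k)) hy) (shiftTorsion_linear _ _
        (sub_mem (shiftTorsion_translate k hyz) hy))
    have h := (split hp he (funext fun l => by
      have e1 : x l = u l + y l := congrFun hxuy l
      have e2 : z (k + l) = uz (l + k) + yz (l + k) := by
        rw [add_comm k l]; exact congrFun hzuy (l + k)
      have e3 := hxx k l
      rw [e1, e2, lie_add] at e3
      rw [Pi.add_apply, Pi.zero_apply,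
        show ∀ p q r s : E, p - q + (r - s) = (p + r) - (q + s) from fun _ _ _ _ => by abel,
        e3, ← smul_add, show (-δ * l + δ * k) = δ * (k - l) by ring, ← smul_sub]
      convert smul_zero _ using 2
      abel)).1
    intro l
    have := congrFun h l
    rwa [Pi.zero_apply, show (-δ * (l : ℂ) + δ * k) = δ * (k - l) by ring] at this
  -- the other part in the first index
  have h2 : ∀ k : ℤ, ⁅y k, u 0⁆ + (δ * k) • y k = 0 := by
    have hp : (fun k : ℤ => ⁅u k, u 0⁆ - (δ * k + 0) • (uz (k + 0) - u k - u 0)) ∈ polSeq E :=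
      sub_mem (shiftTorsion_map ((LieAlgebra.ad ℂ E).toLinearMap.flip (u 0)) hu)
        (shiftTorsion_linear _ _ (sub_mem (sub_mem (shiftTorsion_translate 0 huz) hu) (const_mem_polSeq _)))
    have he : (fun k : ℤ => ⁅y k, u 0⁆ + (δ * k + 0) • y k) ∈ expSeq E :=
      add_mem (shiftTorsion_map ((LieAlgebra.ad ℂ E).toLinearMap.flip (u 0)) hy)
        (shiftTorsion_linear _ _ hy)
    have h := (split hp he (funext fun k => by
      have e1 : x k = u k + y k := congrFun hxuy k
      have e3 := h1 k 0
      rw [e1, add_lie, zero_add] at e3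
      rw [Pi.add_apply, Pi.zero_apply, ← e3, Int.cast_zero, sub_zero, add_zero, add_zero]
      module)).2
    intro k
    simpa using congrFun h k
  have hfin : {k : ℤ | y k ≠ 0}.Finite := by
    refine ((LieAlgebra.ad ℂ E (u 0)).finite_hasEigenvalue.preimage
      (f := fun k : ℤ => δ * k) (fun a _ b _ h => by simpa [hδ] using h)).subset fun k hk => ?_
    refine Module.End.hasEigenvalue_of_hasEigenvector
      ⟨Module.End.mem_eigenspace_iff.mpr (?_ : ⁅u 0, y k⁆ = _), hk⟩
    rw [← lie_skew, eq_neg_of_add_eq_zero_left (h2 k), neg_neg]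
  have hyrec : ∀ k, y (k + 1) = (1 + δ⁻¹ • LieAlgebra.ad ℂ E a) (y k) := by
    set B := 1 + δ⁻¹ • LieAlgebra.ad ℂ E a
    have h := (split (sub_mem (sub_mem (shiftTorsion_translate 1 hu) (shiftTorsion_map B hu))
      (const_mem_polSeq a)) (sub_mem (shiftTorsion_translate 1 hy) (shiftTorsion_map B hy))
      (funext fun k => by
        have e := hrec hδ hx k
        rw [hxuy] at e
        simp only [Pi.add_apply, map_add] at e
        simp only [Pi.add_apply, Pi.sub_apply, Pi.zero_apply]
        rw [eq_sub_of_add_eq e]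
        simp only [B]
        abel)).2
    exact fun k => sub_eq_zero.mp (congrFun h k)
  have hy0 : y = 0 := by
    obtain ⟨k₀, hk₀⟩ := hfin.bddBelow
    have hlow : ∀ k < k₀, y k = 0 := fun k hk => by
      by_contra h
      exact absurd (hk₀ h) (not_le.mpr hk)
    ext k
    by_cases hk : k < k₀
    · exact hlow k hk
    · have : k₀ - 1 ≤ k := by omega
      induction k, this using Int.leInduction with
      | base => exact hlow _ (by omega)
      | succ k _ ih =>
        rw [hyrec]
        by_cases hk' : k < k₀
        · rw [hlow k hk', map_zero]; rfl
        · rw [ih hk']; exact map_zero _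
  rw [hxuy, hy0, add_zero]
  exact hu

/-- The degree of the polynomial sequence `x` is bounded in terms of `E` only. -/
lemma difference_pow_eq_zero {a : E} {δ : ℂ} (hδ : δ ≠ 0) {x : ℤ → E}
    (hx : ∀ k, ⁅a, x k⁆ = δ • (x (k + 1) - x k - a)) (hpol : x ∈ polSeq E) :
    ((shift E - 1) ^ (Module.finrank ℂ E + 1)) x = 0 := by
  obtain ⟨_, ⟨N, rfl⟩, hN⟩ := hpol
  set B := 1 + δ⁻¹ • LieAlgebra.ad ℂ E a with hB
  set w := (shift E - 1) x with hw
  have hwB : ∀ k, w (k + 1) = B (w k) := by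
    intro k
    have h : ∀ k, x (k + 1) = B (x k) + a := fun k => by simp [hB, hx k, smul_smul, hδ]; abel
    simp only [hw, LinearMap.sub_apply, shift_apply, Module.End.one_apply, Pi.sub_apply]
    rw [h (k + 1), map_sub, ← sub_eq_of_eq_add (h k)]
    abel
  have hpow : ∀ (j : ℕ) (k : ℤ), ((shift E - 1) ^ j) w k = ((B - 1) ^ j) (w k) := by
    intro j k
    have := aeval_shift_apply hwB ((X - C 1) ^ j) k
    simpa using this
  have hNw : ((shift E - 1) ^ N) w = 0 := by
    have : ((shift E - 1) ^ N) x = 0 := by simpa using hN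
    rw [hw, ← Module.End.mul_apply, ← pow_succ, pow_succ', Module.End.mul_apply, this, map_zero]
  rw [pow_succ, Module.End.mul_apply, ← hw]
  ext k
  rw [hpow]
  have hk : w k ∈ LinearMap.ker ((B - 1) ^ N) := by
    rw [LinearMap.mem_ker, ← hpow, hNw]; rfl
  exact Module.End.ker_pow_le_ker_pow_finrank (B - 1) N hk

end OneDirection

/-! ### Polynomiality in two variables -/

section PolyFun

variable {E : Type*} [AddCommGroup E] [Module ℂ E]

/-- Vector-valued polynomial functions on `ℤ`. -/
def IsPolyFun (f : ℤ → E) : Prop :=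
  ∃ (K : ℕ) (c : ℕ → E), (∀ p, K ≤ p → c p = 0) ∧ ∀ k : ℤ, f k = dsum K (k : ℂ) c

/-- Vector-valued polynomial functions on `ℤ²`. -/
def IsPolyFun₂ (f : ℤ × ℤ → E) : Prop :=
  ∃ (K : ℕ) (c : ℕ × ℕ → E), BoxSupported K c ∧ ∀ m, f m = jetSum K m c

lemma IsPolyFun.zero : IsPolyFun (fun _ => (0 : E)) :=
  ⟨0, fun _ => 0, fun _ _ => rfl, fun _ => (dsum_zero_fun _ _).symm⟩

lemma IsPolyFun.sub {f g : ℤ → E} (hf : IsPolyFun f) (hg : IsPolyFun g) :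
    IsPolyFun fun k => f k - g k := by
  obtain ⟨K, c, hc, hf⟩ := hf
  obtain ⟨L, d, hd, hg⟩ := hg
  refine ⟨max K L, fun p => c p - d p, fun p hp => ?_, fun k => ?_⟩
  · beta_reduce
    rw [hc p (le_trans (le_max_left _ _) hp), hd p (le_trans (le_max_right _ _) hp), sub_zero]
  · beta_reduce
    rw [dsum_sub, dsum_of_le (le_max_left _ _) _ hc, dsum_of_le (le_max_right _ _) _ hd, hf, hg]

lemma IsPolyFun.add {f g : ℤ → E} (hf : IsPolyFun f) (hg : IsPolyFun g) :
    IsPolyFun fun k => f k + g k := by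
  simpa using hf.sub (IsPolyFun.zero.sub hg)

lemma IsPolyFun.smul (a : ℂ) {f : ℤ → E} (hf : IsPolyFun f) : IsPolyFun fun k => a • f k := by
  obtain ⟨K, c, hc, hf⟩ := hf
  exact ⟨K, fun p => a • c p, fun p hp => by beta_reduce; rw [hc p hp, smul_zero],
    fun k => by beta_reduce; rw [dsum_smul, hf]⟩

lemma IsPolyFun.smul_const {a : ℤ → ℂ} (ha : IsPolyFun a) (v : E) :
    IsPolyFun fun k => a k • v := by
  obtain ⟨K, c, hc, ha⟩ := ha
  refine ⟨K, fun p => c p • v, fun p hp => ?_, fun k => ?_⟩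
  · beta_reduce
    rw [hc p hp, zero_smul]
  · beta_reduce
    rw [ha]
    simp only [dsum, Finset.sum_smul, smul_smul, smul_eq_mul]

lemma IsPolyFun.sum {ι : Type*} (s : Finset ι) {f : ι → ℤ → E} (h : ∀ i ∈ s, IsPolyFun (f i)) :
    IsPolyFun fun k => ∑ i ∈ s, f i k := by
  classical
  induction s using Finset.induction_on with
  | empty => simpa using IsPolyFun.zero
  | insert i s hi ih =>
    simp only [Finset.sum_insert hi]
    exact (h i (Finset.mem_insert_self _ _)).add
      (ih fun j hj => h j (Finset.mem_insert_of_mem hj))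

/-- A polynomial function is determined by its values at the positive integers. -/
lemma IsPolyFun.eq_of_forall_pos {f g : ℤ → E} (hf : IsPolyFun f) (hg : IsPolyFun g)
    (h : ∀ k : ℤ, 0 < k → f k = g k) : f = g := by
  obtain ⟨K, c, hc, (hfg : ∀ k : ℤ, f k - g k = dsum K (k : ℂ) c)⟩ := hf.sub hg
  have h0 : c = fun _ => 0 := by
    ext p
    by_cases hp : K ≤ p
    · exact hc p hp
    · refine eq_zero_of_dsum_eq_zero (fun k hk => ?_) p (not_le.mp hp)
      have := hfg k
      rw [h k (by omega), sub_self] at this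
      simpa using this.symm
  ext k
  rw [← sub_eq_zero, hfg, h0, dsum_zero_fun]

lemma IsPolyFun.of_polynomial (P : Polynomial ℂ) : IsPolyFun fun k : ℤ => P.eval (k : ℂ) := by
  refine ⟨P.natDegree + 1, fun p => p.factorial * P.coeff p, fun p hp => ?_, fun k => ?_⟩
  · beta_reduce
    rw [Polynomial.coeff_eq_zero_of_natDegree_lt (by omega), mul_zero]
  · beta_reduce
    rw [Polynomial.eval_eq_sum_range, dsum]
    refine Finset.sum_congr rfl fun p _ => ?_
    have h' : ((p.factorial : ℕ) : ℂ) ≠ 0 := by exact_mod_cast p.factorial_ne_zero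
    rw [dpow, smul_eq_mul]
    field_simp

lemma IsPolyFun.choose (j : ℕ) : IsPolyFun fun k : ℤ => ((Ring.choose (k - 1) j : ℤ) : ℂ) := by
  have h' : ((j.factorial : ℕ) : ℂ) ≠ 0 := by exact_mod_cast j.factorial_ne_zero
  have h : ∀ k : ℤ, ((Ring.choose (k - 1) j : ℤ) : ℂ) =
      (Polynomial.C (j.factorial : ℂ)⁻¹ * (descPochhammer ℂ j).comp (Polynomial.X - 1)).eval
        (k : ℂ) := by
    intro k
    have h1 := Ring.descPochhammer_eq_factorial_smul_choose (k - 1) j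
    rw [← Polynomial.eval_eq_smeval] at h1
    have h2 : ((descPochhammer ℂ j).eval ((k - 1 : ℤ) : ℂ)) =
        ((descPochhammer ℤ j).eval (k - 1) : ℤ) := by
      rw [← descPochhammer_map (Int.castRingHom ℂ), Polynomial.eval_map,
        ← eq_intCast (Int.castRingHom ℂ) (k - 1), Polynomial.eval₂_at_apply]
      simp
    simp only [Polynomial.eval_mul, Polynomial.eval_C, Polynomial.eval_comp, Polynomial.eval_sub,
      Polynomial.eval_X, Polynomial.eval_one]
    rw [h1] at h2
    push_cast at h2
    rw [h2, nsmul_eq_mul]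
    push_cast
    field_simp
  simp only [h]
  exact IsPolyFun.of_polynomial _

lemma IsPolyFun₂.zero : IsPolyFun₂ (fun _ => (0 : E)) :=
  ⟨0, fun _ => 0, fun _ _ => rfl, fun _ => (jetSum_zero_fun _ _).symm⟩

lemma IsPolyFun₂.add {f g : ℤ × ℤ → E} (hf : IsPolyFun₂ f) (hg : IsPolyFun₂ g) :
    IsPolyFun₂ fun k => f k + g k := by
  obtain ⟨K, c, hc, hf⟩ := hf
  obtain ⟨L, d, hd, hg⟩ := hg
  have hc' := hc.mono (le_max_left K L)
  have hd' := hd.mono (le_max_right K L)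
  refine ⟨max K L, fun p => c p + d p, fun p hp => ?_, fun k => ?_⟩
  · beta_reduce
    rw [hc' p hp, hd' p hp, add_zero]
  · beta_reduce
    rw [jetSum_add, jetSum_of_le (le_max_left _ _) _ hc, jetSum_of_le (le_max_right _ _) _ hd, hf,
      hg]

lemma IsPolyFun₂.sum {ι : Type*} (s : Finset ι) {f : ι → ℤ × ℤ → E}
    (h : ∀ i ∈ s, IsPolyFun₂ (f i)) : IsPolyFun₂ fun k => ∑ i ∈ s, f i k := by
  classical
  induction s using Finset.induction_on with
  | empty => simpa using IsPolyFun₂.zero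
  | insert i s hi ih =>
    simp only [Finset.sum_insert hi]
    exact (h i (Finset.mem_insert_self _ _)).add
      (ih fun j hj => h j (Finset.mem_insert_of_mem hj))

lemma IsPolyFun₂.prod {a : ℤ → ℂ} {f : ℤ → E} (ha : IsPolyFun a) (hf : IsPolyFun f) :
    IsPolyFun₂ fun m => a m.1 • f m.2 := by
  obtain ⟨K, c, hc, ha⟩ := ha
  obtain ⟨L, d, hd, hf⟩ := hf
  refine ⟨max K L, fun p => c p.1 • d p.2, fun p hp => ?_, fun m => ?_⟩
  · beta_reduce
    rcases hp with hp | hp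
    · rw [hc _ (le_trans (le_max_left _ _) hp), zero_smul]
    · rw [hd _ (le_trans (le_max_right _ _) hp), smul_zero]
  · beta_reduce
    rw [ha, hf, ← dsum_of_le (le_max_left K L) _ hc, ← dsum_of_le (le_max_right K L) _ hd, jetSum]
    simp only [dsum_smul]
    rw [dsum, dsum, Finset.sum_smul]
    simp only [smul_smul, smul_eq_mul, dsum]

/-- Newton's interpolation formula for two-sided sequences with vanishing higher differences. -/
lemma eq_sum_choose_smul {N : ℕ} {x : ℤ → E} (h : ((shift E - 1) ^ N) x = 0) (k : ℤ) :
    x k = ∑ j ∈ Finset.range N, ((Ring.choose k j : ℤ) : ℂ) • ((shift E - 1) ^ j) x 0 := by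
  induction N generalizing x k with
  | zero => simpa using congrFun h k
  | succ N ih =>
    have hstep : ∀ k, x (k + 1) - x k = ∑ j ∈ Finset.range N,
        ((Ring.choose k j : ℤ) : ℂ) • ((shift E - 1) ^ (j + 1)) x 0 := by
      intro k
      have := ih (x := (shift E - 1) x) (by rw [← Module.End.mul_apply, ← pow_succ, h]) k
      simpa [pow_succ] using this
    set R : ℤ → E := fun k => ∑ j ∈ Finset.range (N + 1),
      ((Ring.choose k j : ℤ) : ℂ) • ((shift E - 1) ^ j) x 0 with hR
    have hRstep : ∀ k, R (k + 1) - R k = x (k + 1) - x k := by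
      intro k
      rw [hstep, hR]
      simp only [Finset.sum_range_succ' _ N]
      rw [add_sub_add_comm, ← Finset.sum_sub_distrib]
      simp [Ring.choose_succ_succ, ← sub_smul]
    have h0 : R 0 = x 0 := by
      rw [hR]
      simp [Finset.sum_range_succ', Ring.choose_zero_succ]
    have hdiff : ∀ k, x k = R k := by
      intro k
      induction k using Int.induction_on with
      | zero => exact h0.symm
      | succ i hi =>
        have := hRstep i
        rw [hi] at this
        exact (sub_left_injective this).symm
      | pred i hi =>
        have := hRstep (-i - 1)
        rw [sub_add_cancel, hi] at this
        exact (sub_right_injective this).symm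
    exact hdiff k

lemma IsPolyFun.of_difference_pow {N : ℕ} {x : ℤ → E} (h : ((shift E - 1) ^ N) x = 0) :
    IsPolyFun x := by
  have h' : ((shift E - 1) ^ N) (shift E x) = 0 := by
    rw [← Module.End.mul_apply,
      (((Commute.refl (shift E)).sub_left (Commute.one_left _)).pow_left N).eq,
      Module.End.mul_apply, h, map_zero]
  have hx : x = fun k => ∑ j ∈ Finset.range N,
      ((Ring.choose (k - 1) j : ℤ) : ℂ) • ((shift E - 1) ^ j) (shift E x) 0 := by
    ext k
    rw [← eq_sum_choose_smul h' (k - 1)]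
    simp
  rw [hx]
  exact IsPolyFun.sum _ fun j _ => (IsPolyFun.choose j).smul_const _

end PolyFun

section TwoVariables

variable {E : Type*} [LieRing E] [LieAlgebra ℂ E] [Module.Finite ℂ E]

/-- Polynomiality along a line that does not pass through the origin. -/
lemma difference_pow_line {D : ℤ × ℤ → E}
    (h : ∀ m n : ℤ × ℤ, m ≠ 0 → n ≠ 0 →
      ⁅D m, D n⁆ = det2 (toC n) (toC m) • (D (m + n) - D m - D n))
    (m n : ℤ × ℤ) (hmn : det2 (toC m) (toC n) ≠ 0) :
    ((shift E - 1) ^ (Module.finrank ℂ E + 1)) (fun k => D (m + k • n)) = 0 := by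
  have hn : n ≠ 0 := by rintro rfl; simp [det2, toC] at hmn
  have hne : ∀ (c k : ℤ), c ≠ 0 → c • m + k • n ≠ 0 := by
    intro c k hc h0
    have e1 : (c : ℂ) * m.1 + k * n.1 = 0 := by exact_mod_cast congrArg Prod.fst h0
    have e2 : (c : ℂ) * m.2 + k * n.2 = 0 := by exact_mod_cast congrArg Prod.snd h0
    have : (c : ℂ) * det2 (toC m) (toC n) = 0 := by
      simp only [det2, toC]
      linear_combination (n.2 : ℂ) * e1 - n.1 * e2
    exact (mul_ne_zero (by exact_mod_cast hc) hmn) this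
  have hne1 : ∀ k : ℤ, m + k • n ≠ 0 := fun k => by simpa using hne 1 k one_ne_zero
  have hx : ∀ k : ℤ, ⁅D n, D (m + k • n)⁆ =
      det2 (toC m) (toC n) • (D (m + (k + 1) • n) - D (m + k • n) - D n) := by
    intro k
    rw [h n _ hn (hne1 k), show n + (m + k • n) = m + (k + 1) • n by rw [add_smul, one_smul]; abel,
      sub_right_comm]
    congr 1
    simp [det2, toC]; ring
  refine difference_pow_eq_zero hmn hx (mem_polSeq_of_lie hmn hx
    (z := fun k => D ((2 : ℤ) • m + k • n)) ?_ ?_)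
  · intro k
    rw [h n _ hn (hne 2 k two_ne_zero),
      show n + ((2 : ℤ) • m + k • n) = (2 : ℤ) • m + (k + 1) • n by rw [add_smul k, one_smul]; abel,
      sub_right_comm]
    congr 1
    simp [det2, toC]; ring
  · intro k l
    rw [h _ _ (hne1 k) (hne1 l), show m + k • n + (m + l • n) = (2 : ℤ) • m + (k + l) • n by
      rw [add_smul, two_smul]; abel]
    congr 1
    simp [det2, toC]; ring

/-- A solution on `ℤ² ∖ {0}` of `[D(m), D(n)] = det (n over m) (D(m + n) - D(m) - D(n))` with
values in a finite-dimensional Lie algebra is polynomial. -/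
lemma exists_isPolyFun₂_of_lie {D : ℤ × ℤ → E}
    (h : ∀ m n : ℤ × ℤ, m ≠ 0 → n ≠ 0 →
      ⁅D m, D n⁆ = det2 (toC n) (toC m) • (D (m + n) - D m - D n)) :
    ∃ P : ℤ × ℤ → E, IsPolyFun₂ P ∧ ∀ m, m ≠ 0 → D m = P m := by
  set N := Module.finrank ℂ E + 1
  have hcol : ∀ a : ℤ, a ≠ 0 → IsPolyFun fun b => D (a, b) := by
    intro a ha
    have := difference_pow_line h (a, 0) (0, 1) (by simpa [det2, toC] using ha)
    simpa using IsPolyFun.of_difference_pow this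
  have hrow : ∀ b : ℤ, b ≠ 0 → ((shift E - 1) ^ N) (fun a => D (a + 1, b)) = 0 := by
    intro b hb
    have := difference_pow_line h (1, b) (1, 0) (by simpa [det2, toC] using hb)
    simpa [add_comm] using this
  set c : ℕ → ℤ → E := fun j b => ((shift E - 1) ^ j) (fun a => D (a + 1, b)) 0 with hcdef
  have hc : ∀ (j : ℕ) (a : ℤ), 0 ≤ a →
      IsPolyFun fun b => ((shift E - 1) ^ j) (fun a => D (a + 1, b)) a := by
    intro j
    induction j with
    | zero => intro a ha; exact hcol (a + 1) (by omega)
    | succ j ih =>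
      intro a ha
      simpa [pow_succ'] using (ih (a + 1) (by omega)).sub (ih a ha)
  refine ⟨fun m => ∑ j ∈ Finset.range N, ((Ring.choose (m.1 - 1) j : ℤ) : ℂ) • c j m.2,
    IsPolyFun₂.sum _ fun j _ => IsPolyFun₂.prod (IsPolyFun.choose j) (hc j 0 le_rfl), ?_⟩
  have hb0 : ∀ a b : ℤ, b ≠ 0 →
      D (a, b) = ∑ j ∈ Finset.range N, ((Ring.choose (a - 1) j : ℤ) : ℂ) • c j b := by
    intro a b hb
    have := eq_sum_choose_smul (hrow b hb) (a - 1)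
    simpa using this
  rintro ⟨a, b⟩ hab
  by_cases hb : b = 0
  · -- on the axis `b = 0` compare two polynomial functions of `b`
    have ha : a ≠ 0 := fun ha => hab (by rw [ha, hb]; rfl)
    exact congrFun ((hcol a ha).eq_of_forall_pos
      (IsPolyFun.sum _ fun j _ => (hc j 0 le_rfl).smul ((Ring.choose (a - 1) j : ℤ) : ℂ))
      fun k hk => hb0 a k hk.ne') b
  · exact hb0 a b hb

end TwoVariables

/-! ### Generators of `𝒢 ⋉ A` -/

section Generators

lemma dDer_zero : dDer 0 = 0 := by
  refine derivation_ext fun n => ?_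
  rw [dDer_mono]
  simp [det2, toC]

lemma dDer_mem_Vir (m : ℤ × ℤ) : dDer m ∈ Vir := by
  by_cases hm : m = 0
  · rw [hm, dDer_zero]; exact zero_mem Vir
  · exact Submodule.subset_span ⟨m, hm, rfl⟩

/-- The element `d_m` of `𝒢 ⋉ A`, with `d_0 = 0`. -/
def dGen (m : ℤ × ℤ) : VirA := ⟨0, ⟨dDer m, dDer_mem_Vir m⟩⟩

lemma dGen_lie_tElt (m n : ℤ × ℤ) :
    ⁅dGen m, tElt n⁆ = det2 (toC n) (toC m) • tElt (m + n) := by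
  rw [LieAlgebra.SemiDirectSum.lie_eq_mk]
  ext1
  · change ⁅(0 : Laurent), mono n⁆ + dDer m (mono n) - (0 : Derivation ℂ Laurent Laurent) 0 =
      det2 (toC n) (toC m) • mono (m + n)
    rw [dDer_mono, zero_lie, zero_add, map_zero, sub_zero]
  · change ⁅(⟨dDer m, dDer_mem_Vir m⟩ : Vir), (0 : Vir)⁆ = det2 (toC n) (toC m) • (0 : Vir)
    rw [lie_zero, smul_zero]

lemma dGen_lie_dGen (m n : ℤ × ℤ) :
    ⁅dGen m, dGen n⁆ = det2 (toC n) (toC m) • dGen (m + n) := by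
  rw [LieAlgebra.SemiDirectSum.lie_eq_mk]
  ext1
  · change ⁅(0 : Laurent), (0 : Laurent)⁆ + dDer m 0 - dDer n 0 =
      det2 (toC n) (toC m) • (0 : Laurent)
    rw [zero_lie, map_zero, map_zero, smul_zero, add_zero, sub_zero]
  · exact Subtype.ext (dDer_lie m n)

lemma tElt_lie_tElt (m n : ℤ × ℤ) : ⁅tElt m, tElt n⁆ = 0 := by
  rw [LieAlgebra.SemiDirectSum.lie_eq_mk]
  ext1
  · change ⁅mono m, mono n⁆ + (0 : Derivation ℂ Laurent Laurent) (mono n) -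
      (0 : Derivation ℂ Laurent Laurent) (mono m) = (0 : Laurent)
    rw [LieRing.of_associative_ring_bracket, mul_comm, sub_self, Derivation.zero_apply,
      Derivation.zero_apply, add_zero, sub_zero]
  · exact zero_lie (0 : Vir)

/-- Linear maps on `𝒢 ⋉ A` are determined by their values on the `t^n` and the `d_m`. -/
lemma virA_ext {M : Type*} [AddCommGroup M] [Module ℂ M] {f g : VirA →ₗ[ℂ] M}
    (ht : ∀ n, f (tElt n) = g (tElt n)) (hd : ∀ m, m ≠ 0 → f (dGen m) = g (dGen m)) : f = g := by
  have h1 : f.comp (LieAlgebra.SemiDirectSum.inl (derAction.comp Vir.incl)).toLinearMap =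
      g.comp (LieAlgebra.SemiDirectSum.inl (derAction.comp Vir.incl)).toLinearMap :=
    linearMap_ext ht
  have h2 : ∀ x : Vir, f ⟨0, x⟩ = g ⟨0, x⟩ := by
    rintro ⟨x, hx⟩
    set F := (f - g).comp (LieAlgebra.SemiDirectSum.inr (derAction.comp Vir.incl)).toLinearMap
    have : ∀ (x) (hx : x ∈ Submodule.span ℂ {D | ∃ m : ℤ × ℤ, m ≠ 0 ∧ D = dDer m}),
        F ⟨x, hx⟩ = 0 := by
      intro x hx
      induction hx using Submodule.span_induction with
      | mem a ha =>
        obtain ⟨m, hm, rfl⟩ := ha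
        exact sub_eq_zero.mpr (hd m hm)
      | zero => exact map_zero F
      | add a b ha hb iha ihb =>
        have e := map_add F ⟨a, ha⟩ ⟨b, hb⟩
        rw [iha, ihb, add_zero] at e
        exact e
      | smul c a ha iha =>
        have e := map_smul F c ⟨a, ha⟩
        rw [iha, smul_zero] at e
        exact e
    exact sub_eq_zero.mp (this x hx)
  ext1 ⟨a, x⟩
  have e : (⟨a, x⟩ : VirA) = ⟨a, 0⟩ + ⟨0, x⟩ := by
    rw [LieAlgebra.SemiDirectSum.add_eq_mk, add_zero, zero_add]
  rw [e, map_add, map_add, h2 x]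
  congr 1
  exact LinearMap.congr_fun h1 a

lemma virA_hom_ext {L : Type*} [LieRing L] [LieAlgebra ℂ L] {f g : VirA →ₗ⁅ℂ⁆ L}
    (ht : ∀ n, f (tElt n) = g (tElt n)) (hd : ∀ m, m ≠ 0 → f (dGen m) = g (dGen m)) : f = g := by
  ext x
  exact LinearMap.congr_fun (virA_ext (f := f.toLinearMap) (g := g.toLinearMap) ht hd) x

lemma isInvariant_iff {V : Type*} [AddCommGroup V] [Module ℂ V]
    {Φ : VirA →ₗ⁅ℂ⁆ Module.End ℂ V} {S : Submodule ℂ V} :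
    IsInvariant Φ S ↔
      (∀ n, ∀ v ∈ S, Φ (tElt n) v ∈ S) ∧ ∀ m, m ≠ 0 → ∀ v ∈ S, Φ (dGen m) v ∈ S := by
  refine ⟨fun h => ⟨fun n => h _, fun m _ => h _⟩, fun ⟨ht, hd⟩ x v hv => ?_⟩
  have : S.mkQ.comp ((LinearMap.applyₗ v).comp Φ.toLinearMap) = 0 :=
    virA_ext (fun n => (Submodule.Quotient.mk_eq_zero S).mpr (ht n v hv))
      fun m hm => (Submodule.Quotient.mk_eq_zero S).mpr (hd m hm v hv)
  exact (Submodule.Quotient.mk_eq_zero S).mp (LinearMap.congr_fun this x)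

lemma intertwines_iff {V : Type*} [AddCommGroup V] [Module ℂ V] {W : Type*} [AddCommGroup W]
    [Module ℂ W] {Φ : VirA →ₗ⁅ℂ⁆ Module.End ℂ V} {Ψ : VirA →ₗ⁅ℂ⁆ Module.End ℂ W} {f : V ≃ₗ[ℂ] W} :
    Intertwines Φ Ψ f ↔ (∀ n v, f (Φ (tElt n) v) = Ψ (tElt n) (f v)) ∧
      ∀ m, m ≠ 0 → ∀ v, f (Φ (dGen m) v) = Ψ (dGen m) (f v) := by
  refine ⟨fun h => ⟨fun n => h _, fun m _ => h _⟩, fun ⟨ht, hd⟩ x v => ?_⟩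
  have : f.toLinearMap.comp ((LinearMap.applyₗ v).comp Φ.toLinearMap) =
      (LinearMap.applyₗ (f v)).comp Ψ.toLinearMap :=
    virA_ext (fun n => ht n v) fun m hm => hd m hm v
  exact LinearMap.congr_fun this x

end Generators

/-! ### The structure of a jet module over its zero component -/

namespace JetModule

variable {lam : ℂ} (V : JetModule.{u} lam)

/-- The operator `λ⁻¹ t^m`. -/
def tOp (m : ℤ × ℤ) : Module.End ℂ V.carrier := lam⁻¹ • V.action (tElt m)

/-- The operator `d_m`, with `d_0 = 0`. -/
def dOp (m : ℤ × ℤ) : Module.End ℂ V.carrier := V.action (dGen m)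

instance : Module.Finite ℂ (V.gr 0) := (V.isJet.bounded.choose_spec 0).1

lemma tOp_mem {m n : ℤ × ℤ} {v : V.carrier} (hv : v ∈ V.gr n) : V.tOp m v ∈ V.gr (m + n) :=
  Submodule.smul_mem _ _ (V.isJet.t_mem m n v hv)

lemma dOp_mem {m n : ℤ × ℤ} {v : V.carrier} (hv : v ∈ V.gr n) : V.dOp m v ∈ V.gr (m + n) := by
  by_cases hm : m = 0
  · have : dGen 0 = 0 := by
      ext1
      · rfl
      · exact Subtype.ext dDer_zero
    rw [dOp, hm, this, map_zero]
    exact zero_mem _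
  · exact V.isJet.d_mem m hm n v hv

variable {V}

lemma tOp_zero (hlam : lam ≠ 0) (v : V.carrier) : V.tOp 0 v = v := by
  rw [tOp, LinearMap.smul_apply, V.isJet.t_zero, smul_smul, inv_mul_cancel₀ hlam, one_smul]

lemma action_tElt (hlam : lam ≠ 0) (m : ℤ × ℤ) : V.action (tElt m) = lam • V.tOp m := by
  rw [tOp, smul_smul, mul_inv_cancel₀ hlam, one_smul]

/-- Quasi-associativity also holds for `m + n = 0`: compare both sides on vectors `t^{2m} v`. -/
lemma tOp_tOp (hlam : lam ≠ 0) (m n : ℤ × ℤ) (v : V.carrier) :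
    V.tOp m (V.tOp n v) = V.tOp (m + n) v := by
  have gen : ∀ m n : ℤ × ℤ, m ≠ 0 → n ≠ 0 → m + n ≠ 0 → ∀ v,
      V.tOp m (V.tOp n v) = V.tOp (m + n) v := by
    intro m n hm hn hmn v
    simp only [tOp, LinearMap.smul_apply, map_smul]
    rw [V.isJet.t_quasiAssoc m n hm hn hmn, smul_smul lam⁻¹ lam, inv_mul_cancel₀ hlam, one_smul]
  by_cases hm : m = 0
  · rw [hm, tOp_zero hlam, zero_add]
  by_cases hn : n = 0
  · rw [hn, tOp_zero hlam, add_zero]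
  by_cases hmn : m + n = 0
  · rw [hmn, tOp_zero hlam]
    obtain rfl : n = -m := (neg_eq_of_add_eq_zero_right hmn).symm
    have h2 : m + m ≠ 0 := by
      intro h
      apply hm
      have h1 := congrArg Prod.fst h
      have h2 := congrArg Prod.snd h
      ext <;> simp at h1 h2 ⊢ <;> omega
    obtain ⟨w, rfl⟩ : ∃ w, V.tOp (m + m) w = v := by
      obtain ⟨w, hw⟩ := (V.isJet.t_bijective (m + m) h2).2 (lam • v)
      exact ⟨w, by rw [tOp, LinearMap.smul_apply, hw, smul_smul, inv_mul_cancel₀ hlam, one_smul]⟩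
    rw [gen (-m) (m + m) hn h2 (by simpa using hm), neg_add_cancel_left, gen m m hm hm h2]
  · exact gen m n hm hn hmn v

lemma tOp_neg_tOp (hlam : lam ≠ 0) (m : ℤ × ℤ) (v : V.carrier) : V.tOp (-m) (V.tOp m v) = v := by
  rw [tOp_tOp hlam, neg_add_cancel, tOp_zero hlam]

lemma tOp_tOp_neg (hlam : lam ≠ 0) (m : ℤ × ℤ) (v : V.carrier) : V.tOp m (V.tOp (-m) v) = v := by
  rw [tOp_tOp hlam, add_neg_cancel, tOp_zero hlam]

lemma dOp_tOp (m n : ℤ × ℤ) (v : V.carrier) :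
    V.dOp m (V.tOp n v) = V.tOp n (V.dOp m v) + det2 (toC n) (toC m) • V.tOp (m + n) v := by
  have h : ⁅V.action (dGen m), V.action (tElt n)⁆ v =
      det2 (toC n) (toC m) • V.action (tElt (m + n)) v := by
    rw [← LieHom.map_lie, dGen_lie_tElt, map_smul, LinearMap.smul_apply]
  rw [LieRing.of_associative_ring_bracket, LinearMap.sub_apply, Module.End.mul_apply,
    Module.End.mul_apply, sub_eq_iff_eq_add] at h
  simp only [dOp, tOp, LinearMap.smul_apply, map_smul]
  rw [h, smul_add, smul_comm lam⁻¹, add_comm]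

lemma dOp_dOp (m n : ℤ × ℤ) (v : V.carrier) :
    V.dOp m (V.dOp n v) - V.dOp n (V.dOp m v) = det2 (toC n) (toC m) • V.dOp (m + n) v := by
  have h : ⁅V.action (dGen m), V.action (dGen n)⁆ v =
      det2 (toC n) (toC m) • V.action (dGen (m + n)) v := by
    rw [← LieHom.map_lie, dGen_lie_dGen, map_smul, LinearMap.smul_apply]
  exact h

variable (V) in
/-- The operator `(λ⁻¹ t^{-m}) d_m` on the zero component. -/
def fiberOp (m : ℤ × ℤ) : Module.End ℂ (V.gr 0) :=
  ((V.tOp (-m)).comp (V.dOp m)).restrict fun v hv => by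
    have := V.tOp_mem (m := -m) (V.dOp_mem (m := m) hv)
    rwa [neg_add_cancel_left] at this

lemma coe_fiberOp (m : ℤ × ℤ) (v : V.gr 0) : (V.fiberOp m v : V.carrier) = V.tOp (-m) (V.dOp m v) :=
  rfl

lemma dOp_coe (hlam : lam ≠ 0) (m : ℤ × ℤ) (v : V.gr 0) :
    V.dOp m (v : V.carrier) = V.tOp m (V.fiberOp m v : V.carrier) := by
  rw [coe_fiberOp, tOp_tOp_neg hlam]

/-- The action of `d_m` in terms of the operators on the zero component. -/
lemma dOp_tOp_coe (hlam : lam ≠ 0) (m n : ℤ × ℤ) (v : V.gr 0) :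
    V.dOp m (V.tOp n (v : V.carrier)) =
      V.tOp (m + n) ((V.fiberOp m v + det2 (toC n) (toC m) • v : V.gr 0) : V.carrier) := by
  rw [dOp_tOp, dOp_coe hlam, tOp_tOp hlam, add_comm n m, Submodule.coe_add, map_add,
    Submodule.coe_smul, map_smul]

/-- The bracket `[d_m, d_n]` in terms of the operators on the zero component. -/
lemma fiberOp_lie (hlam : lam ≠ 0) (m n : ℤ × ℤ) :
    ⁅V.fiberOp m, V.fiberOp n⁆ =
      det2 (toC n) (toC m) • (V.fiberOp (m + n) - V.fiberOp m - V.fiberOp n) := by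
  have inj : Function.Injective (V.tOp (m + n)) :=
    Function.LeftInverse.injective (tOp_neg_tOp hlam (m + n))
  have hmul : ∀ m n : ℤ × ℤ, ∀ v : V.gr 0, V.dOp m (V.dOp n v) = V.tOp (m + n)
      ((V.fiberOp m (V.fiberOp n v) + det2 (toC n) (toC m) • V.fiberOp n v : V.gr 0) :
        V.carrier) := by
    intro m n v
    rw [dOp_coe hlam n, dOp_tOp_coe hlam]
  ext v
  apply inj
  have h := dOp_dOp m n (v : V.carrier)
  have hdet : det2 (toC m) (toC n) = -det2 (toC n) (toC m) := by simp only [det2]; ring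
  rw [hmul, hmul, add_comm n m, dOp_coe hlam, hdet] at h
  congr 1
  have h'' : (V.fiberOp m (V.fiberOp n v) + det2 (toC n) (toC m) • V.fiberOp n v) -
      (V.fiberOp n (V.fiberOp m v) + -det2 (toC n) (toC m) • V.fiberOp m v) =
      det2 (toC n) (toC m) • V.fiberOp (m + n) v := Subtype.ext (inj (by
        rw [Submodule.coe_sub, map_sub, Submodule.coe_smul, map_smul (V.tOp (m + n))]
        exact h))
  refine congrArg _ (?_ : V.fiberOp m (V.fiberOp n v) - V.fiberOp n (V.fiberOp m v) =
    det2 (toC n) (toC m) • (V.fiberOp (m + n) v - V.fiberOp m v - V.fiberOp n v))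
  rw [smul_sub, smul_sub, ← h'']
  module

lemma isBlockAction_iff (hlam : lam ≠ 0) {ρ : BlockPlus →ₗ⁅ℂ⁆ Module.End ℂ (V.gr 0)} :
    V.IsBlockAction ρ ↔ ∀ m, m ≠ 0 → V.fiberOp m = polyOp ρ m := by
  refine forall_congr' fun m => forall_congr' fun hm => ?_
  rw [LinearMap.ext_iff]
  refine forall_congr' fun v => ?_
  change V.dOp m v = V.tOp m (polyOp ρ m v : V.carrier) ↔ _
  rw [dOp_coe hlam, (Function.LeftInverse.injective (tOp_neg_tOp hlam m)).eq_iff,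
    Subtype.coe_inj]

lemma existsUnique_isBlockAction (hlam : lam ≠ 0) : ∃! ρ, V.IsBlockAction ρ := by
  simp only [isBlockAction_iff hlam]
  obtain ⟨P, ⟨K, f, hf, hP⟩, hDP⟩ := exists_isPolyFun₂_of_lie (D := V.fiberOp)
    fun m n _ _ => fiberOp_lie hlam m n
  have hf1 := hf.mono (Nat.le_succ K)
  have hD : ∀ m, m ≠ 0 → V.fiberOp m = jetSum (K + 1) m f := fun m hm => by
    rw [hDP m hm, hP, jetSum_of_le (Nat.le_succ K) m hf]
  obtain ⟨ρ, hρ⟩ := exists_blockRep (Nat.succ_pos K) hf1 fun m n hm hn => by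
    rw [← hD m hm, ← hD n hn, fiberOp_lie hlam]
    by_cases hmn : m + n = 0
    · rw [show det2 (toC n) (toC m) = 0 by
        rw [eq_neg_of_add_eq_zero_right hmn]; simp [det2, toC]; ring, zero_smul, zero_smul]
    · rw [← hD _ hmn]
  have hρ' : (fun i => ρ (BlockPlus.D i)) = f := funext hρ
  refine ⟨ρ, fun m hm => ?_, fun σ hσ => ?_⟩
  · rw [hD m hm, polyOp_eq_jetSum ρ (hρ' ▸ hf1), hρ']
  · obtain ⟨L, -, hL⟩ := exists_boxSupported σ
    refine blockHom_ext fun i => ?_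
    rw [hρ i]
    refine congrFun (jetSum_ext hL hf1 fun m hm => ?_) i
    rw [← polyOp_eq_jetSum σ hL, ← hσ m hm, hD m hm]

/-- A jet module is a direct sum of copies of its zero component, moved by the `t^n`. -/
def coord (V : JetModule.{u} lam) (hlam : lam ≠ 0) : (ℤ × ℤ →₀ V.gr 0) ≃ₗ[ℂ] V.carrier :=
  LinearEquiv.ofBijective (Finsupp.lsum ℂ fun n => (V.tOp n).comp (V.gr 0).subtype) (by
    have hmem : ∀ n (v : V.gr 0), V.tOp n v ∈ V.gr n := fun n v => by
      simpa using V.tOp_mem (m := n) v.2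
    constructor
    · rw [← LinearMap.ker_eq_bot, LinearMap.ker_eq_bot']
      intro c hc
      rw [Finsupp.lsum_apply] at hc
      have hind := V.isJet.isInternal.submodule_iSupIndep
      rw [iSupIndep_iff_finsetSum_eq_zero_imp_eq_zero] at hind
      ext1 n
      by_cases hn : n ∈ c.support
      · have := hind c.support (fun n => V.tOp n (c n)) (fun n _ => hmem n _) hc n hn
        have h2 := tOp_neg_tOp hlam n (c n : V.carrier)
        rw [this, map_zero] at h2
        exact Subtype.ext h2.symm
      · simpa using hn
    · rw [← LinearMap.range_eq_top, eq_top_iff, ← V.isJet.isInternal.submodule_iSup_eq_top]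
      refine iSup_le fun n v hv => ?_
      have h0 : V.tOp (-n) v ∈ V.gr 0 := by simpa using V.tOp_mem (m := -n) hv
      exact ⟨Finsupp.single n ⟨_, h0⟩, by simp [tOp_tOp_neg hlam]⟩)

lemma coord_single (hlam : lam ≠ 0) (n : ℤ × ℤ) (v : V.gr 0) :
    V.coord hlam (Finsupp.single n v) = V.tOp n v := by
  change Finsupp.lsum ℂ (fun n => (V.tOp n).comp (V.gr 0).subtype) (Finsupp.single n v) = _
  simp

lemma induction_tOp (hlam : lam ≠ 0) {p : V.carrier → Prop} (h0 : p 0)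
    (hadd : ∀ v w, p v → p w → p (v + w)) (h : ∀ (n) (v : V.gr 0), p (V.tOp n v))
    (v : V.carrier) : p v := by
  obtain ⟨c, rfl⟩ := (V.coord hlam).surjective v
  induction c using Finsupp.induction_linear with
  | zero => rw [map_zero]; exact h0
  | add f g hf hg => rw [map_add]; exact hadd _ _ hf hg
  | single n v => rw [coord_single]; exact h n v

lemma gr_eq_map (hlam : lam ≠ 0) (n : ℤ × ℤ) : V.gr n = (V.gr 0).map (V.tOp n) := by
  ext v
  constructor
  · intro hv
    exact ⟨V.tOp (-n) v, by simpa using V.tOp_mem (m := -n) hv, tOp_tOp_neg hlam n v⟩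
  · rintro ⟨w, hw, rfl⟩
    simpa using V.tOp_mem (m := n) hw

end JetModule

/-! ### Homomorphisms between jet modules -/

section Coefficients

variable {E : Type*} [AddCommGroup E] [Module ℂ E]

lemma jetSum_shiftScalar {K : ℕ} (hK : 2 ≤ K) (k m : ℤ × ℤ) (x : E) :
    jetSum K m (fun i => shiftScalar k i • x) = det2 (toC k) (toC m) • x := by
  obtain ⟨K, rfl⟩ : ∃ L, K = L + 2 := ⟨K - 2, by omega⟩
  have h0 : ∀ i : ℕ, dsum (K + 2) (m.2 : ℂ) (fun j => shiftScalar k (i, j) • x) =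
      if i = 0 then (m.2 * k.1 : ℂ) • x else if i = 1 then (-k.2 : ℂ) • x else 0 := by
    intro i
    rw [dsum, Finset.sum_range_succ', Finset.sum_range_succ']
    rcases i with _ | _ | i <;> simp [shiftScalar, dpow, smul_smul]
  rw [jetSum]
  simp only [h0]
  rw [dsum, Finset.sum_range_succ', Finset.sum_range_succ']
  simp only [dpow, det2, toC]
  simp [smul_smul]
  module

lemma shiftScalar_eq_zero (k : ℤ × ℤ) (i : ℕ × ℕ) (h : 2 ≤ i.1 ∨ 2 ≤ i.2) :
    shiftScalar k i = 0 := by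
  unfold shiftScalar
  rw [if_neg, if_neg] <;> rintro rfl <;> simp at h

lemma shiftScalar_zero (i : ℕ × ℕ) : shiftScalar 0 i = 0 := by
  simp [shiftScalar]

variable {U : Type*} [AddCommGroup U] [Module ℂ U] [Module.Finite ℂ U]
  {W : Type*} [AddCommGroup W] [Module ℂ W] [Module.Finite ℂ W]

/-- Comparison of coefficients: a linear map is compatible with the functions `∑ (m^i / i!) D_i`,
up to the scalar `det (k over m)`, if and only if it is compatible with the `D_i`, up to scalars. -/
lemma polyOp_intertwines_iff (ρ : BlockPlus →ₗ⁅ℂ⁆ Module.End ℂ U)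
    (σ : BlockPlus →ₗ⁅ℂ⁆ Module.End ℂ W) (g : U →ₗ[ℂ] W) (k : ℤ × ℤ) :
    (∀ m : ℤ × ℤ, m ≠ 0 → ∀ v,
      g (polyOp ρ m v) = polyOp σ m (g v) + det2 (toC k) (toC m) • g v) ↔
    ∀ (i : ℕ × ℕ) (v : U),
      g (ρ (BlockPlus.D i) v) = σ (BlockPlus.D i) (g v) + shiftScalar k i • g v := by
  obtain ⟨K₁, -, h1⟩ := exists_boxSupported ρ
  obtain ⟨K₂, -, h2⟩ := exists_boxSupported σ
  set K := max 2 (max K₁ K₂)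
  have hρ := h1.mono ((le_max_left K₁ K₂).trans (le_max_right 2 _))
  have hσ := h2.mono ((le_max_right K₁ K₂).trans (le_max_right 2 _))
  have hK : 2 ≤ K := le_max_left _ _
  set F : ℕ × ℕ → (U →ₗ[ℂ] W) := fun i => g ∘ₗ ρ (BlockPlus.D i)
  set G : ℕ × ℕ → (U →ₗ[ℂ] W) := fun i => σ (BlockPlus.D i) ∘ₗ g + shiftScalar k i • g
  have hF : BoxSupported K F := fun i hi => by
    have := hρ i hi
    simp only [F, this, LinearMap.comp_zero]
  have hG : BoxSupported K G := fun i hi => by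
    have := hσ i hi
    simp only [G, this, LinearMap.zero_comp, shiftScalar_eq_zero k i (by omega), zero_smul,
      add_zero]
  have eF : ∀ m v, jetSum K m F v = g (polyOp ρ m v) := by
    intro m v
    rw [polyOp_apply_eq_jetSum ρ hρ, map_jetSum]
    exact map_jetSum (LinearMap.applyₗ v) K m F
  have eG : ∀ m v, jetSum K m G v = polyOp σ m (g v) + det2 (toC k) (toC m) • g v := by
    intro m v
    rw [polyOp_apply_eq_jetSum σ hσ, ← jetSum_shiftScalar hK k m (g v), ← jetSum_add]
    exact map_jetSum (LinearMap.applyₗ v) K m G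
  simp only [← eF, ← eG]
  constructor
  · intro h i v
    exact LinearMap.congr_fun (congrFun (jetSum_ext hF hG fun m hm => LinearMap.ext (h m hm)) i) v
  · intro h m _ v
    rw [show F = G from funext fun i => LinearMap.ext (h i)]

end Coefficients

lemma block_intertwines_iff {U : Type*} [AddCommGroup U] [Module ℂ U]
    {W : Type*} [AddCommGroup W] [Module ℂ W] {ρ : BlockPlus →ₗ⁅ℂ⁆ Module.End ℂ U}
    {σ : BlockPlus →ₗ⁅ℂ⁆ Module.End ℂ W} {g : U ≃ₗ[ℂ] W} :
    Intertwines ρ σ g ↔ ∀ i v, g (ρ (BlockPlus.D i) v) = σ (BlockPlus.D i) (g v) := by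
  refine ⟨fun h i => h _, fun h x v => ?_⟩
  have : g.toLinearMap.comp ((LinearMap.applyₗ v).comp ρ.toLinearMap) =
      (LinearMap.applyₗ (g v)).comp σ.toLinearMap :=
    BlockPlus.lin_ext fun i => h i v
  exact LinearMap.congr_fun this x

namespace JetModule

variable {lam : ℂ} {V W : JetModule.{u} lam}

lemma coord_symm_tOp (hlam : lam ≠ 0) (n : ℤ × ℤ) (v : V.gr 0) :
    (V.coord hlam).symm (V.tOp n v) = Finsupp.single n v := by
  rw [LinearEquiv.symm_apply_eq, coord_single]

/-- A linear isomorphism `g : V₀ → W₀` with `g D(m) = (D(m) + det (k over m)) g` extends to an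
isomorphism of modules that maps `V_n` onto `W_{n+k}`. -/
lemma exists_iso_of_fiberOp (hlam : lam ≠ 0) (k : ℤ × ℤ) (g : V.gr 0 ≃ₗ[ℂ] W.gr 0)
    (hg : ∀ m, m ≠ 0 → ∀ v,
      g (V.fiberOp m v) = W.fiberOp m (g v) + det2 (toC k) (toC m) • g v) :
    ∃ f : V.carrier ≃ₗ[ℂ] W.carrier, Intertwines V.action W.action f ∧
      ∀ n, (V.gr n).map f.toLinearMap = W.gr (n + k) := by
  set f : V.carrier ≃ₗ[ℂ] W.carrier :=
    (V.coord hlam).symm ≪≫ₗ Finsupp.lcongr (Equiv.addRight k) g ≪≫ₗ W.coord hlam with hf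
  have hfT : ∀ n (v : V.gr 0), f (V.tOp n v) = W.tOp (n + k) (g v : W.carrier) := by
    intro n v
    simp [hf, coord_symm_tOp hlam, coord_single]
  refine ⟨f, intertwines_iff.mpr ⟨fun m => ?_, fun m hm => ?_⟩, fun n => ?_⟩
  · refine induction_tOp hlam (by simp) (fun v w hv hw => by simp [hv, hw]) fun n v => ?_
    rw [action_tElt hlam, action_tElt hlam, LinearMap.smul_apply, LinearMap.smul_apply, map_smul,
      tOp_tOp hlam, hfT, hfT, tOp_tOp hlam, add_assoc]
  · refine induction_tOp hlam (by simp) (fun v w hv hw => by simp [hv, hw]) fun n v => ?_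
    change f (V.dOp m _) = W.dOp m _
    rw [dOp_tOp_coe hlam, hfT, hfT, dOp_tOp_coe hlam, add_assoc, map_add, hg m hm, map_smul]
    congr 2
    rw [add_assoc, ← add_smul]
    congr 2
    simp only [det2, toC, Prod.fst_add, Prod.snd_add]
    push_cast
    ring
  · rw [gr_eq_map hlam n, gr_eq_map hlam (n + k), ← Submodule.map_comp]
    ext w
    constructor
    · rintro ⟨v, hv, rfl⟩
      exact ⟨g ⟨v, hv⟩, (g ⟨v, hv⟩).2, (hfT n ⟨v, hv⟩).symm⟩
    · rintro ⟨w, hw, rfl⟩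
      refine ⟨g.symm ⟨w, hw⟩, (g.symm ⟨w, hw⟩).2, ?_⟩
      exact (hfT n _).trans (by rw [LinearEquiv.apply_symm_apply])

/-- Conversely, an isomorphism that maps `V₀` onto `W_k` gives such a linear isomorphism. -/
lemma exists_fiberOp_of_iso (hlam : lam ≠ 0) (k : ℤ × ℤ) {f : V.carrier ≃ₗ[ℂ] W.carrier}
    (hf : Intertwines V.action W.action f) (hk : (V.gr 0).map f.toLinearMap = W.gr k) :
    ∃ g : V.gr 0 ≃ₗ[ℂ] W.gr 0, ∀ m v,
      g (V.fiberOp m v) = W.fiberOp m (g v) + det2 (toC k) (toC m) • g v := by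
  have hft : ∀ n v, f (V.tOp n v) = W.tOp n (f v) := fun n v => by
    simp only [tOp, LinearMap.smul_apply, map_smul, hf (tElt n) v]
  have hfd : ∀ n v, f (V.dOp n v) = W.dOp n (f v) := fun n v => hf (dGen n) v
  have hmem : ∀ v ∈ V.gr 0, W.tOp (-k) (f v) ∈ W.gr 0 := by
    intro v hv
    have : f v ∈ W.gr k := hk ▸ ⟨v, hv, rfl⟩
    simpa using W.tOp_mem (m := -k) this
  set g₀ : V.gr 0 →ₗ[ℂ] W.gr 0 := ((W.tOp (-k)).comp f.toLinearMap).restrict hmem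
  have hg₀ : ∀ v : V.gr 0, f v = W.tOp k (g₀ v : W.carrier) := fun v =>
    (tOp_tOp_neg hlam k (f v)).symm
  have hbij : Function.Bijective g₀ := by
    constructor
    · intro v w h
      exact Subtype.ext (f.injective (by rw [hg₀, hg₀, h]))
    · intro w
      have hw : W.tOp k (w : W.carrier) ∈ (V.gr 0).map f.toLinearMap := by
        rw [hk]
        simpa using W.tOp_mem (m := k) w.2
      obtain ⟨v, hv, hvw⟩ := hw
      refine ⟨⟨v, hv⟩, Subtype.ext ?_⟩
      change W.tOp (-k) (f v) = w
      rw [show f v = W.tOp k w from hvw, tOp_neg_tOp hlam]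
  refine ⟨LinearEquiv.ofBijective g₀ hbij, fun m v => Subtype.ext ?_⟩
  change W.tOp (-k) (f (V.tOp (-m) (V.dOp m v))) = _
  rw [hft, hfd, hg₀, dOp_tOp_coe hlam, tOp_tOp hlam, tOp_tOp hlam,
    show -k + -m + (m + k) = 0 by abel, tOp_zero hlam]
  rfl

variable {ρ : BlockPlus →ₗ⁅ℂ⁆ Module.End ℂ (V.gr 0)} {σ : BlockPlus →ₗ⁅ℂ⁆ Module.End ℂ (W.gr 0)}

lemma fiberOp_intertwines_iff (hlam : lam ≠ 0) (hρ : V.IsBlockAction ρ) (hσ : W.IsBlockAction σ)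
    (g : V.gr 0 ≃ₗ[ℂ] W.gr 0) (k : ℤ × ℤ) :
    (∀ m, m ≠ 0 → ∀ v, g (V.fiberOp m v) = W.fiberOp m (g v) + det2 (toC k) (toC m) • g v) ↔
      ∀ i v, g (ρ (BlockPlus.D i) v) = σ (BlockPlus.D i) (g v) + shiftScalar k i • g v := by
  rw [isBlockAction_iff hlam] at hρ hσ
  refine Iff.trans ?_ (polyOp_intertwines_iff ρ σ g.toLinearMap k)
  refine forall_congr' fun m => forall_congr' fun hm => ?_
  rw [hρ m hm, hσ m hm]
  rfl

lemma regradedIso_iff (hlam : lam ≠ 0) (hρ : V.IsBlockAction ρ) (hσ : W.IsBlockAction σ) :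
    V.RegradedIso W ↔ ∃ (n : ℤ × ℤ) (f : V.gr 0 ≃ₗ[ℂ] W.gr 0), ∀ (i : ℕ × ℕ) (v : V.gr 0),
      f (ρ (BlockPlus.D i) v) = σ (BlockPlus.D i) (f v) + shiftScalar n i • f v := by
  constructor
  · rintro ⟨f, hf, s, hs⟩
    obtain ⟨g, hg⟩ := exists_fiberOp_of_iso hlam (s 0) hf (hs 0)
    exact ⟨s 0, g, (fiberOp_intertwines_iff hlam hρ hσ g _).mp fun m _ => hg m⟩
  · rintro ⟨n, g, hg⟩
    obtain ⟨f, hf, h⟩ := exists_iso_of_fiberOp hlam n g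
      ((fiberOp_intertwines_iff hlam hρ hσ g n).mpr hg)
    exact ⟨f, hf, Equiv.addRight n, h⟩

lemma setoid_iff (hlam : lam ≠ 0) (hρ : V.IsBlockAction ρ) (hσ : W.IsBlockAction σ) :
    (JetModule.setoid.{u} lam).r V W ↔ ∃ g : V.gr 0 ≃ₗ[ℂ] W.gr 0, Intertwines ρ σ g := by
  have key : ∀ g : V.gr 0 ≃ₗ[ℂ] W.gr 0, Intertwines ρ σ g ↔
      ∀ i v, g (ρ (BlockPlus.D i) v) = σ (BlockPlus.D i) (g v) + shiftScalar 0 i • g v := by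
    intro g
    simp only [shiftScalar_zero, zero_smul, add_zero]
    exact block_intertwines_iff
  simp only [key]
  constructor
  · rintro ⟨f, hf, hs⟩
    obtain ⟨g, hg⟩ := exists_fiberOp_of_iso hlam 0 hf (hs 0)
    exact ⟨g, (fiberOp_intertwines_iff hlam hρ hσ g _).mp fun m _ => hg m⟩
  · rintro ⟨g, hg⟩
    obtain ⟨f, hf, h⟩ := exists_iso_of_fiberOp hlam 0 g
      ((fiberOp_intertwines_iff hlam hρ hσ g 0).mpr hg)
    exact ⟨f, hf, fun n => by simpa using h n⟩

end JetModule

/-! ### Operators with a single eigenvalue -/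

section SingleEigenvalue

open Module.End

lemma block_isInvariant_iff {U : Type*} [AddCommGroup U] [Module ℂ U]
    {ρ : BlockPlus →ₗ⁅ℂ⁆ Module.End ℂ U} {S : Submodule ℂ U} :
    IsInvariant ρ S ↔ ∀ i, ∀ v ∈ S, ρ (BlockPlus.D i) v ∈ S := by
  refine ⟨fun h i => h _, fun h x v hv => ?_⟩
  have : S.mkQ.comp ((LinearMap.applyₗ v).comp ρ.toLinearMap) = 0 :=
    BlockPlus.lin_ext fun i => (Submodule.Quotient.mk_eq_zero S).mpr (h i v hv)
  exact (Submodule.Quotient.mk_eq_zero S).mp (LinearMap.congr_fun this x)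

variable {U : Type*} [AddCommGroup U] [Module ℂ U]

/-- Generalized eigenspaces of `X` are stable under `Y` if `(ad X)² Y = 0`. -/
lemma mapsTo_maxGenEigenspace_of_lie_lie {X Y : Module.End ℂ U} (h : ⁅X, ⁅X, Y⁆⁆ = 0) (μ : ℂ)
    {v : U} (hv : v ∈ X.maxGenEigenspace μ) : Y v ∈ X.maxGenEigenspace μ := by
  rw [mem_maxGenEigenspace] at hv ⊢
  obtain ⟨N, hN⟩ := hv
  set A := X - μ • (1 : Module.End ℂ U) with hA
  set Z := ⁅X, Y⁆ with hZ
  have hAY : A * Y = Y * A + Z := by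
    rw [hA, hZ, LieRing.of_associative_ring_bracket, sub_mul, mul_sub, smul_mul_assoc, one_mul,
      mul_smul_comm, mul_one]
    abel
  have hAZ : A * Z = Z * A := by
    rw [LieRing.of_associative_ring_bracket, sub_eq_zero] at h
    rw [hA, sub_mul, mul_sub, smul_mul_assoc, one_mul, mul_smul_comm, mul_one, h]
  have hpow : ∀ n : ℕ, A ^ (n + 1) * Y = Y * A ^ (n + 1) + ((n + 1 : ℕ) : ℂ) • (Z * A ^ n) := by
    intro n
    induction n with
    | zero => simpa using hAY
    | succ n ih =>
      rw [pow_succ', mul_assoc, ih, mul_add, ← mul_assoc, hAY, add_mul, mul_smul_comm,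
        ← mul_assoc A Z, hAZ, mul_assoc Z, ← pow_succ', mul_assoc Y, ← pow_succ']
      push_cast
      module
  refine ⟨N + 1, ?_⟩
  rw [← Module.End.mul_apply, hpow, LinearMap.add_apply, LinearMap.smul_apply,
    Module.End.mul_apply, Module.End.mul_apply, hN, map_zero, smul_zero, add_zero, pow_succ',
    Module.End.mul_apply, hN, map_zero, map_zero]

/-- If `(ad X)²` kills the action of all `D_j` on an indecomposable module, then `X` has only one
eigenvalue: its generalized eigenspaces are submodules. -/
lemma exists_maxGenEigenspace_eq_top [Module.Finite ℂ U] {ρ : BlockPlus →ₗ⁅ℂ⁆ Module.End ℂ U}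
    (hU : IsIndecomposableRep ρ) {X : Module.End ℂ U}
    (hX : ∀ j, ⁅X, ⁅X, ρ (BlockPlus.D j)⁆⁆ = 0) : ∃ c, X.maxGenEigenspace c = ⊤ := by
  have := hU.1
  obtain ⟨c, hc⟩ := Module.End.exists_eigenvalue X
  obtain ⟨v, hv⟩ := hc.exists_hasEigenvector
  have hinv : ∀ μ, IsInvariant ρ (X.maxGenEigenspace μ) := fun μ =>
    block_isInvariant_iff.mpr fun j v hv => mapsTo_maxGenEigenspace_of_lie_lie (hX j) μ hv
  have hinv' : IsInvariant ρ (⨆ μ ≠ c, X.maxGenEigenspace μ) := by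
    intro x
    have h : (⨆ μ ≠ c, X.maxGenEigenspace μ) ≤ (⨆ μ ≠ c, X.maxGenEigenspace μ).comap (ρ x) := by
      refine iSup₂_le fun μ hμ v hv => ?_
      exact (le_iSup₂ (f := fun μ (_ : μ ≠ c) => X.maxGenEigenspace μ) μ hμ) (hinv μ x v hv)
    exact fun v hv => h hv
  have hcompl : IsCompl (X.maxGenEigenspace c) (⨆ μ ≠ c, X.maxGenEigenspace μ) := by
    refine ⟨independent_maxGenEigenspace X c, ?_⟩
    rw [codisjoint_iff, eq_top_iff, ← iSup_maxGenEigenspace_eq_top X]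
    refine iSup_le fun μ => ?_
    by_cases h : μ = c
    · rw [h]; exact le_sup_left
    · exact le_sup_of_le_right (le_iSup₂ (f := fun μ (_ : μ ≠ c) => X.maxGenEigenspace μ) μ h)
  refine ⟨c, ?_⟩
  rcases hU.2 _ _ (hinv c) hinv' hcompl with h | h
  · exfalso
    have : v ∈ X.maxGenEigenspace c := Module.End.eigenspace_le_maxGenEigenspace hv.1
    rw [h] at this
    exact hv.2 ((Submodule.mem_bot ℂ).mp this)
  · have := hcompl.sup_eq_top
    rwa [h, sup_bot_eq] at this

/-- A submodule that is stable under `X` contains the components of its elements in the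
generalized eigenspaces of `X`. -/
lemma mem_of_sum_mem_of_mem_maxGenEigenspace {X : Module.End ℂ U} {S : Submodule ℂ U}
    (hS : ∀ v ∈ S, X v ∈ S) {ι : Type*} {μ : ι → ℂ} (hμ : Function.Injective μ) (s : Finset ι)
    {v : ι → U} (hv : ∀ i ∈ s, v i ∈ X.maxGenEigenspace (μ i)) (hsum : ∑ i ∈ s, v i ∈ S) :
    ∀ i ∈ s, v i ∈ S := by
  set Y : Module.End ℂ (U ⧸ S) := S.mapQ S X hS
  have hY : ∀ (μ : ℂ) (v : U), v ∈ X.maxGenEigenspace μ → S.mkQ v ∈ Y.maxGenEigenspace μ := by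
    intro μ v hv
    rw [mem_maxGenEigenspace] at hv ⊢
    obtain ⟨N, hN⟩ := hv
    refine ⟨N, ?_⟩
    have : ∀ (k : ℕ) (w : U), ((Y - μ • 1) ^ k) (S.mkQ w) = S.mkQ (((X - μ • 1) ^ k) w) := by
      intro k
      induction k with
      | zero => intro w; rfl
      | succ k ih =>
        intro w
        rw [pow_succ, Module.End.mul_apply, pow_succ, Module.End.mul_apply, ← ih]
        rfl
    rw [this, hN, map_zero]
  have hind := (independent_maxGenEigenspace Y).comp hμ
  rw [iSupIndep_iff_finsetSum_eq_zero_imp_eq_zero] at hind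
  intro i hi
  refine (Submodule.Quotient.mk_eq_zero S).mp (hind s (fun i => S.mkQ (v i))
    (fun i hi => hY _ _ (hv i hi)) ?_ i hi)
  rw [← map_sum]
  exact (Submodule.Quotient.mk_eq_zero S).mpr hsum

end SingleEigenvalue

section JetSumMem

variable {E : Type*} [AddCommGroup E] [Module ℂ E] {K : ℕ} {f : ℕ × ℕ → E} {S : Submodule ℂ E}

lemma jetSum_mem (m : ℤ × ℤ) (h : ∀ i, f i ∈ S) : jetSum K m f ∈ S := by
  unfold jetSum dsum
  exact Submodule.sum_mem _ fun _ _ => S.smul_mem _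
    (Submodule.sum_mem _ fun _ _ => S.smul_mem _ (h _))

lemma mem_of_forall_jetSum_mem (hf : BoxSupported K f)
    (h : ∀ m, m ≠ 0 → jetSum K m f ∈ S) (i : ℕ × ℕ) : f i ∈ S := by
  have h0 : (fun i => S.mkQ (f i)) = fun _ => 0 := by
    refine jetSum_ext (K := K) (L := K) (fun i hi => ?_) (fun _ _ => rfl) fun m hm => ?_
    · rw [hf i hi, map_zero]
    · rw [← map_jetSum, jetSum_zero_fun]
      exact (Submodule.Quotient.mk_eq_zero S).mpr (h m hm)
  exact (Submodule.Quotient.mk_eq_zero S).mp (congrFun h0 i)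

end JetSumMem

/-! ### Submodules of jet modules -/

namespace JetModule

variable {lam : ℂ} {V : JetModule.{u} lam}

/-- The subspace `⨁_n t^n S₀` of a jet module. -/
def extend (V : JetModule.{u} lam) (hlam : lam ≠ 0) (S₀ : Submodule ℂ (V.gr 0)) :
    Submodule ℂ V.carrier where
  carrier := {v | ∀ n, (V.coord hlam).symm v n ∈ S₀}
  zero_mem' n := by simp
  add_mem' hv hw n := by simpa using S₀.add_mem (hv n) (hw n)
  smul_mem' c v hv n := by simpa using S₀.smul_mem c (hv n)

lemma tOp_mem_extend (hlam : lam ≠ 0) {S₀ : Submodule ℂ (V.gr 0)} (n : ℤ × ℤ) {v : V.gr 0} :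
    V.tOp n v ∈ V.extend hlam S₀ ↔ v ∈ S₀ := by
  change (∀ k, (V.coord hlam).symm (V.tOp n v) k ∈ S₀) ↔ _
  simp only [coord_symm_tOp]
  constructor
  · intro h
    simpa using h n
  · intro h k
    rw [Finsupp.single_apply]
    split_ifs
    · exact h
    · exact zero_mem _

lemma eq_sum_tOp (hlam : lam ≠ 0) (v : V.carrier) :
    v = ∑ n ∈ ((V.coord hlam).symm v).support, V.tOp n ((V.coord hlam).symm v n : V.carrier) := by
  conv_lhs => rw [← (V.coord hlam).apply_symm_apply v, ← Finsupp.sum_single ((V.coord hlam).symm v)]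
  rw [Finsupp.sum, map_sum]
  exact Finset.sum_congr rfl fun n _ => coord_single hlam n _

lemma extend_le_iff (hlam : lam ≠ 0) {S₀ : Submodule ℂ (V.gr 0)} {T : Submodule ℂ V.carrier} :
    V.extend hlam S₀ ≤ T ↔ ∀ n, ∀ v ∈ S₀, V.tOp n (v : V.carrier) ∈ T := by
  refine ⟨fun h n v hv => h ((tOp_mem_extend hlam n).mpr hv), fun h v hv => ?_⟩
  rw [eq_sum_tOp hlam v]
  exact Submodule.sum_mem _ fun n _ => h n _ (hv n)

/-- The intersection with the zero component. -/
def fiberSub (S : Submodule ℂ V.carrier) : Submodule ℂ (V.gr 0) := S.comap (V.gr 0).subtype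

lemma fiberSub_extend (hlam : lam ≠ 0) (S₀ : Submodule ℂ (V.gr 0)) :
    fiberSub (V.extend hlam S₀) = S₀ := by
  ext v
  have := tOp_mem_extend hlam (S₀ := S₀) 0 (v := v)
  rwa [tOp_zero hlam] at this

variable {ρ : BlockPlus →ₗ⁅ℂ⁆ Module.End ℂ (V.gr 0)}

lemma invariant_extend (hlam : lam ≠ 0) (hρ : V.IsBlockAction ρ) {S₀ : Submodule ℂ (V.gr 0)}
    (hS : IsInvariant ρ S₀) : IsInvariant V.action (V.extend hlam S₀) := by
  rw [isBlockAction_iff hlam] at hρ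
  refine isInvariant_iff.mpr ⟨fun m => ?_, fun m hm => ?_⟩
  · refine (extend_le_iff hlam (T := (V.extend hlam S₀).comap (V.action (tElt m)))).mpr
      fun n v hv => ?_
    rw [Submodule.mem_comap, action_tElt hlam, LinearMap.smul_apply, tOp_tOp hlam]
    exact Submodule.smul_mem _ _ ((tOp_mem_extend hlam _).mpr hv)
  · refine (extend_le_iff hlam (T := (V.extend hlam S₀).comap (V.dOp m))).mpr fun n v hv => ?_
    rw [Submodule.mem_comap, dOp_tOp_coe hlam, tOp_mem_extend hlam, hρ m hm]
    obtain ⟨K, -, hK⟩ := exists_boxSupported ρ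
    refine add_mem ?_ (S₀.smul_mem _ hv)
    rw [polyOp_apply_eq_jetSum ρ hK]
    exact jetSum_mem m fun i => hS _ v hv

lemma tOp_mem_of_invariant {S : Submodule ℂ V.carrier} (hS : IsInvariant V.action S) (n : ℤ × ℤ)
    {v : V.carrier} (hv : v ∈ S) : V.tOp n v ∈ S :=
  S.smul_mem _ (hS _ v hv)

lemma invariant_fiberSub (hlam : lam ≠ 0) (hρ : V.IsBlockAction ρ) {S : Submodule ℂ V.carrier}
    (hS : IsInvariant V.action S) : IsInvariant ρ (fiberSub S) := by
  rw [isBlockAction_iff hlam] at hρ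
  obtain ⟨K, -, hK⟩ := exists_boxSupported ρ
  refine block_isInvariant_iff.mpr fun i v hv => ?_
  refine mem_of_forall_jetSum_mem (K := K) (f := fun i => ρ (BlockPlus.D i) v)
    (fun i hi => ?_) (fun m hm => ?_) i
  · exact LinearMap.congr_fun (hK i hi) v
  · rw [← polyOp_apply_eq_jetSum ρ hK, ← hρ m hm]
    exact tOp_mem_of_invariant hS (-m) (hS (dGen m) v hv)

/-- The operator on `V` that acts on `t^n V₀` as `D_i` plus the scalar of the shift by `n`. -/
def shiftedD (hlam : lam ≠ 0) (ρ : BlockPlus →ₗ⁅ℂ⁆ Module.End ℂ (V.gr 0)) (i : ℕ × ℕ) :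
    Module.End ℂ V.carrier :=
  (Finsupp.lsum ℂ fun n => (V.tOp n).comp ((V.gr 0).subtype.comp
    (ρ (BlockPlus.D i) + shiftScalar n i • 1))).comp (V.coord hlam).symm.toLinearMap

lemma shiftedD_tOp (hlam : lam ≠ 0) (i : ℕ × ℕ) (n : ℤ × ℤ) (v : V.gr 0) :
    shiftedD hlam ρ i (V.tOp n v) =
      V.tOp n ((ρ (BlockPlus.D i) v + shiftScalar n i • v : V.gr 0) : V.carrier) := by
  simp [shiftedD, coord_symm_tOp hlam]

/-- The `shiftedD` are the coefficients of the polynomial function `m ↦ λ⁻¹ t^{-m} d_m`. -/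
lemma jetSum_shiftedD (hlam : lam ≠ 0) (hρ : V.IsBlockAction ρ) {K : ℕ} (h2 : 2 ≤ K)
    (hK : BoxSupported K fun i => ρ (BlockPlus.D i)) {m : ℤ × ℤ} (hm : m ≠ 0) (v : V.carrier) :
    (jetSum K m fun i => shiftedD hlam ρ i v) = V.tOp (-m) (V.dOp m v) := by
  rw [isBlockAction_iff hlam] at hρ
  refine induction_tOp hlam
    (p := fun v => (jetSum K m fun i => shiftedD hlam ρ i v) = V.tOp (-m) (V.dOp m v))
    ?_ (fun v w hv hw => ?_) (fun n w => ?_) v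
  · simp only [map_zero, jetSum_zero_fun]
  · simp only [map_add, jetSum_add, hv, hw]
  · simp only [shiftedD_tOp]
    refine (map_jetSum ((V.tOp n).comp (V.gr 0).subtype) K m
      (fun i => ρ (BlockPlus.D i) w + shiftScalar n i • w)).symm.trans ?_
    rw [jetSum_add, jetSum_shiftScalar h2, ← polyOp_apply_eq_jetSum ρ hK,
      ← hρ m hm, dOp_tOp_coe hlam, tOp_tOp hlam, neg_add_cancel_left]
    rfl

lemma shiftedD_mem (hlam : lam ≠ 0) (hρ : V.IsBlockAction ρ) {S : Submodule ℂ V.carrier}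
    (hS : IsInvariant V.action S) (i : ℕ × ℕ) {v : V.carrier} (hv : v ∈ S) :
    shiftedD hlam ρ i v ∈ S := by
  obtain ⟨K', -, hK'⟩ := exists_boxSupported ρ
  set K := max 2 K'
  have hK := hK'.mono (le_max_right 2 K')
  have h2 : 2 ≤ K := le_max_left _ _
  refine mem_of_forall_jetSum_mem (K := K) (f := fun i => shiftedD hlam ρ i v)
    (fun i hi => ?_) (fun m hm => ?_) i
  · refine induction_tOp hlam (p := fun v => shiftedD hlam ρ i v = 0) (map_zero _)
      (fun v w hv hw => ?_) (fun n w => ?_) v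
    · rw [map_add, hv, hw, add_zero]
    · have h0 : ρ (BlockPlus.D i) = 0 := hK i hi
      rw [shiftedD_tOp, h0, shiftScalar_eq_zero n i (by omega), zero_smul, LinearMap.zero_apply,
        add_zero, Submodule.coe_zero, map_zero]
  · rw [jetSum_shiftedD hlam hρ h2 hK hm]
    exact tOp_mem_of_invariant hS (-m) (hS (dGen m) v hv)

/-- Brackets with `D_{(1,0)} + i D_{(0,1)}` land in the central line of `D_{(0,0)}`. -/
lemma lie_D_comm (ρ : BlockPlus →ₗ⁅ℂ⁆ Module.End ℂ (V.gr 0)) (j : ℕ × ℕ) :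
    ⁅ρ (BlockPlus.D (1, 0)) + Complex.I • ρ (BlockPlus.D (0, 1)),
      ⁅ρ (BlockPlus.D (1, 0)) + Complex.I • ρ (BlockPlus.D (0, 1)), ρ (BlockPlus.D j)⁆⁆ = 0 := by
  rw [← map_smul, ← map_add, ← LieHom.map_lie, ← LieHom.map_lie]
  have h0 : ⁅BlockPlus.D (1, 0) + Complex.I • BlockPlus.D (0, 1), BlockPlus.D (0, 0)⁆ = 0 := by
    simp [BlockPlus.lie_D, BlockPlus.lieBasis]
  have h1 : ∃ c : ℂ, ⁅BlockPlus.D (1, 0) + Complex.I • BlockPlus.D (0, 1), BlockPlus.D j⁆ =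
      c • BlockPlus.D (0, 0) := by
    rw [add_lie, smul_lie, BlockPlus.lie_D, BlockPlus.lie_D]
    by_cases h1 : j = (1, 0)
    · exact ⟨-Complex.I, by simp [BlockPlus.lieBasis, h1]⟩
    · by_cases h2 : j = (0, 1)
      · exact ⟨1, by simp [BlockPlus.lieBasis, h2]⟩
      · exact ⟨0, by simp [BlockPlus.lieBasis, h1, h2]⟩
  obtain ⟨c, hc⟩ := h1
  rw [hc, lie_smul, h0, smul_zero, map_zero]

/-- If `V₀` is indecomposable, then all submodules of `V` are graded. The operator
`D_{(1,0)} + i D_{(0,1)}` has only one eigenvalue `c` on `V₀`; the corresponding operator on `V`,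
which preserves submodules, has the generalized eigenvalue `c - n(2) + i n(1)` on `V_n`, so that the
`V_n` are its generalized eigenspaces. -/
lemma extend_fiberSub (hlam : lam ≠ 0) (hρ : V.IsBlockAction ρ) (hV : IsIndecomposableRep ρ)
    {S : Submodule ℂ V.carrier} (hS : IsInvariant V.action S) :
    V.extend hlam (fiberSub S) = S := by
  refine le_antisymm ((extend_le_iff hlam).mpr fun n v hv => tOp_mem_of_invariant hS n hv) ?_
  set X := ρ (BlockPlus.D (1, 0)) + Complex.I • ρ (BlockPlus.D (0, 1)) with hX
  obtain ⟨c, hc⟩ := exists_maxGenEigenspace_eq_top hV (X := X) (lie_D_comm ρ)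
  set Y := shiftedD hlam ρ (1, 0) + Complex.I • shiftedD hlam ρ (0, 1) with hY
  set μ : ℤ × ℤ → ℂ := fun n => c + (-(n.2 : ℂ) + Complex.I * n.1) with hμ
  have hμinj : Function.Injective μ := by
    intro a b hab
    have h := add_left_cancel hab
    have hre := congrArg Complex.re h
    have him := congrArg Complex.im h
    simp at hre him
    exact Prod.ext him hre
  have hYS : ∀ v ∈ S, Y v ∈ S := fun v hv =>
    S.add_mem (shiftedD_mem hlam hρ hS _ hv) (S.smul_mem _ (shiftedD_mem hlam hρ hS _ hv))
  have hYt : ∀ n (v : V.gr 0), (Y - μ n • 1) (V.tOp n v) =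
      V.tOp n (((X - c • 1) v : V.gr 0) : V.carrier) := by
    intro n v
    simp only [hY, hX, LinearMap.sub_apply, LinearMap.add_apply, LinearMap.smul_apply,
      shiftedD_tOp, Module.End.one_apply, ← map_smul, ← map_add, ← map_sub, ← Submodule.coe_smul,
      ← Submodule.coe_add, ← Submodule.coe_sub]
    congr 2
    simp only [shiftScalar, hμ]
    simp
    module
  have hgen : ∀ n (v : V.gr 0), V.tOp n v ∈ Y.maxGenEigenspace (μ n) := by
    intro n v
    have hv : v ∈ X.maxGenEigenspace c := by rw [hc]; trivial
    rw [Module.End.mem_maxGenEigenspace] at hv ⊢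
    obtain ⟨N, hN⟩ := hv
    refine ⟨N, ?_⟩
    have : ∀ (k : ℕ) (v : V.gr 0), ((Y - μ n • 1) ^ k) (V.tOp n v) =
        V.tOp n ((((X - c • 1) ^ k) v : V.gr 0) : V.carrier) := by
      intro k
      induction k with
      | zero => intro v; rfl
      | succ k ih =>
        intro v
        rw [pow_succ, Module.End.mul_apply, hYt, ih, pow_succ, Module.End.mul_apply]
    rw [this, hN, Submodule.coe_zero, map_zero]
  intro v hv n
  by_cases hn : n ∈ ((V.coord hlam).symm v).support
  · rw [eq_sum_tOp hlam v] at hv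
    have := mem_of_sum_mem_of_mem_maxGenEigenspace hYS hμinj _ (fun n _ => hgen n _) hv n hn
    have := tOp_mem_of_invariant hS (-n) this
    rwa [tOp_neg_tOp hlam] at this
  · rw [Finsupp.notMem_support_iff.mp hn]
    exact zero_mem _

end JetModule

/-! ### Irreducible and indecomposable jet modules -/

lemma IsIrreducibleRep.isIndecomposableRep {L : Type*} [LieRing L] [LieAlgebra ℂ L]
    {V : Type*} [AddCommGroup V] [Module ℂ V] {ρ : L →ₗ⁅ℂ⁆ Module.End ℂ V}
    (h : IsIrreducibleRep ρ) : IsIndecomposableRep ρ := by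
  refine ⟨h.1, fun S T hS _ hST => (h.2 S hS).imp_right fun h => ?_⟩
  subst h
  simpa using hST.inf_eq_bot

namespace JetModule

variable {lam : ℂ} {V : JetModule.{u} lam} {ρ : BlockPlus →ₗ⁅ℂ⁆ Module.End ℂ (V.gr 0)}

lemma nontrivial_iff (hlam : lam ≠ 0) : Nontrivial V.carrier ↔ Nontrivial (V.gr 0) := by
  constructor
  · intro h
    by_contra h0
    rw [not_nontrivial_iff_subsingleton] at h0
    refine not_subsingleton V.carrier ⟨fun v w => ?_⟩
    have : ∀ v : V.carrier, v = 0 := induction_tOp hlam (p := fun v => v = 0) rfl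
      (fun v w hv hw => by rw [hv, hw, add_zero])
      fun n v => by rw [Subsingleton.elim v 0, Submodule.coe_zero, map_zero]
    rw [this v, this w]
  · intro h
    exact (V.gr 0).subtype_injective.nontrivial

lemma extend_bot (hlam : lam ≠ 0) : V.extend hlam ⊥ = ⊥ := by
  rw [eq_bot_iff, extend_le_iff]
  rintro n v rfl
  rw [Submodule.coe_zero, map_zero]
  exact zero_mem _

lemma extend_top (hlam : lam ≠ 0) : V.extend hlam ⊤ = ⊤ :=
  eq_top_iff.mpr fun _ _ _ => trivial

lemma isIrreducibleRep_iff (hlam : lam ≠ 0) (hρ : V.IsBlockAction ρ) :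
    IsIrreducibleRep V.action ↔ IsIrreducibleRep ρ := by
  constructor
  · refine fun h => ⟨(nontrivial_iff hlam).mp h.1, fun S₀ hS₀ => ?_⟩
    rw [← fiberSub_extend hlam S₀]
    rcases h.2 _ (invariant_extend hlam hρ hS₀) with h | h
    · left
      rw [h, fiberSub, Submodule.comap_bot, Submodule.ker_subtype]
    · right
      rw [h, fiberSub, Submodule.comap_top]
  · refine fun h => ⟨(nontrivial_iff hlam).mpr h.1, fun S hS => ?_⟩
    rw [← extend_fiberSub hlam hρ h.isIndecomposableRep hS]
    rcases h.2 _ (invariant_fiberSub hlam hρ hS) with h | h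
    · left
      rw [h, extend_bot]
    · right
      rw [h, extend_top]

lemma isIndecomposableRep_iff (hlam : lam ≠ 0) (hρ : V.IsBlockAction ρ) :
    IsIndecomposableRep V.action ↔ IsIndecomposableRep ρ := by
  constructor
  · refine fun h => ⟨(nontrivial_iff hlam).mp h.1, fun S₀ T₀ hS₀ hT₀ hST => ?_⟩
    have hcompl : IsCompl (V.extend hlam S₀) (V.extend hlam T₀) := by
      constructor
      · rw [disjoint_iff, eq_bot_iff]
        rintro v ⟨h1, h2⟩
        rw [← extend_bot hlam]
        intro n
        rw [← hST.inf_eq_bot]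
        exact ⟨h1 n, h2 n⟩
      · rw [codisjoint_iff, eq_top_iff, ← extend_top hlam, extend_le_iff]
        intro n v _
        obtain ⟨s, hs, t, ht, rfl⟩ := Submodule.mem_sup.mp
          (show v ∈ S₀ ⊔ T₀ by rw [hST.sup_eq_top]; trivial)
        rw [Submodule.coe_add, map_add]
        exact Submodule.add_mem_sup ((tOp_mem_extend hlam n).mpr hs)
          ((tOp_mem_extend hlam n).mpr ht)
    rw [← fiberSub_extend hlam S₀, ← fiberSub_extend hlam T₀]
    refine (h.2 _ _ (invariant_extend hlam hρ hS₀) (invariant_extend hlam hρ hT₀) hcompl).imp ?_ ?_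
    all_goals
      intro h
      rw [h, fiberSub, Submodule.comap_bot, Submodule.ker_subtype]
  · refine fun h => ⟨(nontrivial_iff hlam).mpr h.1, fun S T hS hT hST => ?_⟩
    have eS := extend_fiberSub hlam hρ h hS
    have eT := extend_fiberSub hlam hρ h hT
    have hcompl : IsCompl (fiberSub S) (fiberSub T) := by
      constructor
      · rw [disjoint_iff, fiberSub, fiberSub, ← Submodule.comap_inf, hST.inf_eq_bot,
          Submodule.comap_bot, Submodule.ker_subtype]
      · rw [codisjoint_iff, eq_top_iff]
        intro v _
        obtain ⟨s, hs, t, ht, hv⟩ := Submodule.mem_sup.mp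
          (show (v : V.carrier) ∈ S ⊔ T by rw [hST.sup_eq_top]; trivial)
        rw [← eS] at hs
        rw [← eT] at ht
        have e : v = (V.coord hlam).symm s 0 + (V.coord hlam).symm t 0 := by
          rw [← Finsupp.add_apply, ← map_add, hv]
          have := coord_symm_tOp hlam 0 v
          rw [tOp_zero hlam] at this
          rw [this, Finsupp.single_eq_same]
        rw [e]
        exact Submodule.add_mem_sup (hs 0) (ht 0)
    rw [← eS, ← eT]
    refine (h.2 _ _ (invariant_fiberSub hlam hρ hS)
      (invariant_fiberSub hlam hρ hT) hcompl).imp ?_ ?_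
    all_goals
      intro h
      rw [h, extend_bot]

end JetModule

/-! ### Irreducible `𝓑₊`-modules -/

section IrreducibleBlock

variable {U : Type*} [AddCommGroup U] [Module ℂ U]

/-- Commuting nilpotent operators have a common kernel vector. -/
lemma exists_common_kernel [Nontrivial U] {ι : Type*} {X : ι → Module.End ℂ U} (s : Finset ι)
    (hnil : ∀ i ∈ s, IsNilpotent (X i)) (hcomm : ∀ i ∈ s, ∀ j ∈ s, Commute (X i) (X j)) :
    ∃ v ≠ 0, ∀ i ∈ s, X i v = 0 := by
  classical
  induction s using Finset.induction_on with
  | empty => simpa using exists_ne (0 : U)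
  | insert a s ha ih =>
    obtain ⟨v, hv, hvs⟩ := ih (fun i hi => hnil i (Finset.mem_insert_of_mem hi))
      fun i hi j hj => hcomm i (Finset.mem_insert_of_mem hi) j (Finset.mem_insert_of_mem hj)
    have hex : ∃ k, (X a ^ k) v = 0 := by
      obtain ⟨k, hk⟩ := hnil a (Finset.mem_insert_self _ _)
      exact ⟨k, by rw [hk]; rfl⟩
    obtain ⟨k, hk⟩ : ∃ k, Nat.find hex = k + 1 := by
      refine Nat.exists_eq_succ_of_ne_zero fun h => hv ?_
      have := Nat.find_spec hex
      rwa [h, pow_zero] at this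
    refine ⟨(X a ^ k) v, Nat.find_min hex (by omega), fun i hi => ?_⟩
    rcases Finset.mem_insert.mp hi with rfl | hi'
    · rw [← Module.End.mul_apply, ← pow_succ', ← hk]
      exact Nat.find_spec hex
    · have := (hcomm i hi a (Finset.mem_insert_self _ _)).pow_right k
      rw [← Module.End.mul_apply, this.eq, Module.End.mul_apply, hvs i hi', map_zero]

lemma trace_lie_eq_zero (X Y : Module.End ℂ U) : LinearMap.trace ℂ U ⁅X, Y⁆ = 0 := by
  rw [LieRing.of_associative_ring_bracket, map_sub, LinearMap.trace_mul_comm, sub_self]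

variable [Module.Finite ℂ U] {ρ : BlockPlus →ₗ⁅ℂ⁆ Module.End ℂ U}

/-- The only eigenvalue of `X` is zero, since its multiple by the dimension is the trace. -/
lemma isNilpotent_of_lie_lie (hU : IsIndecomposableRep ρ) {X : Module.End ℂ U}
    (hX : ∀ j, ⁅X, ⁅X, ρ (BlockPlus.D j)⁆⁆ = 0) (htr : LinearMap.trace ℂ U X = 0) :
    IsNilpotent X := by
  have := hU.1
  obtain ⟨c, hc⟩ := exists_maxGenEigenspace_eq_top hU hX
  have hnil : IsNilpotent (X - c • (1 : Module.End ℂ U)) := by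
    refine ⟨Module.finrank ℂ U, LinearMap.ext fun v => ?_⟩
    have hv : v ∈ X.maxGenEigenspace c := by rw [hc]; trivial
    rwa [Module.End.maxGenEigenspace_eq_genEigenspace_finrank, Module.End.mem_genEigenspace_nat]
      at hv
  have htr' := (LinearMap.isNilpotent_trace_of_isNilpotent hnil).eq_zero
  rw [map_sub, htr, map_smul, LinearMap.trace_one, zero_sub, neg_eq_zero, smul_eq_mul,
    mul_eq_zero] at htr'
  have hc0 : c = 0 := htr'.resolve_right (by exact_mod_cast Module.finrank_pos.ne')
  rwa [hc0, zero_smul, sub_zero] at hnil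

/-- Finitely many operators `D_i` act as zero on an irreducible module if they commute and are
commutators, and if their span is stable under brackets with all `D_j`: they are nilpotent, and
their common kernel is a submodule. -/
lemma D_eq_zero_of_ideal (hU : IsIrreducibleRep ρ) (s : Finset (ℕ × ℕ))
    (hcomm : ∀ i ∈ s, ∀ j ∈ s, ⁅ρ (BlockPlus.D i), ρ (BlockPlus.D j)⁆ = 0)
    (hideal : ∀ i ∈ s, ∀ j, ∃ k ∈ s, ∃ c : ℂ,
      ⁅ρ (BlockPlus.D i), ρ (BlockPlus.D j)⁆ = c • ρ (BlockPlus.D k))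
    (hderived : ∀ i ∈ s, ∃ c : ℂ, c ≠ 0 ∧ ∃ p q, BlockPlus.lieBasis p q = c • BlockPlus.D i) :
    ∀ i ∈ s, ρ (BlockPlus.D i) = 0 := by
  have := hU.1
  have hnil : ∀ i ∈ s, IsNilpotent (ρ (BlockPlus.D i)) := by
    intro i hi
    refine isNilpotent_of_lie_lie hU.isIndecomposableRep (fun j => ?_) ?_
    · obtain ⟨k, hk, c, hc⟩ := hideal i hi j
      rw [hc, lie_smul, hcomm i hi k hk, smul_zero]
    · obtain ⟨c, hc, p, q, h⟩ := hderived i hi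
      have h1 : ⁅ρ (BlockPlus.D p), ρ (BlockPlus.D q)⁆ = c • ρ (BlockPlus.D i) := by
        rw [← LieHom.map_lie, BlockPlus.lie_D, h, map_smul]
      have h2 := trace_lie_eq_zero (ρ (BlockPlus.D p)) (ρ (BlockPlus.D q))
      rw [h1, map_smul] at h2
      exact (smul_eq_zero.mp h2).resolve_left hc
  obtain ⟨v, hv, hvs⟩ := exists_common_kernel (X := fun i => ρ (BlockPlus.D i)) s hnil
    fun i hi j hj => commute_iff_lie_eq.mpr (hcomm i hi j hj)
  set N : Submodule ℂ U := ⨅ i ∈ s, LinearMap.ker (ρ (BlockPlus.D i)) with hN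
  have hmem : ∀ v, v ∈ N ↔ ∀ i ∈ s, ρ (BlockPlus.D i) v = 0 := by simp [hN]
  have hinv : IsInvariant ρ N := by
    refine block_isInvariant_iff.mpr fun j w hw => (hmem _).mpr fun i hi => ?_
    rw [hmem] at hw
    obtain ⟨k, hk, c, hc⟩ := hideal i hi j
    have := LinearMap.congr_fun hc w
    rw [LieRing.of_associative_ring_bracket, LinearMap.sub_apply, Module.End.mul_apply,
      Module.End.mul_apply, hw i hi, map_zero, sub_zero, LinearMap.smul_apply, hw k hk,
      smul_zero] at this
    exact this
  intro i hi
  rcases hU.2 N hinv with h | h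
  · exact absurd ((Submodule.mem_bot ℂ).mp (h ▸ (hmem v).mpr hvs)) hv
  · ext w
    exact (hmem w).mp (h ▸ Submodule.mem_top) i hi

/-- `D_{(0,0)}` is central and equal to `[D_{(1,0)}, D_{(0,1)}]`. -/
lemma D_zero_eq_zero (hU : IsIrreducibleRep ρ) : ρ (BlockPlus.D (0, 0)) = 0 := by
  have h0 : ∀ j, ⁅ρ (BlockPlus.D (0, 0)), ρ (BlockPlus.D j)⁆ = 0 := fun j => by
    rw [← LieHom.map_lie, BlockPlus.lie_D]
    simp [BlockPlus.lieBasis]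
  refine D_eq_zero_of_ideal hU {(0, 0)} ?_ ?_ ?_ _ (Finset.mem_singleton_self _)
  · intro i hi j _
    rw [Finset.mem_singleton] at hi
    rw [hi, h0]
  · intro i hi j
    rw [Finset.mem_singleton] at hi
    exact ⟨(0, 0), Finset.mem_singleton_self _, 0, by rw [hi, h0, zero_smul]⟩
  · intro i hi
    rw [Finset.mem_singleton] at hi
    exact ⟨1, one_ne_zero, (1, 0), (0, 1), by simp [BlockPlus.lieBasis, hi]⟩

/-- Bracketing with an element of degree `d ≥ 3` shifts degrees by `d - 2`. -/
lemma lieBasis_eq_smul (i j : ℕ × ℕ) (h : 3 ≤ i.1 + i.2) :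
    ∃ (c : ℂ) (k : ℕ × ℕ), BlockPlus.lieBasis i j = c • BlockPlus.D k ∧
      (c = 0 ∨ (2 ≤ j.1 + j.2 ∧ k.1 + k.2 + 2 = i.1 + i.2 + (j.1 + j.2))) := by
  obtain ⟨a, b⟩ := i
  obtain ⟨c, d⟩ := j
  dsimp only at h
  by_cases hj : 2 ≤ c + d
  · refine ⟨_, _, if_pos ⟨by dsimp only; omega, hj⟩, ?_⟩
    by_cases h1 : a + c = 0
    · left
      obtain ⟨rfl, rfl⟩ : a = 0 ∧ c = 0 := by omega
      simp [det2, BlockPlus.natC]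
    by_cases h2 : b + d = 0
    · left
      obtain ⟨rfl, rfl⟩ : b = 0 ∧ d = 0 := by omega
      simp [det2, BlockPlus.natC]
    right
    dsimp only
    omega
  · refine ⟨0, (0, 0), ?_, Or.inl rfl⟩
    rw [zero_smul, BlockPlus.lieBasis, if_neg (fun h => hj h.2), if_neg, if_neg]
    · rintro ⟨h1, -⟩
      simp only [Prod.mk.injEq] at h1
      omega
    · rintro ⟨h1, -⟩
      simp only [Prod.mk.injEq] at h1
      omega

/-- Descending induction on the degree: the `D_i` of the highest degree `d ≥ 3` span an abelian
ideal in the image of `𝓑₊`. -/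
lemma D_eq_zero_of_three_le (hU : IsIrreducibleRep ρ) (i : ℕ × ℕ) (hi : 3 ≤ i.1 + i.2) :
    ρ (BlockPlus.D i) = 0 := by
  obtain ⟨K, -, hK⟩ := exists_boxSupported ρ
  -- an index of degree at least `2K` has an entry that is at least `K`
  have key : ∀ n : ℕ, ∀ i : ℕ × ℕ, 3 ≤ i.1 + i.2 → K + K ≤ i.1 + i.2 + n →
      ρ (BlockPlus.D i) = 0 := by
    intro n
    induction n with
    | zero => exact fun i _ h => hK i (by omega)
    | succ n ih =>
      intro i h3 hin
      have hlie : ∀ j k : ℕ × ℕ, ⁅ρ (BlockPlus.D j), ρ (BlockPlus.D k)⁆ =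
          ρ (BlockPlus.lieBasis j k) := fun j k => by rw [← LieHom.map_lie, BlockPlus.lie_D]
      refine D_eq_zero_of_ideal hU (Finset.HasAntidiagonal.antidiagonal (i.1 + i.2)) ?_ ?_ ?_ i
        (by simp)
      · intro j hj k hk
        rw [Finset.HasAntidiagonal.mem_antidiagonal] at hj hk
        obtain ⟨c, l, h, hc⟩ := lieBasis_eq_smul j k (by omega)
        rw [hlie, h, map_smul]
        rcases hc with rfl | ⟨-, hl⟩
        · rw [zero_smul]
        · rw [ih l (by omega) (by omega), smul_zero]
      · intro j hj k
        rw [Finset.HasAntidiagonal.mem_antidiagonal] at hj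
        obtain ⟨c, l, h, hc⟩ := lieBasis_eq_smul j k (by omega)
        rw [hlie, h, map_smul]
        by_cases hl : l.1 + l.2 = i.1 + i.2
        · exact ⟨l, by simpa using hl, c, rfl⟩
        · refine ⟨j, by simpa using hj, 0, ?_⟩
          rcases hc with rfl | ⟨hk2, hl'⟩
          · rw [zero_smul, zero_smul]
          · rw [ih l (by omega) (by omega), smul_zero, zero_smul]
      -- `[D_(0,2), D_(1,b-1)]` and `[D_(2,0), D_(a,b+1)]` are nonzero multiples of `D_(0,b)` and
      -- `D_(a+1,b)`
      · rintro ⟨a, b⟩ hj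
        rw [Finset.HasAntidiagonal.mem_antidiagonal] at hj
        dsimp only at hj
        rcases a with _ | a
        · refine ⟨2, two_ne_zero, (0, 2), (1, b - 1), ?_⟩
          rw [BlockPlus.lieBasis, if_pos ⟨by norm_num, by dsimp only; omega⟩]
          congr 1
          · simp [det2, BlockPlus.natC]
          · congr 2
            omega
        · refine ⟨-((b + 1 : ℕ) * 2), ?_, (2, 0), (a, b + 1), ?_⟩
          · exact neg_ne_zero.mpr (mul_ne_zero (by exact_mod_cast b.succ_ne_zero) two_ne_zero)
          · rw [BlockPlus.lieBasis, if_pos ⟨by norm_num, by dsimp only; omega⟩]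
            congr 1
            · simp [det2, BlockPlus.natC]
            · congr 2 <;> dsimp only <;> omega
  exact key (K + K) i hi (by omega)

end IrreducibleBlock

/-! ### The projection `𝓑₊ → sl₂ ⊕ ℂ z₁ ⊕ ℂ z₂` -/

section Projection

lemma slMat_lie (a b c a' b' c' : ℂ) : ⁅slMat a b c, slMat a' b' c'⁆ =
    slMat (b * c' - b' * c) (2 * (a * b' - a' * b)) (2 * (c * a' - c' * a)) := by
  refine Prod.ext (Subtype.ext ?_) ?_
  · change ⁅!![a, b; c, -a], !![a', b'; c', -a']⁆ = _
    rw [LieRing.of_associative_ring_bracket, Matrix.mul_fin_two, Matrix.mul_fin_two]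
    ext i j
    fin_cases i <;> fin_cases j <;> simp [slMat] <;> ring
  · change ⁅(0 : ℂ × ℂ), (0 : ℂ × ℂ)⁆ = 0
    exact lie_self _

lemma z₁_lie (x : SlZ) : ⁅z₁, x⁆ = 0 := by
  refine Prod.ext ?_ ?_
  · exact zero_lie x.1
  · refine Prod.ext ?_ ?_
    · change (1 : ℂ) * x.2.1 - x.2.1 * 1 = 0
      ring
    · change (0 : ℂ) * x.2.2 - x.2.2 * 0 = 0
      ring

lemma z₂_lie (x : SlZ) : ⁅z₂, x⁆ = 0 := by
  refine Prod.ext ?_ ?_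
  · exact zero_lie x.1
  · refine Prod.ext ?_ ?_
    · change (0 : ℂ) * x.2.1 - x.2.1 * 0 = 0
      ring
    · change (1 : ℂ) * x.2.2 - x.2.2 * 1 = 0
      ring

lemma smul_slMat (r a b c : ℂ) : r • slMat a b c = slMat (r * a) (r * b) (r * c) := by
  refine Prod.ext (Subtype.ext ?_) (smul_zero r)
  change r • !![a, b; c, -a] = _
  simp [slMat]

lemma slMat_add (a b c a' b' c' : ℂ) :
    slMat a b c + slMat a' b' c' = slMat (a + a') (b + b') (c + c') := by
  refine Prod.ext (Subtype.ext ?_) (add_zero 0)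
  change !![a, b; c, -a] + !![a', b'; c', -a'] = _
  simp [slMat, add_comm]

lemma slMat_zero : slMat 0 0 0 = 0 := by
  refine Prod.ext (Subtype.ext ?_) rfl
  change !![(0 : ℂ), 0; 0, -0] = 0
  ext i j
  fin_cases i <;> fin_cases j <;> simp

lemma neg_slMat (a b c : ℂ) : -slMat a b c = slMat (-a) (-b) (-c) := by
  rw [← neg_one_smul ℂ, smul_slMat]
  simp

lemma slZ_eq (x : SlZ) :
    x = slMat (x.1.1 0 0) (x.1.1 0 1) (x.1.1 1 0) + x.2.1 • z₁ + x.2.2 • z₂ := by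
  have htr : x.1.1 1 1 = -x.1.1 0 0 := by
    have h : Matrix.trace x.1.1 = 0 := x.1.2
    rw [Matrix.trace_fin_two] at h
    exact eq_neg_of_add_eq_zero_right h
  refine Prod.ext (Subtype.ext ?_) ?_
  · change x.1.1 = !![_, _; _, _] + x.2.1 • 0 + x.2.2 • 0
    ext i j
    fin_cases i <;> fin_cases j <;> simp [htr]
  · refine Prod.ext ?_ ?_
    · simp [slMat, z₁, z₂]
    · simp [slMat, z₁, z₂]

lemma blockToSl_of_two {i : ℕ × ℕ} (h : i.1 + i.2 = 2) :
    blockToSl i = slMat (if i.1 = 1 then 1 else 0) (if i.1 = 2 then -2 else 0)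
      (if i.1 = 0 then 2 else 0) := by
  obtain ⟨a, b⟩ := i
  dsimp only at h
  obtain ⟨rfl, rfl⟩ | ⟨rfl, rfl⟩ | ⟨rfl, rfl⟩ :
    (a = 0 ∧ b = 2) ∨ (a = 1 ∧ b = 1) ∨ (a = 2 ∧ b = 0) := by omega
  all_goals simp [blockToSl]

lemma blockToSl_of_three_le {i : ℕ × ℕ} (h : 3 ≤ i.1 + i.2) : blockToSl i = 0 := by
  obtain ⟨a, b⟩ := i
  dsimp only at h
  unfold blockToSl
  repeat rw [if_neg (by simp only [Prod.mk.injEq]; omega)]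

lemma blockToSl_zero : blockToSl (0, 0) = 0 := by simp [blockToSl]

lemma blockToSl_z₁ : blockToSl (1, 0) = z₁ := by simp [blockToSl]

lemma blockToSl_z₂ : blockToSl (0, 1) = z₂ := by simp [blockToSl]

lemma lift_blockToSl (i j : ℕ × ℕ) :
    BlockPlus.lift blockToSl (BlockPlus.lieBasis i j) = ⁅blockToSl i, blockToSl j⁆ := by
  -- the elements of degree at most one map to central elements
  have hcen : ∀ i j : ℕ × ℕ, i.1 + i.2 ≤ 1 → ⁅blockToSl i, blockToSl j⁆ = 0 := by
    rintro ⟨a, b⟩ j h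
    dsimp only at h
    obtain ⟨rfl, rfl⟩ | ⟨rfl, rfl⟩ | ⟨rfl, rfl⟩ :
      (a = 0 ∧ b = 0) ∨ (a = 1 ∧ b = 0) ∨ (a = 0 ∧ b = 1) := by omega
    · rw [blockToSl_zero, zero_lie]
    · rw [blockToSl_z₁, z₁_lie]
    · rw [blockToSl_z₂, z₂_lie]
  by_cases h : 2 ≤ i.1 + i.2 ∧ 2 ≤ j.1 + j.2
  · by_cases h2 : i.1 + i.2 = 2 ∧ j.1 + j.2 = 2
    · rw [blockToSl_of_two h2.1, blockToSl_of_two h2.2, slMat_lie, BlockPlus.lieBasis, if_pos h,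
        map_smul, BlockPlus.lift_D]
      obtain ⟨a, b⟩ := i
      obtain ⟨c, d⟩ := j
      dsimp only at h2
      obtain ⟨⟨rfl, rfl⟩ | ⟨rfl, rfl⟩ | ⟨rfl, rfl⟩, ⟨rfl, rfl⟩ | ⟨rfl, rfl⟩ | ⟨rfl, rfl⟩⟩ :
        ((a = 0 ∧ b = 2) ∨ (a = 1 ∧ b = 1) ∨ (a = 2 ∧ b = 0)) ∧
        ((c = 0 ∧ d = 2) ∨ (c = 1 ∧ d = 1) ∨ (c = 2 ∧ d = 0)) := by omega
      all_goals
        simp [det2, BlockPlus.natC, blockToSl, smul_slMat, neg_slMat, slMat_zero]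
    · have h3 : blockToSl i = 0 ∨ blockToSl j = 0 := by
        by_cases h3 : 3 ≤ i.1 + i.2
        · exact Or.inl (blockToSl_of_three_le h3)
        · exact Or.inr (blockToSl_of_three_le (by omega))
      have h4 : ⁅blockToSl i, blockToSl j⁆ = 0 := by
        rcases h3 with h3 | h3
        · rw [h3, zero_lie]
        · rw [h3, lie_zero]
      rw [h4]
      by_cases h5 : 3 ≤ i.1 + i.2
      · obtain ⟨c, k, hk, hc⟩ := lieBasis_eq_smul i j h5
        rw [hk, map_smul, BlockPlus.lift_D]
        rcases hc with rfl | hc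
        · rw [zero_smul]
        · rw [blockToSl_of_three_le (by omega), smul_zero]
      · obtain ⟨c, k, hk, hc⟩ := lieBasis_eq_smul j i (by omega)
        rw [BlockPlus.lieBasis_skew, hk, map_neg, map_smul, BlockPlus.lift_D]
        rcases hc with rfl | hc
        · rw [zero_smul, neg_zero]
        · rw [blockToSl_of_three_le (by omega), smul_zero, neg_zero]
  · have h0 : BlockPlus.lift blockToSl (BlockPlus.lieBasis i j) = 0 := by
      rw [BlockPlus.lieBasis, if_neg h]
      split_ifs
      · rw [BlockPlus.lift_D, blockToSl_zero]
      · rw [map_neg, BlockPlus.lift_D, blockToSl_zero, neg_zero]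
      · exact map_zero _
    rw [h0]
    by_cases hi : 2 ≤ i.1 + i.2
    · rw [← lie_skew, hcen j i (by omega), neg_zero]
    · rw [hcen i j (by omega)]

/-- The homomorphism `𝓑₊ → sl₂ ⊕ ℂ z₁ ⊕ ℂ z₂` with `D_i ↦ blockToSl i`. -/
def blockProj : BlockPlus →ₗ⁅ℂ⁆ SlZ := BlockPlus.liftLie blockToSl lift_blockToSl

lemma blockProj_D (i : ℕ × ℕ) : blockProj (BlockPlus.D i) = blockToSl i :=
  BlockPlus.liftLie_D _ _ i

/-- A linear section of `blockProj`. -/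
def blockSection : SlZ →ₗ[ℂ] BlockPlus where
  toFun x := (-(x.1.1 0 1) / 2) • BlockPlus.D (2, 0) + (x.1.1 1 0 / 2) • BlockPlus.D (0, 2) +
    x.1.1 0 0 • BlockPlus.D (1, 1) + x.2.1 • BlockPlus.D (1, 0) + x.2.2 • BlockPlus.D (0, 1)
  map_add' x y := by
    have h : ∀ i j, (x.1 + y.1).1 i j = x.1.1 i j + y.1.1 i j := fun _ _ => rfl
    simp only [Prod.fst_add, Prod.snd_add, h]
    module
  map_smul' c x := by
    have h : ∀ i j, (c • x.1).1 i j = c * x.1.1 i j := fun _ _ => rfl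
    simp only [Prod.smul_fst, Prod.smul_snd, h, RingHom.id_apply, smul_eq_mul]
    module

lemma blockProj_blockSection (x : SlZ) : blockProj (blockSection x) = x := by
  change blockProj (_ + _ + _ + _ + _) = x
  simp only [map_add, map_smul, blockProj_D, blockToSl_z₁, blockToSl_z₂]
  simp only [blockToSl]
  simp only [Prod.mk.injEq, if_true, OfNat.ofNat_ne_zero, OfNat.zero_ne_ofNat,
    and_self, OfNat.ofNat_ne_one, OfNat.one_ne_ofNat, if_false, one_ne_zero, zero_ne_one,
    smul_slMat, slMat_add]
  conv_rhs => rw [slZ_eq x]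
  congr 3 <;> ring

lemma blockProj_surjective : Function.Surjective blockProj := fun x =>
  ⟨_, blockProj_blockSection x⟩

lemma blockSection_blockToSl {i : ℕ × ℕ} (h0 : i ≠ (0, 0)) (h3 : i.1 + i.2 ≤ 2) :
    blockSection (blockToSl i) = BlockPlus.D i := by
  obtain ⟨a, b⟩ := i
  dsimp only at h3
  obtain ⟨rfl, rfl⟩ | ⟨rfl, rfl⟩ | ⟨rfl, rfl⟩ | ⟨rfl, rfl⟩ | ⟨rfl, rfl⟩ :
    (a = 2 ∧ b = 0) ∨ (a = 0 ∧ b = 2) ∨ (a = 1 ∧ b = 1) ∨ (a = 1 ∧ b = 0) ∨ (a = 0 ∧ b = 1) := by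
    simp only [ne_eq, Prod.mk.injEq] at h0
    omega
  all_goals
    change (_ • _ + _ • _ + _ • _ + _ • _ + _ • _ : BlockPlus) = _
    simp [blockToSl, slMat, z₁, z₂]

/-- A representation of `𝓑₊` factors through `sl₂ ⊕ ℂ z₁ ⊕ ℂ z₂` if `D_{(0,0)}` and the `D_i` with
`i(1) + i(2) ≥ 3` act as zero. -/
lemma exists_factor {L : Type*} [LieRing L] [LieAlgebra ℂ L] (σ : BlockPlus →ₗ⁅ℂ⁆ L)
    (h0 : σ (BlockPlus.D (0, 0)) = 0)
    (h3 : ∀ i : ℕ × ℕ, 3 ≤ i.1 + i.2 → σ (BlockPlus.D i) = 0) :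
    ∃ τ : SlZ →ₗ⁅ℂ⁆ L, τ.comp blockProj = σ := by
  have key : ∀ x, σ (blockSection (blockProj x)) = σ x := fun x =>
    LinearMap.congr_fun (BlockPlus.lin_ext
      (f := (σ.toLinearMap.comp blockSection).comp blockProj.toLinearMap) (g := σ.toLinearMap)
      fun i => by
        change σ (blockSection (blockProj (BlockPlus.D i))) = σ (BlockPlus.D i)
        rw [blockProj_D]
        by_cases hi : i = (0, 0)
        · rw [hi, blockToSl_zero, map_zero, map_zero, h0]
        by_cases hi3 : 3 ≤ i.1 + i.2
        · rw [blockToSl_of_three_le hi3, map_zero, map_zero, h3 i hi3]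
        · rw [blockSection_blockToSl hi (by omega)]) x
  refine ⟨{ σ.toLinearMap.comp blockSection with map_lie' := ?_ }, ?_⟩
  · intro x y
    change σ (blockSection ⁅x, y⁆) = ⁅σ (blockSection x), σ (blockSection y)⁆
    rw [← LieHom.map_lie, ← key ⁅blockSection x, blockSection y⁆, LieHom.map_lie blockProj,
      blockProj_blockSection, blockProj_blockSection]
  · exact blockHom_ext fun i => key _

end Projection

/-! ### Modules over `sl₂ ⊕ ℂ z₁ ⊕ ℂ z₂` as `𝓑₊`-modules -/

section SlModules

variable {U : Type*} [AddCommGroup U] [Module ℂ U]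

lemma jetSum_blockToSl (m : ℤ × ℤ) :
    jetSum 3 m blockToSl = slM m + (m.1 : ℂ) • z₁ + (m.2 : ℂ) • z₂ := by
  have e1 : slMat 0 (-2) 0 = (-2 : ℂ) • slMat 0 1 0 := by
    simp only [smul_slMat, mul_zero, mul_one]
  have e2 : slMat 0 0 2 = (2 : ℂ) • slMat 0 0 1 := by simp [smul_slMat]
  have e3 : slM m = ((m.1 : ℂ) * m.2) • slMat 1 0 0 + (-(m.1 : ℂ) ^ 2) • slMat 0 1 0 +
      ((m.2 : ℂ) ^ 2) • slMat 0 0 1 := by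
    simp only [slM, smul_slMat, slMat_add, mul_zero, mul_one, add_zero, zero_add]
  simp only [jetSum, dsum, Finset.sum_range_succ, Finset.sum_range_zero, zero_add, dpow, blockToSl,
    Prod.mk.injEq, e1, e2, e3]
  norm_num [Nat.factorial]
  module

lemma boxSupported_comp_blockProj {L : Type*} [LieRing L] [LieAlgebra ℂ L] (τ : SlZ →ₗ⁅ℂ⁆ L) :
    BoxSupported 3 fun i => τ.comp blockProj (BlockPlus.D i) := fun i hi => by
  change τ (blockProj (BlockPlus.D i)) = 0
  rw [blockProj_D, blockToSl_of_three_le (by omega), map_zero]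

lemma polyOp_comp_blockProj (τ : SlZ →ₗ⁅ℂ⁆ Module.End ℂ U) (m : ℤ × ℤ) :
    polyOp (τ.comp blockProj) m = τ (slM m + (m.1 : ℂ) • z₁ + (m.2 : ℂ) • z₂) := by
  rw [polyOp_eq_jetSum _ (boxSupported_comp_blockProj τ), ← jetSum_blockToSl]
  refine Eq.trans ?_ (map_jetSum τ.toLinearMap 3 m blockToSl).symm
  congr 1
  funext i
  exact congrArg τ (blockProj_D i)

lemma JetModule.isSlAction_iff {lam : ℂ} {V : JetModule.{u} lam}
    {τ : SlZ →ₗ⁅ℂ⁆ Module.End ℂ (V.gr 0)} :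
    V.IsSlAction τ ↔ V.IsBlockAction (τ.comp blockProj) := by
  simp only [JetModule.IsSlAction, JetModule.IsBlockAction, polyOp_comp_blockProj]

lemma isInvariant_comp_blockProj {τ : SlZ →ₗ⁅ℂ⁆ Module.End ℂ U} {S : Submodule ℂ U} :
    IsInvariant (τ.comp blockProj) S ↔ IsInvariant τ S := by
  refine ⟨fun h x => ?_, fun h x => h (blockProj x)⟩
  obtain ⟨y, rfl⟩ := blockProj_surjective x
  exact h y

lemma isIrreducibleRep_comp_blockProj {τ : SlZ →ₗ⁅ℂ⁆ Module.End ℂ U} :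
    IsIrreducibleRep (τ.comp blockProj) ↔ IsIrreducibleRep τ := by
  simp only [IsIrreducibleRep, isInvariant_comp_blockProj]

lemma intertwines_comp_blockProj {W : Type*} [AddCommGroup W] [Module ℂ W]
    {τ : SlZ →ₗ⁅ℂ⁆ Module.End ℂ U} {τ' : SlZ →ₗ⁅ℂ⁆ Module.End ℂ W} {f : U ≃ₗ[ℂ] W} :
    Intertwines (τ.comp blockProj) (τ'.comp blockProj) f ↔ Intertwines τ τ' f := by
  refine ⟨fun h x => ?_, fun h x => h (blockProj x)⟩
  obtain ⟨y, rfl⟩ := blockProj_surjective x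
  exact h y

lemma comp_blockProj_injective {L : Type*} [LieRing L] [LieAlgebra ℂ L] {τ τ' : SlZ →ₗ⁅ℂ⁆ L}
    (h : τ.comp blockProj = τ'.comp blockProj) : τ = τ' := by
  refine LieHom.ext fun x => ?_
  obtain ⟨y, rfl⟩ := blockProj_surjective x
  exact LieHom.congr_fun h y

/-- An irreducible finite-dimensional `𝓑₊`-module is a module over `sl₂ ⊕ ℂ z₁ ⊕ ℂ z₂`. -/
lemma exists_comp_blockProj [Module.Finite ℂ U] {σ : BlockPlus →ₗ⁅ℂ⁆ Module.End ℂ U}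
    (hσ : IsIrreducibleRep σ) : ∃ τ : SlZ →ₗ⁅ℂ⁆ Module.End ℂ U, τ.comp blockProj = σ :=
  exists_factor σ (D_zero_eq_zero hσ) (D_eq_zero_of_three_le hσ)

lemma JetModule.existsUnique_isSlAction {lam : ℂ} (hlam : lam ≠ 0) {V : JetModule.{u} lam}
    (hV : IsIrreducibleRep V.action) : ∃! τ, V.IsSlAction τ := by
  obtain ⟨σ, hσ, huniq⟩ := V.existsUnique_isBlockAction hlam
  obtain ⟨τ, rfl⟩ := exists_comp_blockProj ((isIrreducibleRep_iff hlam hσ).mp hV)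
  exact ⟨τ, isSlAction_iff.mpr hσ, fun τ' h =>
    comp_blockProj_injective (huniq _ (isSlAction_iff.mp h))⟩

/-- Schur's lemma for a central element. -/
lemma exists_scalar [Module.Finite ℂ U] {τ : SlZ →ₗ⁅ℂ⁆ Module.End ℂ U} (hτ : IsIrreducibleRep τ)
    {z : SlZ} (hz : ∀ x : SlZ, ⁅z, x⁆ = 0) : ∃ c : ℂ, ∀ v, τ z v = c • v := by
  have := hτ.1
  obtain ⟨c, hc⟩ := Module.End.exists_eigenvalue (τ z)
  have hinv : IsInvariant τ ((τ z).eigenspace c) := by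
    intro x v hv
    rw [Module.End.mem_eigenspace_iff] at hv ⊢
    have h : ⁅τ z, τ x⁆ v = 0 := by rw [← LieHom.map_lie, hz, map_zero, LinearMap.zero_apply]
    rw [LieRing.of_associative_ring_bracket, LinearMap.sub_apply, Module.End.mul_apply,
      Module.End.mul_apply, hv, map_smul, sub_eq_zero] at h
    exact h
  have htop := (hτ.2 _ hinv).resolve_left hc
  exact ⟨c, fun v => Module.End.mem_eigenspace_iff.mp (htop ▸ Submodule.mem_top)⟩

lemma existsUnique_hasCentralWeight [Module.Finite ℂ U] {τ : SlZ →ₗ⁅ℂ⁆ Module.End ℂ U}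
    (hτ : IsIrreducibleRep τ) : ∃! α : ℂ × ℂ, HasCentralWeight τ α := by
  obtain ⟨c₁, h₁⟩ := exists_scalar hτ z₁_lie
  obtain ⟨c₂, h₂⟩ := exists_scalar hτ z₂_lie
  refine ⟨(c₂, -c₁), ⟨fun v => by rw [h₁, neg_neg], h₂⟩, fun α hα => ?_⟩
  have := hτ.1
  obtain ⟨v, hv⟩ := exists_ne (0 : U)
  have e₁ := (h₁ v).symm.trans (hα.1 v)
  have e₂ := (h₂ v).symm.trans (hα.2 v)
  refine Prod.ext (smul_left_injective ℂ hv e₂).symm ?_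
  rw [smul_left_injective ℂ hv e₁, neg_neg]

lemma isSlTensorAction_iff {lam : ℂ} {α : ℂ × ℂ} {τ : SlZ →ₗ⁅ℂ⁆ Module.End ℂ U}
    (hα : HasCentralWeight τ α) {Φ : VirA →ₗ⁅ℂ⁆ Module.End ℂ (Laurent ⊗[ℂ] U)} :
    IsSlTensorAction lam α τ Φ ↔ IsBlockTensorAction lam (τ.comp blockProj) Φ := by
  have key : ∀ (m n : ℤ × ℤ) (v : U), τ (slM m) v + det2 (α + toC n) (toC m) • v =
      det2 (toC n) (toC m) • v + polyOp (τ.comp blockProj) m v := by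
    intro m n v
    rw [polyOp_comp_blockProj, map_add, map_add, map_smul, map_smul, LinearMap.add_apply,
      LinearMap.add_apply, LinearMap.smul_apply, LinearMap.smul_apply, hα.1, hα.2]
    simp only [det2, toC, Prod.fst_add, Prod.snd_add]
    module
  simp only [IsSlTensorAction, IsBlockTensorAction, key]

end SlModules

/-! ### The modules `A ⊗ U` -/

section Tensor

/-- The vector orthogonal to `m` pairs with `m` to `m(1)² + m(2)²`. -/
lemma det2_rotate_ne_zero {m : ℤ × ℤ} (hm : m ≠ 0) :
    det2 (toC (m.2, -m.1)) (toC m) ≠ 0 := by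
  have h : m.1 ^ 2 + m.2 ^ 2 ≠ 0 := by
    intro h
    have h1 : m.1 = 0 := by nlinarith [sq_nonneg m.1, sq_nonneg m.2]
    have h2 : m.2 = 0 := by nlinarith [sq_nonneg m.1, sq_nonneg m.2]
    exact hm (Prod.ext h1 h2)
  have e : det2 (toC (m.2, -m.1)) (toC m) = ((m.1 ^ 2 + m.2 ^ 2 : ℤ) : ℂ) := by
    simp only [det2, toC]
    push_cast
    ring
  rw [e]
  exact_mod_cast h

/-- The coefficient of `t^n` as a linear functional. -/
def coeffLin (n : ℤ × ℤ) : Laurent →ₗ[ℂ] ℂ :=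
  (Finsupp.lapply n).comp (AddMonoidAlgebra.coeffLinearEquiv ℂ).toLinearMap

lemma coeffLin_mono (n k : ℤ × ℤ) : coeffLin n (mono k) = if k = n then 1 else 0 := by
  simp [coeffLin, mono, Finsupp.single_apply]

lemma linearIndependent_dDer :
    LinearIndependent ℂ fun m : {m : ℤ × ℤ // m ≠ 0} => (⟨dDer m, dDer_mem_Vir m⟩ : Vir) := by
  rw [linearIndependent_iff']
  intro s c hc k hk
  -- compare the coefficients of `t^{k+n}` after applying both sides to `t^n`, `det (n over k) ≠ 0`
  set n : ℤ × ℤ := (k.1.2, -k.1.1) with hn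
  set φ : Vir →ₗ[ℂ] ℂ :=
    { toFun := fun x => coeffLin (k.1 + n) (x.1 (mono n))
      map_add' := fun x y => map_add (coeffLin (k.1 + n)) (x.1 (mono n)) (y.1 (mono n))
      map_smul' := fun r x => map_smul (coeffLin (k.1 + n)) r (x.1 (mono n)) } with hφ
  have h := congrArg φ hc
  rw [map_sum, map_zero, Finset.sum_eq_single k] at h
  · rw [map_smul] at h
    have : φ ⟨dDer k, dDer_mem_Vir k⟩ = det2 (toC n) (toC k.1) := by
      change coeffLin (k.1 + n) (dDer k (mono n)) = _
      rw [dDer_mono, map_smul, coeffLin_mono, if_pos rfl, smul_eq_mul, mul_one]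
    rw [this, smul_eq_mul] at h
    exact (mul_eq_zero.mp h).resolve_right (det2_rotate_ne_zero k.2)
  · intro m _ hmk
    have : φ ⟨dDer m, dDer_mem_Vir m⟩ = 0 := by
      change coeffLin (k.1 + n) (dDer m (mono n)) = _
      rw [dDer_mono, map_smul, coeffLin_mono, if_neg, smul_zero]
      exact fun h => hmk (Subtype.ext (add_right_cancel h))
    rw [map_smul, this, smul_zero]
  · exact fun h => absurd hk h

lemma span_dDer :
    ⊤ ≤ Submodule.span ℂ
      (Set.range fun m : {m : ℤ × ℤ // m ≠ 0} => (⟨dDer m, dDer_mem_Vir m⟩ : Vir)) := by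
  set S := Submodule.span ℂ
    (Set.range fun m : {m : ℤ × ℤ // m ≠ 0} => (⟨dDer m, dDer_mem_Vir m⟩ : Vir)) with hS
  have h : S.mkQ.comp (LieAlgebra.SemiDirectSum.projr (derAction.comp Vir.incl)).toLinearMap = 0 :=
    virA_ext (fun n => map_zero S.mkQ) fun m hm =>
      (Submodule.Quotient.mk_eq_zero S).mpr (Submodule.subset_span ⟨⟨m, hm⟩, rfl⟩)
  intro x _
  exact (Submodule.Quotient.mk_eq_zero S).mp (LinearMap.congr_fun h ⟨0, x⟩)

/-- The basis of `𝒢` that consists of the `d_m`, `m ≠ 0`. -/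
def virBasis : Module.Basis {m : ℤ × ℤ // m ≠ 0} ℂ Vir :=
  Module.Basis.mk linearIndependent_dDer span_dDer

lemma virBasis_apply (m : {m : ℤ × ℤ // m ≠ 0}) : virBasis m = ⟨dDer m, dDer_mem_Vir m⟩ := by
  rw [virBasis, Module.Basis.mk_apply]

/-- A linear map on `𝒢 ⋉ A` is a homomorphism of Lie algebras if it respects the brackets of the
`t^n` and the `d_m`. -/
lemma map_lie_of_generators {L : Type*} [LieRing L] [LieAlgebra ℂ L] (F : VirA →ₗ[ℂ] L)
    (htt : ∀ m n, ⁅F (tElt m), F (tElt n)⁆ = 0)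
    (hdt : ∀ m n, m ≠ 0 → ⁅F (dGen m), F (tElt n)⁆ = det2 (toC n) (toC m) • F (tElt (m + n)))
    (hdd : ∀ m n, m ≠ 0 → n ≠ 0 →
      ⁅F (dGen m), F (dGen n)⁆ = det2 (toC n) (toC m) • F (dGen (m + n))) (x y : VirA) :
    F ⁅x, y⁆ = ⁅F x, F y⁆ := by
  have ext : ∀ x, (∀ n, F ⁅x, tElt n⁆ = ⁅F x, F (tElt n)⁆) →
      (∀ m, m ≠ 0 → F ⁅x, dGen m⁆ = ⁅F x, F (dGen m)⁆) → ∀ y, F ⁅x, y⁆ = ⁅F x, F y⁆ :=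
    fun x ht hd => LinearMap.congr_fun (virA_ext
      (f := F.comp (LieAlgebra.ad ℂ VirA x)) (g := LinearMap.comp (LieAlgebra.ad ℂ L (F x)) F)
      ht hd)
  have hdt' : ∀ m n, m ≠ 0 → F ⁅dGen m, tElt n⁆ = ⁅F (dGen m), F (tElt n)⁆ := fun m n hm => by
    rw [dGen_lie_tElt, map_smul, hdt m n hm]
  have ht : ∀ n y, F ⁅tElt n, y⁆ = ⁅F (tElt n), F y⁆ := fun n =>
    ext _ (fun k => by rw [tElt_lie_tElt, map_zero, htt]) fun m hm => by
      rw [← lie_skew, map_neg, hdt' m n hm, lie_skew]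
  have hd : ∀ m, m ≠ 0 → ∀ y, F ⁅dGen m, y⁆ = ⁅F (dGen m), F y⁆ := fun m hm =>
    ext _ (fun n => hdt' m n hm) fun k hk => by rw [dGen_lie_dGen, map_smul, hdd m k hm hk]
  refine ext x (fun n => ?_) (fun m hm => ?_) y
  · rw [← lie_skew, map_neg, ht, lie_skew]
  · rw [← lie_skew, map_neg, hd m hm, lie_skew]

variable {U : Type*} [AddCommGroup U] [Module ℂ U]

lemma tensor_ext {M : Type*} [AddCommGroup M] [Module ℂ M] {f g : Laurent ⊗[ℂ] U →ₗ[ℂ] M}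
    (h : ∀ n v, f (mono n ⊗ₜ v) = g (mono n ⊗ₜ v)) : f = g :=
  TensorProduct.ext (linearMap_ext fun n => LinearMap.ext (h n))

/-- The operator of multiplication by `λ a` on `A ⊗ U`. -/
def tensorT (lam : ℂ) (U : Type*) [AddCommGroup U] [Module ℂ U] :
    Laurent →ₗ[ℂ] Module.End ℂ (Laurent ⊗[ℂ] U) :=
  lam • (LinearMap.rTensorHom U).comp (LinearMap.mul ℂ Laurent)

lemma tensorT_mono (lam : ℂ) (m n : ℤ × ℤ) (v : U) :
    tensorT lam U (mono m) (mono n ⊗ₜ v) = lam • (mono (m + n) ⊗ₜ[ℂ] v) := by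
  simp [tensorT, mono_mul]

/-- The operator on `A ⊗ U` by which `d_m` acts. -/
def tensorD (ρ : BlockPlus →ₗ⁅ℂ⁆ Module.End ℂ U) (m : ℤ × ℤ) : Module.End ℂ (Laurent ⊗[ℂ] U) :=
  (dDer m).toLinearMap.rTensor U + TensorProduct.map (LinearMap.mul ℂ Laurent (mono m)) (polyOp ρ m)

lemma tensorD_mono (ρ : BlockPlus →ₗ⁅ℂ⁆ Module.End ℂ U) (m n : ℤ × ℤ) (v : U) :
    tensorD ρ m (mono n ⊗ₜ v) =
      mono (m + n) ⊗ₜ[ℂ] (det2 (toC n) (toC m) • v + polyOp ρ m v) := by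
  simp [tensorD, mono_mul, dDer_mono, TensorProduct.tmul_add, TensorProduct.smul_tmul']

/-- The linear map `𝒢 ⋉ A → End (A ⊗ U)` of the action. -/
def tensorLin (lam : ℂ) (ρ : BlockPlus →ₗ⁅ℂ⁆ Module.End ℂ U) :
    VirA →ₗ[ℂ] Module.End ℂ (Laurent ⊗[ℂ] U) where
  toFun x := tensorT lam U x.left + virBasis.constr ℂ (fun m => tensorD ρ m.1) x.right
  map_add' x y := by
    rw [LieAlgebra.SemiDirectSum.add_eq_mk, map_add, map_add]
    abel
  map_smul' r x := by
    rw [LieAlgebra.SemiDirectSum.smul_eq_mk, map_smul, map_smul, RingHom.id_apply, smul_add]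

lemma tensorLin_tElt (lam : ℂ) (ρ : BlockPlus →ₗ⁅ℂ⁆ Module.End ℂ U) (n : ℤ × ℤ) :
    tensorLin lam ρ (tElt n) = tensorT lam U (mono n) := by
  change tensorT lam U (mono n) + virBasis.constr ℂ (fun m => tensorD ρ m.1) 0 = _
  rw [map_zero, add_zero]

lemma tensorLin_dGen (lam : ℂ) (ρ : BlockPlus →ₗ⁅ℂ⁆ Module.End ℂ U) {m : ℤ × ℤ} (hm : m ≠ 0) :
    tensorLin lam ρ (dGen m) = tensorD ρ m := by
  change tensorT lam U 0 +
    virBasis.constr ℂ (fun m => tensorD ρ m.1) (⟨dDer m, dDer_mem_Vir m⟩ : Vir) = _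
  rw [map_zero, zero_add, ← virBasis_apply ⟨m, hm⟩, Module.Basis.constr_basis]

lemma tensorT_lie_tensorT (lam : ℂ) (m n : ℤ × ℤ) :
    ⁅tensorT lam U (mono m), tensorT lam U (mono n)⁆ = 0 := by
  refine tensor_ext fun k v => ?_
  change tensorT lam U (mono m) (tensorT lam U (mono n) (mono k ⊗ₜ v)) -
    tensorT lam U (mono n) (tensorT lam U (mono m) (mono k ⊗ₜ v)) = 0
  simp only [tensorT_mono, map_smul]
  rw [add_left_comm, sub_self]

lemma tensorD_lie_tensorT (lam : ℂ) (ρ : BlockPlus →ₗ⁅ℂ⁆ Module.End ℂ U) (m n : ℤ × ℤ) :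
    ⁅tensorD ρ m, tensorT lam U (mono n)⁆ =
      det2 (toC n) (toC m) • tensorT lam U (mono (m + n)) := by
  refine tensor_ext fun k v => ?_
  change tensorD ρ m (tensorT lam U (mono n) (mono k ⊗ₜ v)) -
    tensorT lam U (mono n) (tensorD ρ m (mono k ⊗ₜ v)) =
    det2 (toC n) (toC m) • tensorT lam U (mono (m + n)) (mono k ⊗ₜ v)
  simp only [tensorT_mono, tensorD_mono, map_smul]
  rw [add_left_comm n m k, add_assoc, ← TensorProduct.tmul_smul, ← TensorProduct.tmul_smul,
    ← TensorProduct.tmul_smul, ← TensorProduct.tmul_smul, ← TensorProduct.tmul_sub]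
  congr 1
  simp only [det2, toC, Prod.fst_add, Prod.snd_add]
  push_cast
  module

lemma tensorD_lie_tensorD [Module.Finite ℂ U] (ρ : BlockPlus →ₗ⁅ℂ⁆ Module.End ℂ U)
    (m n : ℤ × ℤ) :
    ⁅tensorD ρ m, tensorD ρ n⁆ = det2 (toC n) (toC m) • tensorD ρ (m + n) := by
  refine tensor_ext fun k v => ?_
  change tensorD ρ m (tensorD ρ n (mono k ⊗ₜ v)) - tensorD ρ n (tensorD ρ m (mono k ⊗ₜ v)) =
    det2 (toC n) (toC m) • tensorD ρ (m + n) (mono k ⊗ₜ v)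
  simp only [tensorD_mono]
  rw [add_left_comm n m k, ← TensorProduct.tmul_sub, ← TensorProduct.tmul_smul, add_assoc]
  congr 1
  have h := LinearMap.congr_fun (polyOp_lie ρ m n) v
  rw [LieRing.of_associative_ring_bracket, LinearMap.sub_apply, Module.End.mul_apply,
    Module.End.mul_apply, LinearMap.smul_apply, LinearMap.sub_apply, LinearMap.sub_apply,
    sub_eq_iff_eq_add] at h
  simp only [map_add, map_smul, h]
  simp only [det2, toC, Prod.fst_add, Prod.snd_add]
  push_cast
  module

/-- The action of `𝒢 ⋉ A` on `A ⊗ U`. -/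
def tensorAction (lam : ℂ) [Module.Finite ℂ U] (ρ : BlockPlus →ₗ⁅ℂ⁆ Module.End ℂ U) :
    VirA →ₗ⁅ℂ⁆ Module.End ℂ (Laurent ⊗[ℂ] U) where
  __ := tensorLin lam ρ
  map_lie' {x y} := by
    refine map_lie_of_generators (L := Module.End ℂ (Laurent ⊗[ℂ] U)) (tensorLin lam ρ)
      (fun m n => ?_) (fun m n hm => ?_) (fun m n hm hn => ?_) x y
    · rw [tensorLin_tElt, tensorLin_tElt, tensorT_lie_tensorT]
    · rw [tensorLin_tElt, tensorLin_tElt, tensorLin_dGen lam ρ hm, tensorD_lie_tensorT]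
    · rw [tensorLin_dGen lam ρ hm, tensorLin_dGen lam ρ hn, tensorD_lie_tensorD]
      by_cases h : m + n = 0
      · have : det2 (toC n) (toC m) = 0 := by
          rw [eq_neg_of_add_eq_zero_right h]
          simp only [det2, toC, Prod.fst_neg, Prod.snd_neg]
          push_cast
          ring
        rw [this, zero_smul, zero_smul]
      · rw [tensorLin_dGen lam ρ h]

lemma existsUnique_isBlockTensorAction (lam : ℂ) [Module.Finite ℂ U]
    (ρ : BlockPlus →ₗ⁅ℂ⁆ Module.End ℂ U) : ∃! Φ, IsBlockTensorAction lam ρ Φ := by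
  refine ⟨tensorAction lam ρ, ⟨fun m n v => ?_, fun m hm n v => ?_⟩, fun Φ hΦ => ?_⟩
  · change tensorLin lam ρ (tElt m) _ = _
    rw [tensorLin_tElt, tensorT_mono]
  · change tensorLin lam ρ (dGen m) _ = _
    rw [tensorLin_dGen lam ρ hm, tensorD_mono]
  · refine virA_hom_ext (fun n => tensor_ext fun k v => ?_) fun m hm => tensor_ext fun k v => ?_
    · change _ = tensorLin lam ρ (tElt n) _
      rw [tensorLin_tElt, tensorT_mono, hΦ.1]
    · change _ = tensorLin lam ρ (dGen m) _
      rw [tensorLin_dGen lam ρ hm, tensorD_mono, ← hΦ.2 m hm]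
      rfl

end Tensor

section TensorJet

variable {U : Type*} [AddCommGroup U] [Module ℂ U]

/-- The components `t^n ⊗ U` are the eigenspaces of an operator with distinct eigenvalues
`n(1) + i n(2)`. -/
lemma isInternal_tensorGr (U : Type*) [AddCommGroup U] [Module ℂ U] :
    DirectSum.IsInternal (tensorGr U) := by
  rw [DirectSum.isInternal_submodule_iff_iSupIndep_and_iSup_eq_top]
  constructor
  · set c : ℤ × ℤ → ℂ := fun n => n.1 + n.2 * Complex.I with hc
    have hinj : Function.Injective c := by
      intro m n h
      have h1 := congrArg Complex.re h
      have h2 := congrArg Complex.im h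
      simp only [hc, Complex.add_re, Complex.intCast_re, Complex.mul_re, Complex.I_re, mul_zero,
        Complex.intCast_im, Complex.I_im, mul_one, sub_zero, add_zero, Complex.add_im,
        Complex.mul_im, zero_add] at h1 h2
      exact Prod.ext (by exact_mod_cast h1) (by exact_mod_cast h2)
    set E : Module.End ℂ (Laurent ⊗[ℂ] U) := (scaleLin c).rTensor U
    refine ((Module.End.eigenspaces_iSupIndep E).comp hinj).mono fun n => ?_
    rintro _ ⟨v, rfl⟩
    refine Module.End.mem_eigenspace_iff.mpr ?_
    change scaleLin c (mono n) ⊗ₜ v = _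
    rw [scaleLin_mono, ← TensorProduct.smul_tmul']
    rfl
  · rw [eq_top_iff]
    have h : (⨆ n, tensorGr U n).mkQ = 0 := tensor_ext fun n v =>
      (Submodule.Quotient.mk_eq_zero _).mpr (Submodule.mem_iSup_of_mem n ⟨v, rfl⟩)
    intro x _
    exact (Submodule.Quotient.mk_eq_zero _).mp (LinearMap.congr_fun h x)

variable {lam : ℂ} {ρ : BlockPlus →ₗ⁅ℂ⁆ Module.End ℂ U}
  {Φ : VirA →ₗ⁅ℂ⁆ Module.End ℂ (Laurent ⊗[ℂ] U)}

lemma IsBlockTensorAction.isJet [Module.Finite ℂ U] (hlam : lam ≠ 0)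
    (hΦ : IsBlockTensorAction lam ρ Φ) : IsJet lam Φ (tensorGr U) := by
  have hquasi : ∀ m n x, Φ (tElt m) (Φ (tElt n) x) = lam • Φ (tElt (m + n)) x := by
    intro m n
    refine LinearMap.congr_fun (f := (Φ (tElt m)).comp (Φ (tElt n)))
      (g := lam • Φ (tElt (m + n))) (tensor_ext fun k v => ?_)
    rw [LinearMap.comp_apply, LinearMap.smul_apply, hΦ.1, map_smul, hΦ.1, hΦ.1, add_assoc]
  have hzero : ∀ x, Φ (tElt 0) x = lam • x := by
    refine LinearMap.congr_fun (f := Φ (tElt 0)) (g := lam • LinearMap.id)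
      (tensor_ext fun k v => ?_)
    rw [hΦ.1, zero_add]
    rfl
  refine ⟨isInternal_tensorGr U, ?_, ?_, ⟨Module.finrank ℂ U, fun n => ⟨?_, ?_⟩⟩, fun m _ => ?_,
    fun m n _ _ _ => hquasi m n, hzero⟩
  · rintro m n _ ⟨v, rfl⟩
    rw [TensorProduct.mk_apply, hΦ.1]
    exact Submodule.smul_mem _ _ ⟨v, rfl⟩
  · rintro m hm n _ ⟨v, rfl⟩
    rw [TensorProduct.mk_apply, hΦ.2 m hm]
    exact ⟨_, rfl⟩
  · exact Module.Finite.range _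
  · exact LinearMap.finrank_range_le _
  · have hinv : ∀ m x, Φ (tElt m) (Φ (tElt (-m)) x) = (lam * lam) • x := fun m x => by
      rw [hquasi, add_neg_cancel, hzero, smul_smul]
    have hl : lam * lam ≠ 0 := mul_ne_zero hlam hlam
    constructor
    · rw [injective_iff_map_eq_zero]
      intro x hx
      have h := hinv (-m) x
      rw [neg_neg, hx, map_zero] at h
      exact (smul_eq_zero.mp h.symm).resolve_left hl
    · intro x
      refine ⟨Φ (tElt (-m)) ((lam * lam)⁻¹ • x), ?_⟩
      rw [hinv, smul_smul, mul_inv_cancel₀ hl, one_smul]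

lemma mk_mono_injective (n : ℤ × ℤ) :
    Function.Injective (TensorProduct.mk ℂ Laurent U (mono n)) := by
  refine Function.LeftInverse.injective
    (g := (TensorProduct.lid ℂ U).toLinearMap.comp ((coeffLin n).rTensor U)) fun v => ?_
  simp [coeffLin_mono]

/-- Transport of a representation along a linear isomorphism. -/
def transport {L : Type*} [LieRing L] [LieAlgebra ℂ L] {W : Type*} [AddCommGroup W] [Module ℂ W]
    (g : U ≃ₗ[ℂ] W) (ρ : L →ₗ⁅ℂ⁆ Module.End ℂ U) : L →ₗ⁅ℂ⁆ Module.End ℂ W :=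
  g.lieConj.toLieHom.comp ρ

lemma intertwines_transport {L : Type*} [LieRing L] [LieAlgebra ℂ L] {W : Type*} [AddCommGroup W]
    [Module ℂ W] (g : U ≃ₗ[ℂ] W) (ρ : L →ₗ⁅ℂ⁆ Module.End ℂ U) :
    Intertwines ρ (transport g ρ) g := by
  intro x v
  change _ = g (ρ x (g.symm (g v)))
  rw [LinearEquiv.symm_apply_apply]

section Intertwines

variable {L : Type*} [LieRing L] [LieAlgebra ℂ L] {W : Type*} [AddCommGroup W] [Module ℂ W]
  {τ : L →ₗ⁅ℂ⁆ Module.End ℂ U} {σ : L →ₗ⁅ℂ⁆ Module.End ℂ W} {g : U ≃ₗ[ℂ] W}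

lemma Intertwines.symm (h : Intertwines τ σ g) : Intertwines σ τ g.symm := fun x w => by
  rw [LinearEquiv.symm_apply_eq, h, LinearEquiv.apply_symm_apply]

lemma Intertwines.isInvariant_comap (h : Intertwines τ σ g) {S : Submodule ℂ W}
    (hS : IsInvariant σ S) : IsInvariant τ (Submodule.orderIsoMapComap g |>.symm S) := by
  intro x v hv
  change g (τ x v) ∈ S
  rw [h]
  exact hS x _ hv

lemma Intertwines.isIrreducibleRep (h : Intertwines τ σ g) (hτ : IsIrreducibleRep τ) :
    IsIrreducibleRep σ := by
  have := hτ.1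
  refine ⟨g.symm.toEquiv.nontrivial, fun S hS => ?_⟩
  exact (hτ.2 _ (h.isInvariant_comap hS)).imp (map_eq_bot_iff _).mp (map_eq_top_iff _).mp

lemma Intertwines.isIndecomposableRep (h : Intertwines τ σ g) (hτ : IsIndecomposableRep τ) :
    IsIndecomposableRep σ := by
  have := hτ.1
  refine ⟨g.symm.toEquiv.nontrivial, fun S T hS hT hST => ?_⟩
  exact (hτ.2 _ _ (h.isInvariant_comap hS) (h.isInvariant_comap hT)
    ((OrderIso.isCompl_iff _).mp hST)).imp (map_eq_bot_iff _).mp (map_eq_bot_iff _).mp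

lemma Intertwines.polyOp [Module.Finite ℂ U] {W : Type*} [AddCommGroup W] [Module ℂ W]
    {ρ : BlockPlus →ₗ⁅ℂ⁆ Module.End ℂ U} {σ : BlockPlus →ₗ⁅ℂ⁆ Module.End ℂ W} {g : U ≃ₗ[ℂ] W}
    (h : Intertwines ρ σ g) (m : ℤ × ℤ) (v : U) : g (polyOp ρ m v) = polyOp σ m (g v) := by
  have : Module.Finite ℂ W := Module.Finite.equiv g
  obtain ⟨K, -, hK⟩ := exists_boxSupported ρ
  obtain ⟨K', -, hK'⟩ := exists_boxSupported σ
  rw [polyOp_apply_eq_jetSum ρ (hK.mono (le_max_left K K')),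
    polyOp_apply_eq_jetSum σ (hK'.mono (le_max_right K K'))]
  refine (map_jetSum g.toLinearMap _ m _).trans ?_
  congr 1
  funext i
  exact h _ v

end Intertwines

/-- The zero component of `A ⊗ U` is isomorphic to `U`. -/
lemma exists_isBlockAction_tensorJet {U : Type u} [AddCommGroup U] [Module ℂ U] [Module.Finite ℂ U]
    {ρ : BlockPlus →ₗ⁅ℂ⁆ Module.End ℂ U} {Φ : VirA →ₗ⁅ℂ⁆ Module.End ℂ (Laurent ⊗[ℂ] U)}
    (hlam : lam ≠ 0) (hΦ : IsBlockTensorAction lam ρ Φ) (hJ : IsJet lam Φ (tensorGr U)) :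
    ∃ (g : U ≃ₗ[ℂ] (tensorJet Φ hJ).gr 0)
      (σ : BlockPlus →ₗ⁅ℂ⁆ Module.End ℂ ((tensorJet Φ hJ).gr 0)),
      (tensorJet Φ hJ).IsBlockAction σ ∧ Intertwines ρ σ g := by
  set g : U ≃ₗ[ℂ] (tensorJet Φ hJ).gr 0 :=
    LinearEquiv.ofInjective (TensorProduct.mk ℂ Laurent U (mono 0)) (mk_mono_injective 0)
  refine ⟨g, transport g ρ, fun m hm w => ?_, intertwines_transport g ρ⟩
  obtain ⟨v, rfl⟩ := g.surjective w
  rw [← (intertwines_transport g ρ).polyOp]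
  change Φ (dElt m hm) (mono 0 ⊗ₜ v) = lam⁻¹ • Φ (tElt m) (mono 0 ⊗ₜ polyOp ρ m v)
  rw [hΦ.1, hΦ.2, smul_smul, inv_mul_cancel₀ hlam, one_smul]
  simp [det2, toC]

end TensorJet

/-! ### The correspondences between isomorphism classes -/

section Correspondence

/-- A correspondence between two types that is total on both sides and reflects and respects two
equivalence relations induces a bijection of the quotients. -/
lemma exists_quotient_equiv {α β : Type*} (r : Setoid α) (s : Setoid β) (R : α → β → Prop)
    (hl : ∀ a, ∃ b, R a b) (hr : ∀ b, ∃ a, R a b)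
    (h : ∀ a a' b b', R a b → R a' b' → (r.r a a' ↔ s.r b b')) :
    ∃ e : Quotient r ≃ Quotient s, ∀ a b, R a b → e (Quotient.mk r a) = Quotient.mk s b := by
  choose f hf using hl
  set F : Quotient r → Quotient s := Quotient.lift (fun a => Quotient.mk s (f a))
    fun a a' haa' => Quotient.sound ((h _ _ _ _ (hf a) (hf a')).mp haa')
  have hF : ∀ a b, R a b → F (Quotient.mk r a) = Quotient.mk s b := fun a b hab =>
    Quotient.sound ((h _ _ _ _ (hf a) hab).mp (r.iseqv.refl a))
  have hbij : Function.Bijective F := by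
    constructor
    · intro x y hxy
      obtain ⟨a, rfl⟩ := Quotient.exists_rep x
      obtain ⟨a', rfl⟩ := Quotient.exists_rep y
      exact Quotient.sound ((h _ _ _ _ (hf a) (hf a')).mpr (Quotient.exact hxy))
    · intro y
      obtain ⟨b, rfl⟩ := Quotient.exists_rep y
      obtain ⟨a, ha⟩ := hr b
      exact ⟨Quotient.mk r a, hF a b ha⟩
  exact ⟨Equiv.ofBijective F hbij, hF⟩

section Intertwines

variable {L : Type*} [LieRing L] [LieAlgebra ℂ L] {U V W : Type*} [AddCommGroup U] [Module ℂ U]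
  [AddCommGroup V] [Module ℂ V] [AddCommGroup W] [Module ℂ W]
  {ρ : L →ₗ⁅ℂ⁆ Module.End ℂ U} {σ : L →ₗ⁅ℂ⁆ Module.End ℂ V} {τ : L →ₗ⁅ℂ⁆ Module.End ℂ W}

lemma intertwines_refl (ρ : L →ₗ⁅ℂ⁆ Module.End ℂ U) : Intertwines ρ ρ (LinearEquiv.refl ℂ U) :=
  fun _ _ => rfl

lemma Intertwines.trans {f : U ≃ₗ[ℂ] V} {g : V ≃ₗ[ℂ] W} (hf : Intertwines ρ σ f)
    (hg : Intertwines σ τ g) : Intertwines ρ τ (f.trans g) := fun x v => by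
  rw [LinearEquiv.trans_apply, hf, hg, LinearEquiv.trans_apply]

end Intertwines

/-- The zero component of the jet module `V`, with an action induced by `V`, is isomorphic to the
`𝓑₊`-module `U`. -/
def IsBlockFiber {lam : ℂ} (V : JetModule.{u} lam) (U : LieFDRep.{u} BlockPlus) : Prop :=
  ∃ ρ, V.IsBlockAction ρ ∧ ∃ g : V.gr 0 ≃ₗ[ℂ] U.carrier, Intertwines ρ U.action g

/-- The zero component of the jet module `V`, with an action induced by `V`, is isomorphic to the
`(sl₂ ⊕ ℂ z₁ ⊕ ℂ z₂)`-module `U`. -/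
def IsSlFiber {lam : ℂ} (V : JetModule.{u} lam) (U : LieFDRep.{u} SlZ) : Prop :=
  ∃ τ, V.IsSlAction τ ∧ ∃ g : V.gr 0 ≃ₗ[ℂ] U.carrier, Intertwines τ U.action g

/-- A module over `sl₂ ⊕ ℂ z₁ ⊕ ℂ z₂` as a `𝓑₊`-module, through `blockProj`. -/
def LieFDRep.block (U : LieFDRep.{u} SlZ) : LieFDRep.{u} BlockPlus where
  carrier := U.carrier
  action := U.action.comp blockProj

variable {lam : ℂ}

lemma isSlFiber_iff {V : JetModule.{u} lam} {U : LieFDRep.{u} SlZ} :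
    IsSlFiber V U ↔ IsBlockFiber V U.block := by
  constructor
  · rintro ⟨τ, hτ, g, hg⟩
    exact ⟨_, JetModule.isSlAction_iff.mp hτ, g, intertwines_comp_blockProj.mpr hg⟩
  · rintro ⟨ρ, hρ, (g : V.gr 0 ≃ₗ[ℂ] U.carrier), hg⟩
    have h : Intertwines ((transport g.symm U.action).comp blockProj) (U.action.comp blockProj) g :=
      intertwines_comp_blockProj.mpr (intertwines_transport g.symm U.action).symm
    have e : (transport g.symm U.action).comp blockProj = ρ := by
      refine LieHom.ext fun x => LinearMap.ext fun v => g.injective ?_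
      exact (h x v).trans (hg x v).symm
    exact ⟨transport g.symm U.action, JetModule.isSlAction_iff.mpr (e ▸ hρ), g,
      (intertwines_transport g.symm U.action).symm⟩

lemma IsBlockFiber.setoid_iff (hlam : lam ≠ 0) {V V' : JetModule.{u} lam}
    {U U' : LieFDRep.{u} BlockPlus} (h : IsBlockFiber V U) (h' : IsBlockFiber V' U') :
    (JetModule.setoid.{u} lam).r V V' ↔ (LieFDRep.setoid.{u} BlockPlus).r U U' := by
  obtain ⟨ρ, hρ, g, hg⟩ := h
  obtain ⟨ρ', hρ', g', hg'⟩ := h'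
  rw [JetModule.setoid_iff hlam hρ hρ']
  constructor
  · rintro ⟨f, hf⟩
    exact ⟨_, (hg.symm.trans hf).trans hg'⟩
  · rintro ⟨f, hf⟩
    exact ⟨_, (hg.trans hf).trans hg'.symm⟩

lemma IsBlockFiber.isIndecomposableRep_iff (hlam : lam ≠ 0) {V : JetModule.{u} lam}
    {U : LieFDRep.{u} BlockPlus} (h : IsBlockFiber V U) :
    IsIndecomposableRep V.action ↔ IsIndecomposableRep U.action := by
  obtain ⟨ρ, hρ, g, hg⟩ := h
  rw [JetModule.isIndecomposableRep_iff hlam hρ]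
  exact ⟨hg.isIndecomposableRep, hg.symm.isIndecomposableRep⟩

lemma IsBlockFiber.isIrreducibleRep_iff (hlam : lam ≠ 0) {V : JetModule.{u} lam}
    {U : LieFDRep.{u} BlockPlus} (h : IsBlockFiber V U) :
    IsIrreducibleRep V.action ↔ IsIrreducibleRep U.action := by
  obtain ⟨ρ, hρ, g, hg⟩ := h
  rw [JetModule.isIrreducibleRep_iff hlam hρ]
  exact ⟨hg.isIrreducibleRep, hg.symm.isIrreducibleRep⟩

lemma isBlockFiber_fiber {V : JetModule.{u} lam} {ρ : BlockPlus →ₗ⁅ℂ⁆ Module.End ℂ (V.gr 0)}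
    (hρ : V.IsBlockAction ρ) : IsBlockFiber V (V.fiber ρ) :=
  ⟨ρ, hρ, LinearEquiv.refl ℂ _, intertwines_refl ρ⟩

lemma isSlFiber_fiber {V : JetModule.{u} lam} {τ : SlZ →ₗ⁅ℂ⁆ Module.End ℂ (V.gr 0)}
    (hτ : V.IsSlAction τ) : IsSlFiber V (V.fiber τ) :=
  ⟨τ, hτ, LinearEquiv.refl ℂ _, intertwines_refl τ⟩

lemma isBlockFiber_tensorJet (hlam : lam ≠ 0) (U : LieFDRep.{u} BlockPlus)
    {Φ : VirA →ₗ⁅ℂ⁆ Module.End ℂ (Laurent ⊗[ℂ] U.carrier)}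
    (hΦ : IsBlockTensorAction lam U.action Φ) :
    IsBlockFiber (tensorJet Φ (hΦ.isJet hlam)) U := by
  obtain ⟨g, σ, hσ, hg⟩ := exists_isBlockAction_tensorJet hlam hΦ (hΦ.isJet hlam)
  exact ⟨σ, hσ, g.symm, hg.symm⟩

lemma exists_equiv_indecomposable (hlam : lam ≠ 0) :
    ∃ e : IndecJetClass.{u} lam ≃ IndecRepClass.{u} BlockPlus,
      ∀ V U (hV : IsIndecomposableRep V.action) (hU : IsIndecomposableRep U.action),
        IsBlockFiber V U → e (IndecJetClass.mk V hV) = IndecRepClass.mk U hU := by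
  have hl : ∀ V : {V : JetModule.{u} lam // IsIndecomposableRep V.action},
      ∃ U : {U : LieFDRep.{u} BlockPlus // IsIndecomposableRep U.action}, IsBlockFiber V.1 U.1 := by
    rintro ⟨V, hV⟩
    obtain ⟨ρ, hρ, -⟩ := V.existsUnique_isBlockAction hlam
    have h := isBlockFiber_fiber hρ
    exact ⟨⟨V.fiber ρ, (h.isIndecomposableRep_iff hlam).mp hV⟩, h⟩
  have hr : ∀ U : {U : LieFDRep.{u} BlockPlus // IsIndecomposableRep U.action},
      ∃ V : {V : JetModule.{u} lam // IsIndecomposableRep V.action}, IsBlockFiber V.1 U.1 := by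
    rintro ⟨U, hU⟩
    obtain ⟨Φ, hΦ, -⟩ := existsUnique_isBlockTensorAction lam U.action
    have h := isBlockFiber_tensorJet hlam U hΦ
    exact ⟨⟨_, (h.isIndecomposableRep_iff hlam).mpr hU⟩, h⟩
  obtain ⟨e, he⟩ := exists_quotient_equiv
    ((JetModule.setoid.{u} lam).comap
      (Subtype.val : {V : JetModule.{u} lam // IsIndecomposableRep V.action} → JetModule.{u} lam))
    ((LieFDRep.setoid.{u} BlockPlus).comap
      (Subtype.val : {U : LieFDRep.{u} BlockPlus // IsIndecomposableRep U.action} → _))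
    (fun V U => IsBlockFiber V.1 U.1) hl hr fun V V' U U' h h' => h.setoid_iff hlam h'
  exact ⟨e, fun V U hV hU h => he ⟨V, hV⟩ ⟨U, hU⟩ h⟩

lemma IsSlFiber.isIrreducibleRep_iff (hlam : lam ≠ 0) {V : JetModule.{u} lam}
    {U : LieFDRep.{u} SlZ} (h : IsSlFiber V U) :
    IsIrreducibleRep V.action ↔ IsIrreducibleRep U.action :=
  ((isSlFiber_iff.mp h).isIrreducibleRep_iff hlam).trans isIrreducibleRep_comp_blockProj

lemma IsSlFiber.setoid_iff (hlam : lam ≠ 0) {V V' : JetModule.{u} lam}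
    {U U' : LieFDRep.{u} SlZ} (h : IsSlFiber V U) (h' : IsSlFiber V' U') :
    (JetModule.setoid.{u} lam).r V V' ↔ (LieFDRep.setoid.{u} SlZ).r U U' :=
  ((isSlFiber_iff.mp h).setoid_iff hlam (isSlFiber_iff.mp h')).trans
    (exists_congr fun _ => intertwines_comp_blockProj)

lemma isSlFiber_tensorJet (hlam : lam ≠ 0) (U : LieFDRep.{u} SlZ)
    {Φ : VirA →ₗ⁅ℂ⁆ Module.End ℂ (Laurent ⊗[ℂ] U.carrier)}
    (hΦ : IsBlockTensorAction lam (U.action.comp blockProj) Φ) :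
    IsSlFiber (tensorJet Φ (hΦ.isJet hlam)) U :=
  isSlFiber_iff.mpr (isBlockFiber_tensorJet hlam U.block hΦ)

lemma exists_equiv_irreducible (hlam : lam ≠ 0) :
    ∃ e : IrrJetClass.{u} lam ≃ IrrRepClass.{u} SlZ,
      ∀ V U (hV : IsIrreducibleRep V.action) (hU : IsIrreducibleRep U.action),
        IsSlFiber V U → e (IrrJetClass.mk V hV) = IrrRepClass.mk U hU := by
  have hl : ∀ V : {V : JetModule.{u} lam // IsIrreducibleRep V.action},
      ∃ U : {U : LieFDRep.{u} SlZ // IsIrreducibleRep U.action}, IsSlFiber V.1 U.1 := by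
    rintro ⟨V, hV⟩
    obtain ⟨τ, hτ, -⟩ := V.existsUnique_isSlAction hlam hV
    have h := isSlFiber_fiber hτ
    exact ⟨⟨V.fiber τ, (h.isIrreducibleRep_iff hlam).mp hV⟩, h⟩
  have hr : ∀ U : {U : LieFDRep.{u} SlZ // IsIrreducibleRep U.action},
      ∃ V : {V : JetModule.{u} lam // IsIrreducibleRep V.action}, IsSlFiber V.1 U.1 := by
    rintro ⟨U, hU⟩
    obtain ⟨Φ, hΦ, -⟩ := existsUnique_isBlockTensorAction lam (U.action.comp blockProj)
    have h := isSlFiber_tensorJet hlam U hΦ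
    exact ⟨⟨_, (h.isIrreducibleRep_iff hlam).mpr hU⟩, h⟩
  obtain ⟨e, he⟩ := exists_quotient_equiv
    ((JetModule.setoid.{u} lam).comap
      (Subtype.val : {V : JetModule.{u} lam // IsIrreducibleRep V.action} → JetModule.{u} lam))
    ((LieFDRep.setoid.{u} SlZ).comap
      (Subtype.val : {U : LieFDRep.{u} SlZ // IsIrreducibleRep U.action} → _))
    (fun V U => IsSlFiber V.1 U.1) hl hr fun V V' U U' h h' => h.setoid_iff hlam h'
  exact ⟨e, fun V U hV hU h => he ⟨V, hV⟩ ⟨U, hU⟩ h⟩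

end Correspondence

end VirasoroJet

end

open VirasoroJet

theorem mainTheorem6 (lam : ℂ) (hlam : lam ≠ 0) :
    -- `V₀` carries a unique `𝓑₊`-module structure that describes the action of the `d_m`
    (∀ V : JetModule.{u} lam, IsIndecomposableRep V.action → ∃! ρ, V.IsBlockAction ρ) ∧
    -- for a finite-dimensional `𝓑₊`-module `U`, only finitely many `D_i` act nontrivially, and the
    -- formulas define an action of `𝒢 ⋉ A` on `A ⊗ U`
    (∀ U : LieFDRep.{u} BlockPlus, {i : ℕ × ℕ | U.action (BlockPlus.D i) ≠ 0}.Finite ∧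
      ∃! Φ, IsBlockTensorAction lam U.action Φ) ∧
    -- the one-to-one correspondence of indecomposable modules
    (∃ e : IndecJetClass.{u} lam ≃ IndecRepClass.{u} BlockPlus,
      (∀ (V : JetModule.{u} lam) (hV : IsIndecomposableRep V.action) (ρ), V.IsBlockAction ρ →
        ∃ h : IsIndecomposableRep (V.fiber ρ).action,
          e (IndecJetClass.mk V hV) = IndecRepClass.mk (V.fiber ρ) h) ∧
      (∀ (U : LieFDRep.{u} BlockPlus) (hU : IsIndecomposableRep U.action) (Φ),
        IsBlockTensorAction lam U.action Φ →
        ∃ (hJ : IsJet lam Φ (tensorGr U.carrier)) (h : IsIndecomposableRep (tensorJet Φ hJ).action),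
          e.symm (IndecRepClass.mk U hU) = IndecJetClass.mk (tensorJet Φ hJ) h)) ∧
    -- isomorphism up to regrading amounts to a shift of `D_{(1,0)}`, `D_{(0,1)}`
    (∀ V W : JetModule.{u} lam, IsIndecomposableRep V.action → IsIndecomposableRep W.action →
      ∀ ρ σ, V.IsBlockAction ρ → W.IsBlockAction σ →
      (V.RegradedIso W ↔ ∃ (n : ℤ × ℤ) (f : V.gr 0 ≃ₗ[ℂ] W.gr 0), ∀ (i : ℕ × ℕ) (v : V.gr 0),
        f (ρ (BlockPlus.D i) v) = σ (BlockPlus.D i) (f v) + shiftScalar n i • f v)) ∧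
    -- `V₀` for irreducible `V`, as a module over `sl₂ ⊕ ℂ z₁ ⊕ ℂ z₂` and over `𝓑₊`
    (∀ V : JetModule.{u} lam, IsIrreducibleRep V.action →
      (∃! ρ, V.IsSlAction ρ) ∧
      ∀ ρ σ, V.IsSlAction ρ → V.IsBlockAction σ →
        ∀ i, σ (BlockPlus.D i) = ρ (blockToSl i)) ∧
    -- on an irreducible `U`, the central elements act as scalars, and the formulas define an action
    -- of `𝒢 ⋉ A` on `A ⊗ U`
    (∀ U : LieFDRep.{u} SlZ, IsIrreducibleRep U.action →
      (∃! α : ℂ × ℂ, HasCentralWeight U.action α) ∧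
      ∀ α : ℂ × ℂ, HasCentralWeight U.action α → ∃! Φ, IsSlTensorAction lam α U.action Φ) ∧
    -- the one-to-one correspondence of irreducible modules
    (∃ e : IrrJetClass.{u} lam ≃ IrrRepClass.{u} SlZ,
      (∀ (V : JetModule.{u} lam) (hV : IsIrreducibleRep V.action) (ρ), V.IsSlAction ρ →
        ∃ h : IsIrreducibleRep (V.fiber ρ).action,
          e (IrrJetClass.mk V hV) = IrrRepClass.mk (V.fiber ρ) h) ∧
      (∀ (U : LieFDRep.{u} SlZ) (hU : IsIrreducibleRep U.action) (α : ℂ × ℂ) (Φ),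
        HasCentralWeight U.action α → IsSlTensorAction lam α U.action Φ →
        ∃ (hJ : IsJet lam Φ (tensorGr U.carrier)) (h : IsIrreducibleRep (tensorJet Φ hJ).action),
          e.symm (IrrRepClass.mk U hU) = IrrJetClass.mk (tensorJet Φ hJ) h)) := by
  refine ⟨fun V _ => V.existsUnique_isBlockAction hlam, fun U => ⟨finite_D_ne_zero U.action,
    existsUnique_isBlockTensorAction lam U.action⟩, ?_,
    fun V W _ _ ρ σ hρ hσ => JetModule.regradedIso_iff hlam hρ hσ,
    fun V hV => ⟨V.existsUnique_isSlAction hlam hV, fun ρ σ hρ hσ i => ?_⟩,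
    fun U hU => ⟨existsUnique_hasCentralWeight hU, fun α hα => ?_⟩, ?_⟩
  · obtain ⟨e, he⟩ := exists_equiv_indecomposable hlam
    refine ⟨e, fun V hV ρ hρ => ?_, fun U hU Φ hΦ => ?_⟩
    · have h := isBlockFiber_fiber hρ
      exact ⟨(h.isIndecomposableRep_iff hlam).mp hV, he _ _ _ _ h⟩
    · have h := isBlockFiber_tensorJet hlam U hΦ
      exact ⟨hΦ.isJet hlam, (h.isIndecomposableRep_iff hlam).mpr hU,
        (Equiv.symm_apply_eq e).mpr (he _ _ _ _ h).symm⟩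
  · rw [(V.existsUnique_isBlockAction hlam).unique hσ (JetModule.isSlAction_iff.mp hρ)]
    exact congrArg ρ (blockProj_D i)
  · simp only [isSlTensorAction_iff hα]
    exact existsUnique_isBlockTensorAction lam _
  · obtain ⟨e, he⟩ := exists_equiv_irreducible hlam
    refine ⟨e, fun V hV τ hτ => ?_, fun U hU α Φ hα hΦ => ?_⟩
    · have h := isSlFiber_fiber hτ
      exact ⟨(h.isIrreducibleRep_iff hlam).mp hV, he _ _ _ _ h⟩
    · rw [isSlTensorAction_iff hα] at hΦ
      have h := isSlFiber_tensorJet hlam U hΦ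
      exact ⟨hΦ.isJet hlam, (h.isIrreducibleRep_iff hlam).mpr hU,
        (Equiv.symm_apply_eq e).mpr (he _ _ _ _ h).symm⟩
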